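/- **Setting.** Let $\mathcal O,\mathcal A$ be finite nonempty sets, $A=|\mathcal A|$, and let $H\ge 1$ be the length of an episode. A *model* $f$ consists of probability distributions $\mathbb P_f(o_{h}=\cdot\mid \tau_{h-1})$ on $\mathcal O$ for all histories $\tau_{h-1}=(o_1,a_1,\dots,o_{h-1},a_{h-1})$, $h\in[H]$; after step $H$ a dummy observation $o_{H+1}$ ends the episode. A policy $\pi$ assigns to every $(\tau_{h-1},o_h)$ a distribution on $\mathcal A$. Put $\mathbb P_f(\tau_h)=\prod_{h'\le h}\mathbb P_f(o_{h'}\mid\tau_{h'-1})$, $\pi(\tau_h)=\prod_{h'\le h}\pi(a_{h'}\mid\tau_{h'-1},o_{h'})$ and $\mathbb P_f^\pi(\tau_h)=\mathbb P_f(\tau_h)\pi(\tau_h)$. The rewards $R_h(o,a)\ge 0$ are known and satisfy $\sum_{h=1}^H R_h(o_h,a_h)\le 1$ on every trajectory; $V_f^\pi=\sum_{\tau_H}\mathbb P^\pi_f(\tau_H)\sum_h R_h(o_h,a_h)$, $V_f=\sup_\pi V_f^\pi$, and $\pi_f$ is a policy attaining $V_f$ (chosen measurably in $f$). A *test* at step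 $h$ is $t=(o_{h:h+W-1},a_{h:h+W-2})$, $W\ge1$, $h+W-1\le H+1$ (where $o_{H+1}$ is the dummy observation), and $\mathbb P_f(t\mid\tau_{h-1})$ is the probability of seeing $o_{h:h+W-1}$ after $\tau_{h-1}$ when executing $a_{h:h+W-2}$, set to $0$ if $\mathbb P_f(\tau_{h-1})=0$. Let $\mathbb D_h=[\mathbb P_f(t\mid\tau_h)]$ (rows: all tests at step $h+1$; columns: all $\tau_h$), $d_{\mathrm{PSR},h}=\operatorname{rank}\mathbb D_h$, $d_{\mathrm{PSR}}=\max_{h\in[H]}d_{\mathrm{PSR},h}$. Finite sets $\mathcal U_h$ of tests at step $h$, $h\in[H]$, are *core test sets* of $f$ if for each test $t$ at step $h$ there are coefficients $m_u$, $u\in\mathcal U_h$, with $\mathbb P_f(t\mid\tau_{h-1})=\sum_{u\in\mathcal U_h}m_u\mathbb P_f(u\mid\tau_{h-1})$ for all $\tau_{h-1}$; $\mathcal U_{H+1}=\{o_{H+1}\}$. Let $\mathcal U_{A,h}$ be the set of action sequences occurring in $\mathcal U_h$, $U_A=\max_{h\in[H]}|\mathcal U_{A,h}|$, $\bar{\mathbb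 D}_h=[\mathbb P_f(t\mid\tau_h)]_{t\in\mathcal U_{h+1},\tau_h}$, and $$\delta_{\mathrm{PSR}}=\max_{h\in[H]}\min\{\|K\|_1\|V\|_1:\ \bar{\mathbb D}_h=KV,\ K\in\mathbb R^{|\mathcal U_{h+1}|\times d_{\mathrm{PSR},h}},\ V\in\mathbb R^{d_{\mathrm{PSR},h}\times|\mathcal O|^h|\mathcal A|^h}\},$$ where $\|\cdot\|_1$ is the operator norm for the $\ell^1$ norms. For $\alpha>0$, $f$ is an *$\alpha$-generalized regular PSR* (for given core test sets $\mathcal U_h$) if there are matrices $M_h(o,a)\in\mathbb R^{|\mathcal U_{h+1}|\times|\mathcal U_h|}$ with $[\mathbb P_f(u\mid\tau_h)\mathbb P_f(\tau_h)]_{u\in\mathcal U_{h+1}}=M_h(o_h,a_h)\cdots M_1(o_1,a_1)q_0$ for all $0\le h\le H$ and $\tau_h$, where $q_0=[\mathbb P_f(u)]_{u\in\mathcal U_1}$, such that for all $x\in\mathbb R^{|\mathcal U_h|}$ and all policies $\pi$ 1. for $h\in[H]$: $\sum_{\tau_{h:H}}|M_H(o_H,a_H)\cdots M_h(o_h,a_h)x|\,\pi(o_{h:H},a_{h:H})\le\|x\|_1/\alpha$;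 2. for $h\in[H-1]$: $\sum_{o_h,a_h}\|M_h(o_h,a_h)x\|_1\,\pi(o_h,a_h)\le\frac{|\mathcal U_{A,h+1}|}{\alpha}\|x\|_1$. Let $\mathcal H$ be a class of $\alpha$-generalized regular PSRs with common core test sets $\mathcal U_h$, let $f^*\in\mathcal H$ be the true model, $V^*=V_{f^*}$, and let $p^0$ be a prior (probability measure) on $\mathcal H$. For $f\in\mathcal H$ and $0\le h\le H-1$ the exploration policy $\pi_{\exp}(f,h)$ follows $\pi_f$ in steps $1,\dots,h-1$, plays a uniform action at step $h$ (if $h\ge1$), from step $h+1$ on executes an action sequence drawn uniformly from $\mathcal U_{A,h+1}$, and behaves arbitrarily afterwards. **Algorithm** (parameters $\eta,\gamma$). For $t=1,\dots,T$: sample $f^t\sim p^t$, where $p^t(f)\propto p^0(f)\exp\big(\gamma V_f+\sum_{s<t}\sum_{h=0}^{H-1}\eta\log\mathbb P_f(\tau_h^s)\big)$; then for each $h=0,\dots,H-1$ execute $\pi_{\exp}(f^t,h)$ in the true model to collect a trajectory $\tau_h^t$ of length $H$. Let $\mathrm{Reg}(T)=\sum_{t=1}^T(V^*-V_{f^*}^{\pi_{f^t}})$.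 Let $\omega(c,p^0)=\inf_{\epsilon>0}[c\epsilon-\log p^0(\mathcal H(\epsilon))]$ with $\mathcal H(\epsilon)=\{f\in\mathcal H: V^*-V_f\le\epsilon,\ \sup_\pi\mathrm{KL}(\mathbb P^\pi_{f^*}(\tau_H)\,\|\,\mathbb P^\pi_f(\tau_H))\le\epsilon\}$. With $d_{\mathrm{PSR}},\delta_{\mathrm{PSR}}$ taken for $f^*$, let $\iota=2\log\big(1+4d_{\mathrm{PSR}}A^2U_A^2\delta_{\mathrm{PSR}}^2T/\alpha^4\big)$. Let $d_{\mathrm{GEC}}$ be the generalized eluder coefficient, i.e. the smallest $d\ge0$ such that for all $f^1,\dots,f^T\in\mathcal H$ $$\sum_{t=1}^T\big(V_{f^t}-V_{f^*}^{\pi_{f^t}}\big)\le\Big[d\sum_{h=0}^{H-1}\sum_{t=1}^T\sum_{s=1}^{t-1}D_H^2\big(\mathbb P_{f^t}^{\pi_{\exp}(f^s,h)}(\tau_H),\mathbb P_{f^*}^{\pi_{\exp}(f^s,h)}(\tau_H)\big)\Big]^{1/2}+\sqrt{dHT},$$ where $D_H^2(P,Q)=\frac12\sum_x(\sqrt{P(x)}-\sqrt{Q(x)})^2$.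 **Theorem (Generalized Regular PSR).** There are absolute constants $C_1,C_2>0$ such that in every setting as above $$d_{\mathrm{GEC}}\le C_1\frac{d_{\mathrm{PSR}}A^3U_A^4H\iota}{\alpha^4},$$ and for every $d>0$ with $d_{\mathrm{GEC}}\le d\le C_1 d_{\mathrm{PSR}}A^3U_A^4H\iota/\alpha^4$, the algorithm with $\eta=1/2$ and $\gamma=2\sqrt{\omega(HT,p^0)\,T/d}$ satisfies, if $\omega(HT,p^0)<\infty$, $$\mathbb E[\mathrm{Reg}(T)]\le C_2\,\frac{AU_A^2H\sqrt{d_{\mathrm{PSR}}\cdot AT\,(H+\omega(HT,p^0))\cdot\iota}}{\alpha^2}.$$ Moreover, if the regret is accounted for in all $HT$ executed episodes (each of the $H$ episodes of iteration $t$ being charged $V^*-V_{f^*}^{\pi_{f^t}}$), then the same bound holds for it with the factor $T$ under the root replaced by $HT$: $$H\cdot\mathbb E[\mathrm{Reg}(T)]\le C_2\,\frac{AU_A^2H\sqrt{d_{\mathrm{PSR}}\cdot A\,HT\,(H+\omega(HT,p^0))\cdot\iota}}{\alpha^2}.$$ If $\mathcal H$ is finite and $p^0$ is the uniform distribution on $\mathcal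 H$, then both bounds hold with $\log|\mathcal H|$ in place of $\omega(HT,p^0)$ on the right-hand side. -/

import Mathlib

open MeasureTheory

noncomputable section

namespace PSR

/-- A finite history `(o₁, a₁), …, (o_k, a_k)`, in chronological order. -/
abbrev Hist (O A : Type*) := List (O × A)

/-- A full trajectory `τ_H = (o₁, a₁, …, o_H, a_H)`. -/
abbrev Traj (O A : Type*) (H : ℕ) := Fin H → O × A

/-- A (controlled) model: `trans τ o` is the probability that the next observation is `o` given the
history `τ`; `trans []` is the law of the first observation.  In an episode of length `H` only
histories of length less than `H` matter. -/
structure Model (O A : Type*) [Fintype O] where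
  trans : Hist O A → O → ℝ
  trans_nonneg : ∀ τ o, 0 ≤ trans τ o
  trans_sum : ∀ τ, ∑ o, trans τ o = 1

/-- The σ-algebra generated by all evaluations `f ↦ f.trans τ o`. -/
instance {O A : Type*} [Fintype O] : MeasurableSpace (Model O A) :=
  MeasurableSpace.comap Model.trans inferInstance

/-- A general history-dependent randomized policy: `act τ o a` is the probability of playing `a`
after the history `τ` and the current observation `o`. -/
structure Policy (O A : Type*) [Fintype A] where
  act : Hist O A → O → A → ℝ
  act_nonneg : ∀ τ o a, 0 ≤ act τ o a
  act_sum : ∀ τ o, ∑ a, act τ o a = 1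

/-- A test: a list of observation-action pairs followed by a last observation;
`none` stands for the dummy observation `o_{H+1}` that ends the episode. -/
abbrev Test (O A : Type*) := Hist O A × Option O

/-- The test consisting of the dummy observation alone. -/
def dummyTest {O A : Type*} : Test O A := ([], none)

/-- The tests that can start at step `h` of an episode of length `H`. -/
def validTests (O A : Type*) (H h : ℕ) : Set (Test O A) :=
  {t | (t.2.isSome ∧ h + t.1.length ≤ H) ∨ (t.2 = none ∧ h + t.1.length = H + 1)}

section Probabilities

variable {O A : Type*} [Fintype O] [Fintype A]

/-- Probability of the observations of the segment `seg` after the history `past`, when the actions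
of `seg` are executed. -/
def Model.segProb (f : Model O A) : Hist O A → Hist O A → ℝ
  | _, [] => 1
  | past, (o, a) :: seg => f.trans past o * f.segProb (past ++ [(o, a)]) seg

/-- `ℙ_f(τ) = ∏ ℙ_f(o_{h'} ∣ τ_{h'-1})`. -/
def Model.prob (f : Model O A) (τ : Hist O A) : ℝ := f.segProb [] τ

def Policy.segProb (π : Policy O A) : Hist O A → Hist O A → ℝ
  | _, [] => 1
  | past, (o, a) :: seg => π.act past o a * π.segProb (past ++ [(o, a)]) seg

/-- `π(τ) = ∏ π_{h'}(a_{h'} ∣ τ_{h'-1}, o_{h'})`. -/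
def Policy.prob (π : Policy O A) (τ : Hist O A) : ℝ := π.segProb [] τ

/-- `ℙ_f(t ∣ τ)`, the probability that the test `t` succeeds after `τ`; it is zero by convention if
`τ` is unreachable. -/
def Model.testProb (f : Model O A) (τ : Hist O A) (t : Test O A) : ℝ :=
  open Classical in
  if f.prob τ = 0 then 0
  else f.segProb τ t.1 * (match t.2 with
    | some o => f.trans (τ ++ t.1) o
    | none => 1)

/-- `ℙ_f^π(τ_H) = ℙ_f(τ_H) π(τ_H)`. -/
def Model.trajProb (f : Model O A) {H : ℕ} (π : Policy O A) (τ : Traj O A H) : ℝ :=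
  f.prob (List.ofFn τ) * π.prob (List.ofFn τ)

/-- `V_f^π`, the expected total reward of `π` under the model `f`. -/
def Model.value (f : Model O A) {H : ℕ} (R : Fin H → O → A → ℝ) (π : Policy O A) : ℝ :=
  ∑ τ : Traj O A H, f.trajProb π τ * ∑ i, R i (τ i).1 (τ i).2

/-- `V_f`, the optimal value of the model `f` over all history-dependent policies. -/
def Model.optValue (f : Model O A) {H : ℕ} (R : Fin H → O → A → ℝ) : ℝ :=
  ⨆ π : Policy O A, f.value R π

/-! ### Core tests, rank, generalized regularity -/

/-- The one-step system dynamics matrix `𝔻_h`: rows are the tests starting at step `h + 1`, columns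
are the histories of length `h`. -/
def dynMatrix (f : Model O A) (H h : ℕ) :
    Matrix (validTests O A H (h + 1)) (Fin h → O × A) ℝ :=
  fun t τ => f.testProb (List.ofFn τ) t.1

def psrRankAt (f : Model O A) (H h : ℕ) : ℕ := (dynMatrix f H h).rank

/-- `d_PSR = max_{h ∈ [H]} rank 𝔻_h`. -/
def psrRank (f : Model O A) (H : ℕ) : ℕ := (Finset.Icc 1 H).sup (psrRankAt f H)

/-- `U 1, …, U H` are core test sets of `f`, and `U (H+1)` consists of the dummy observation. -/
def IsCoreTestSets (f : Model O A) (H : ℕ) (U : ℕ → Finset (Test O A)) : Prop :=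
  U (H + 1) = {dummyTest} ∧
  ∀ h ∈ Finset.Icc 1 H,
    (∀ t ∈ U h, t ∈ validTests O A H h) ∧
    ∀ t ∈ validTests O A H h, ∃ m : Test O A → ℝ,
      ∀ τ : Hist O A, τ.length + 1 = h →
        f.testProb τ t = ∑ u ∈ U h, m u * f.testProb τ u

/-- Matrices `M_h(o, a)` with rows in `U (h+1)` and columns in `U h`; entries outside these index
sets are never used. -/
abbrev Operators (O A : Type*) := ℕ → O → A → Test O A → Test O A → ℝ

/-- The vector `M_{h+k-1}(o_{h+k-1}, a_{h+k-1}) ⋯ M_h(o_h, a_h) x` for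
`seg = (o_h, a_h), …, (o_{h+k-1}, a_{h+k-1})`. -/
def applyOps (U : ℕ → Finset (Test O A)) (M : Operators O A) :
    ℕ → Hist O A → (Test O A → ℝ) → (Test O A → ℝ)
  | _, [], x => x
  | h, (o, a) :: seg, x => applyOps U M (h + 1) seg (fun u => ∑ t ∈ U h, M h o a u t * x t)

/-- Observable operator representation: `M_h(o_h, a_h) ⋯ M_1(o_1, a_1) q₀ = [ℙ(t ∣ τ_h) ℙ(τ_h)]_t`
with `q₀ = [ℙ(t)]_{t ∈ U 1}`.  For `h = H` the right-hand side is `ℙ(τ_H)`. -/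
def IsOperatorRep (f : Model O A) (H : ℕ) (U : ℕ → Finset (Test O A)) (M : Operators O A) : Prop :=
  ∀ τ : Hist O A, τ.length ≤ H → ∀ u ∈ U (τ.length + 1),
    applyOps U M 1 τ (fun t => f.testProb [] t) u = f.testProb τ u * f.prob τ

/-- The set `U_{A,h}` of action sequences of the tests in `U h`. -/
def coreActions (U : ℕ → Finset (Test O A)) (h : ℕ) : Finset (List A) :=
  open Classical in (U h).image (fun t => t.1.map Prod.snd)

/-- `U_A = max_{h ∈ [H]} |U_{A,h}|`. -/
def maxCoreActions (H : ℕ) (U : ℕ → Finset (Test O A)) : ℕ :=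
  (Finset.Icc 1 H).sup (fun h => (coreActions U h).card)

/-- `f` is an `α`-generalized regular PSR of horizon `H` with core test sets `U`.
In the first condition, `applyOps U M h (o_{h:H}, a_{h:H}) x dummyTest` is the number
`m(o_{h:H}, a_{h:H}) x`, where `m(o_{h:H}, a_{h:H}) = M_H(o_H, a_H) ⋯ M_h(o_h, a_h)`. -/
def IsGeneralizedRegular (f : Model O A) (H : ℕ) (U : ℕ → Finset (Test O A)) (α : ℝ) : Prop :=
  IsCoreTestSets f H U ∧
  ∃ M : Operators O A, IsOperatorRep f H U M ∧
    (∀ h ∈ Finset.Icc 1 H, ∀ (x : Test O A → ℝ) (π : Policy O A),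
      ∑ seg : Fin (H + 1 - h) → O × A,
        |applyOps U M h (List.ofFn seg) x dummyTest| * π.prob (List.ofFn seg)
        ≤ (∑ t ∈ U h, |x t|) / α) ∧
    (∀ h ∈ Finset.Icc 1 (H - 1), ∀ (x : Test O A → ℝ) (π : Policy O A),
      ∑ oa : O × A,
        (∑ u ∈ U (h + 1), |∑ t ∈ U h, M h oa.1 oa.2 u t * x t|) * π.act [] oa.1 oa.2
        ≤ (coreActions U (h + 1)).card / α * ∑ t ∈ U h, |x t|)

/-- The matrix `1`-norm (operator norm with respect to the `ℓ¹` norms), i.e. the largest absolute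
column sum. -/
def matNormOne {m n : Type*} [Fintype m] (K : Matrix m n ℝ) : ℝ := ⨆ j, ∑ i, |K i j|

/-- The matrix of predictive states: the rows of `𝔻_h` indexed by `U (h+1)`. -/
def coreMatrix (f : Model O A) (U : ℕ → Finset (Test O A)) (h : ℕ) :
    Matrix (U (h + 1)) (Fin h → O × A) ℝ :=
  fun t τ => f.testProb (List.ofFn τ) t.1

/-- `δ_PSR`: the maximum over `h ∈ [H]` of the minimum of `‖K‖₁ ‖V‖₁` over the rank factorizations
`K V` of the matrix of predictive states. -/
def deltaPSR (f : Model O A) (H : ℕ) (U : ℕ → Finset (Test O A)) : ℝ :=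
  ⨆ h : Set.Icc 1 H, sInf {r : ℝ |
    ∃ (K : Matrix (U (h.1 + 1)) (Fin (psrRankAt f H h.1)) ℝ)
      (V : Matrix (Fin (psrRankAt f H h.1)) (Fin h.1 → O × A) ℝ),
      coreMatrix f U h.1 = K * V ∧ r = matNormOne K * matNormOne V}

/-- `ι = 2 log (1 + 4 d_PSR A² U_A² δ_PSR² T / α⁴)`. -/
def iota (f : Model O A) (H : ℕ) (U : ℕ → Finset (Test O A)) (α : ℝ) (T : ℕ) : ℝ :=
  2 * Real.log (1 + 4 * (psrRank f H : ℝ) * (Fintype.card A : ℝ) ^ 2 *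
    (maxCoreActions H U : ℝ) ^ 2 * (deltaPSR f H U) ^ 2 * (T : ℝ) / α ^ 4)

/-- The rate `A U_A² H √(d_PSR A N (H + w) ι) / α²`; here `N` is the number over which the regret is
summed, and `ι` is formed with the number `T` of iterations. -/
def regretRate (f : Model O A) (H : ℕ) (U : ℕ → Finset (Test O A)) (α : ℝ) (T : ℕ) (N w : ℝ) : ℝ :=
  (Fintype.card A : ℝ) * (maxCoreActions H U : ℝ) ^ 2 * (H : ℝ) *
    Real.sqrt ((psrRank f H : ℝ) * (Fintype.card A : ℝ) * N * ((H : ℝ) + w) * iota f H U α T) / α ^ 2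

/-- The quantity `d_PSR A³ U_A⁴ H ι / α⁴`. -/
def gecRate (f : Model O A) (H : ℕ) (U : ℕ → Finset (Test O A)) (α : ℝ) (T : ℕ) : ℝ :=
  (psrRank f H : ℝ) * (Fintype.card A : ℝ) ^ 3 * (maxCoreActions H U : ℝ) ^ 4 * (H : ℝ) *
    iota f H U α T / α ^ 4

end Probabilities

/-! ### Exploration policies -/

section Exploration

variable {O A : Type*} [Fintype O] [Fintype A] [Nonempty A]

/-- Follow `π` in steps `1, …, h - 1`, play a uniform action at step `h` (if `h ≥ 1`), execute the
action sequence `acts` from step `h + 1` on, and follow `cont` afterwards. -/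
def Policy.explore (π cont : Policy O A) (h : ℕ) (acts : List A) : Policy O A where
  act τ o a :=
    open Classical in
    if τ.length + 1 < h then π.act τ o a
    else if τ.length + 1 = h then (Fintype.card A : ℝ)⁻¹
    else if hl : τ.length - h < acts.length then (if a = acts[τ.length - h] then 1 else 0)
    else cont.act τ o a
  act_nonneg τ o a := by
    split_ifs
    · exact π.act_nonneg τ o a
    · positivity
    · exact zero_le_one
    · exact le_rfl
    · exact cont.act_nonneg τ o a
  act_sum τ o := by
    split_ifs
    · exact π.act_sum τ o
    · simp
    · classical
      exact (Fintype.sum_ite_eq' (acts[τ.length - h]) (fun _ => (1 : ℝ)))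
    · exact cont.act_sum τ o

/-- The probability of the actions of `τ_H` under
`π ∘_h Unif(A) ∘_{h+1} Unif(U_{A,h+1})`, for `0 ≤ h ≤ H - 1`: the sequence of actions executed from
step `h + 1` on is drawn uniformly from `U_{A,h+1}`, and `cont acts` describes the arbitrary behavior
once the drawn sequence `acts` has been executed. -/
def exploreProb (U : ℕ → Finset (Test O A)) {H : ℕ} (π : Policy O A) (cont : List A → Policy O A)
    (h : ℕ) (τ : Traj O A H) : ℝ :=
  (∑ acts ∈ coreActions U (h + 1), (π.explore (cont acts) h acts).prob (List.ofFn τ)) /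
    (coreActions U (h + 1)).card

/-- The law of `τ_H` when the exploration policy at index `h` is executed in the model `f`. -/
def exploreTrajProb (f : Model O A) (U : ℕ → Finset (Test O A)) {H : ℕ} (π : Policy O A)
    (cont : List A → Policy O A) (h : ℕ) (τ : Traj O A H) : ℝ :=
  f.prob (List.ofFn τ) * exploreProb U π cont h τ

end Exploration

/-! ### Divergences -/

/-- Squared Hellinger distance of two distributions on a finite type. -/
def hellingerSq {X : Type*} [Fintype X] (P Q : X → ℝ) : ℝ :=
  1 / 2 * ∑ x, (Real.sqrt (P x) - Real.sqrt (Q x)) ^ 2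

/-- Kullback–Leibler divergence `KL(P ‖ Q)` of two distributions on a finite type. -/
def klDivergence {X : Type*} [Fintype X] (P Q : X → ℝ) : EReal :=
  open Classical in
  if ∀ x, Q x = 0 → P x = 0 then ((∑ x, P x * Real.log (P x / Q x) : ℝ) : EReal) else ⊤

/-! ### Model class, generalized eluder coefficient, prior, algorithm -/

section Algorithm

variable {O A : Type*} [Fintype O] [Fintype A] {H : ℕ}

/-- The set `𝓗(ε)` of the models `f` in the class with `V* - V_f ≤ ε` and
`sup_π KL(ℙ_{f*}^π ‖ ℙ_f^π) ≤ ε`. -/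
def modelBall (R : Fin H → O → A → ℝ) (𝓗 : Set (Model O A)) (fstar : 𝓗) (ε : ℝ) : Set 𝓗 :=
  {f | fstar.1.optValue R - f.1.optValue R ≤ ε ∧
    (⨆ π : Policy O A, klDivergence (fun τ : Traj O A H => fstar.1.trajProb π τ)
      (fun τ : Traj O A H => f.1.trajProb π τ)) ≤ (ε : EReal)}

/-- `ω(c, p⁰) = inf_{ε > 0} [c ε - log p⁰(𝓗(ε))]`.  Those `ε` with `p⁰(𝓗(ε)) = 0` contribute `+∞` to
the infimum and are left out; if there are no others, then `ω = +∞`, which has to be excluded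
separately. -/
def omega (R : Fin H → O → A → ℝ) (𝓗 : Set (Model O A)) (fstar : 𝓗) (p0 : Measure 𝓗) (c : ℝ) : ℝ :=
  sInf {r : ℝ | ∃ ε : ℝ, 0 < ε ∧ p0 (modelBall R 𝓗 fstar ε) ≠ 0 ∧
    r = c * ε - Real.log (p0.real (modelBall R 𝓗 fstar ε))}

/-- The trajectories `τ_0, …, τ_{H-1}` collected in one iteration, one for each index `h`. -/
def RoundData (O A : Type*) (H : ℕ) := Fin H → Traj O A H

instance : MeasurableSpace (RoundData O A H) := ⊤

/-- The unnormalized density `exp(γ V_f + ∑_s ∑_h η log ℙ_f(τ_h^s))` of the posterior with respect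
to the prior; the product form takes care of `ℙ_f(τ_h^s) = 0`. -/
def posteriorWeight (R : Fin H → O → A → ℝ) (η γ : ℝ) {n : ℕ} (S : Fin n → RoundData O A H)
    (f : Model O A) : ℝ :=
  Real.exp (γ * f.optValue R) * ∏ s, ∏ h, (f.prob (List.ofFn (S s h))) ^ η

/-- The optimistic posterior `p^t(f) ∝ p⁰(f) exp(γ V_f + ∑_s ∑_h L_h^s(f))`. -/
def posterior (R : Fin H → O → A → ℝ) (𝓗 : Set (Model O A)) (p0 : Measure 𝓗) (η γ : ℝ) {n : ℕ}
    (S : Fin n → RoundData O A H) : Measure 𝓗 :=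
  (∫⁻ f : 𝓗, ENNReal.ofReal (posteriorWeight R η γ S f.1) ∂p0)⁻¹ •
    p0.withDensity (fun f : 𝓗 => ENNReal.ofReal (posteriorWeight R η γ S f.1))

variable [Nonempty A]

/-- The generalized eluder coefficient for PSRs, for `T` iterations: the smallest `d ≥ 0` such that
for all sequences `f¹, …, f^T` of models in the class
`∑_t (V_{f^t} - V^{π_{f^t}}) ≤ [d ∑_h ∑_t ∑_{s<t} D_H²(ℙ_{f^t}^{π_exp(f^s,h)}, ℙ_{f*}^{π_exp(f^s,h)})]^{1/2}
  + √(d H T)`. -/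
def gec (R : Fin H → O → A → ℝ) (U : ℕ → Finset (Test O A)) (𝓗 : Set (Model O A)) (fstar : 𝓗)
    (optPol : 𝓗 → Policy O A) (cont : 𝓗 → ℕ → List A → Policy O A) (T : ℕ) : ℝ :=
  sInf {d : ℝ | 0 ≤ d ∧ ∀ f : Fin T → 𝓗,
    ∑ t, ((f t).1.optValue R - fstar.1.value R (optPol (f t))) ≤
      Real.sqrt (d * ∑ h : Fin H, ∑ t, ∑ s ∈ Finset.Iio t,
        hellingerSq
          (fun τ : Traj O A H => exploreTrajProb (f t).1 U (optPol (f s)) (cont (f s) h) h τ)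
          (fun τ : Traj O A H => exploreTrajProb fstar.1 U (optPol (f s)) (cont (f s) h) h τ))
      + Real.sqrt (d * H * T)}

/-- The law of one iteration of the algorithm given the data of the earlier iterations: a model `f`
is drawn from the posterior, and then, for each `h = 0, …, H - 1`, the exploration policy `π_exp(f, h)`
is executed in the true model, independently given `f`. -/
def roundLaw (R : Fin H → O → A → ℝ) (U : ℕ → Finset (Test O A)) (𝓗 : Set (Model O A)) (fstar : 𝓗)
    (optPol : 𝓗 → Policy O A) (cont : 𝓗 → ℕ → List A → Policy O A) (p0 : Measure 𝓗) (η γ : ℝ)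
    {n : ℕ} (S : Fin n → RoundData O A H) : Measure (𝓗 × RoundData O A H) :=
  (posterior R 𝓗 p0 η γ S).bind (fun f => ∑ D : Fin H → Traj O A H,
    ENNReal.ofReal (∏ h : Fin H, exploreTrajProb fstar.1 U (optPol f) (cont f h) h (D h)) •
      Measure.dirac ((f, D) : 𝓗 × RoundData O A H))

/-- The joint law of the sampled models and collected trajectories in the first `n` iterations. -/
def runLaw (R : Fin H → O → A → ℝ) (U : ℕ → Finset (Test O A)) (𝓗 : Set (Model O A)) (fstar : 𝓗)
    (optPol : 𝓗 → Policy O A) (cont : 𝓗 → ℕ → List A → Policy O A) (p0 : Measure 𝓗) (η γ : ℝ) :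
    (n : ℕ) → Measure (Fin n → 𝓗 × RoundData O A H)
  | 0 => Measure.dirac Fin.elim0
  | n + 1 => (runLaw R U 𝓗 fstar optPol cont p0 η γ n).bind (fun ρ =>
      (roundLaw R U 𝓗 fstar optPol cont p0 η γ (fun i => (ρ i).2)).map
        (fun r => (Fin.snoc ρ r : Fin (n + 1) → 𝓗 × RoundData O A H)))

/-- The expectation of `∑_{t=1}^T (V* - V^{π_{f^t}})` over a run of `T` iterations. -/
def expectedRegret (R : Fin H → O → A → ℝ) (U : ℕ → Finset (Test O A)) (𝓗 : Set (Model O A))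
    (fstar : 𝓗) (optPol : 𝓗 → Policy O A) (cont : 𝓗 → ℕ → List A → Policy O A) (p0 : Measure 𝓗)
    (η γ : ℝ) (T : ℕ) : ℝ :=
  ∫ ρ, ∑ t, (fstar.1.optValue R - fstar.1.value R (optPol (ρ t).1))
    ∂(runLaw R U 𝓗 fstar optPol cont p0 η γ T)

end Algorithm

end PSR

end

open PSR MeasureTheory

namespace PSR

set_option linter.unusedSectionVars false

section Elliptical

open Matrix

variable {n : Type*} [Fintype n]

lemma zero_le_dotProduct_self (v : n → ℝ) : 0 ≤ v ⬝ᵥ v :=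
  Finset.sum_nonneg fun i _ => mul_self_nonneg (v i)

variable [DecidableEq n]

open scoped MatrixOrder Matrix.Norms.L2Operator in
lemma exists_isUnit_transpose_mul_self {L : Matrix n n ℝ} (hL : L.PosDef) :
    ∃ B : Matrix n n ℝ, IsUnit B.det ∧ L = Bᵀ * B := by
  obtain ⟨B, hB⟩ := CStarAlgebra.nonneg_iff_eq_star_mul_self.mp hL.posSemidef.nonneg
  have hB' : L = Bᵀ * B := by
    rw [hB, star_eq_conjTranspose, conjTranspose_eq_transpose_of_trivial]
  refine ⟨B, ?_, hB'⟩
  have h := hL.det_pos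
  rw [hB', det_mul, det_transpose] at h
  exact isUnit_iff_ne_zero.mpr fun h0 => by simp [h0] at h

lemma one_add_sum_le_prod {ι : Type*} (s : Finset ι) (f : ι → ℝ) (hf : ∀ i, 0 ≤ f i) :
    1 + ∑ i ∈ s, f i ≤ ∏ i ∈ s, (1 + f i) := by
  classical
  induction s using Finset.induction_on with
  | empty => simp
  | insert a s ha ih =>
    rw [Finset.sum_insert ha, Finset.prod_insert ha]
    nlinarith [hf a, Finset.sum_nonneg fun i (_ : i ∈ s) => hf i, mul_le_mul_of_nonneg_left ih (hf a),
      mul_nonneg (hf a) (Finset.sum_nonneg fun i (_ : i ∈ s) => hf i)]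

lemma eigenvectorBasis_dotProduct_self {Q : Matrix n n ℝ} (hQ : Q.IsHermitian) (i : n) :
    (hQ.eigenvectorBasis i : n → ℝ) ⬝ᵥ (hQ.eigenvectorBasis i : n → ℝ) = 1 := by
  have h := hQ.eigenvectorBasis.orthonormal.1 i
  have h2 : ‖hQ.eigenvectorBasis i‖ ^ 2 = 1 := by rw [h]; norm_num
  rw [EuclideanSpace.real_norm_sq_eq] at h2
  rw [← h2]
  simp [dotProduct, sq]

lemma eigenvalues_eq_dotProduct {Q : Matrix n n ℝ} (hQ : Q.IsHermitian) (i : n) :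
    hQ.eigenvalues i =
      (hQ.eigenvectorBasis i : n → ℝ) ⬝ᵥ (Q *ᵥ (hQ.eigenvectorBasis i : n → ℝ)) := by
  rw [hQ.eigenvalues_eq]; simp

lemma one_add_trace_le_det {P : Matrix n n ℝ} (hP : P.PosSemidef) :
    1 + P.trace ≤ (1 + P).det := by
  have hQ : (1 + P).IsHermitian := (PosSemidef.one.add hP).1
  have hev : ∀ i, 0 ≤ hQ.eigenvalues i - 1 := fun i => by
    rw [eigenvalues_eq_dotProduct hQ, add_mulVec, one_mulVec, dotProduct_add,
      eigenvectorBasis_dotProduct_self]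
    have := hP.dotProduct_mulVec_nonneg (hQ.eigenvectorBasis i : n → ℝ)
    simp only [star_trivial] at this
    linarith
  have ht : (1 + P).trace = ∑ i, hQ.eigenvalues i := by
    simpa using hQ.trace_eq_sum_eigenvalues
  have hd : (1 + P).det = ∏ i, hQ.eigenvalues i := by
    simpa using hQ.det_eq_prod_eigenvalues
  have h := one_add_sum_le_prod Finset.univ (fun i => hQ.eigenvalues i - 1) hev
  simp only [add_sub_cancel, Finset.sum_sub_distrib] at h
  rw [hd]
  refine le_trans (le_of_eq ?_) h
  rw [← ht, trace_add, trace_one]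
  simp

lemma det_mul_one_add_trace_le {L S : Matrix n n ℝ} (hL : L.PosDef) (hS : S.PosSemidef) :
    L.det * (1 + (L⁻¹ * S).trace) ≤ (L + S).det := by
  obtain ⟨B, hB, rfl⟩ := exists_isUnit_transpose_mul_self hL
  have hBt : IsUnit Bᵀ.det := by rwa [det_transpose]
  set P : Matrix n n ℝ := (B⁻¹)ᵀ * S * B⁻¹ with hPdef
  have hP : P.PosSemidef := by
    have := hS.conjTranspose_mul_mul_same B⁻¹
    rwa [conjTranspose_eq_transpose_of_trivial] at this
  have h1 : Bᵀ * B + S = Bᵀ * (1 + P) * B := by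
    rw [mul_add, mul_one, add_mul, hPdef, transpose_nonsing_inv]
    congr 1
    calc S = (Bᵀ * Bᵀ⁻¹) * S * (B⁻¹ * B) := by
          rw [mul_nonsing_inv _ hBt, nonsing_inv_mul _ hB, one_mul, mul_one]
      _ = _ := by simp only [Matrix.mul_assoc]
  have h2 : ((Bᵀ * B)⁻¹ * S).trace = P.trace := by
    rw [Matrix.mul_inv_rev, hPdef, transpose_nonsing_inv, Matrix.mul_assoc, trace_mul_comm]
  rw [h1, h2, det_mul, det_mul, det_mul]
  have h3 : 0 ≤ Bᵀ.det * B.det := by rw [det_transpose]; exact mul_self_nonneg _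
  nlinarith [mul_le_mul_of_nonneg_left (one_add_trace_le_det hP) h3]

lemma abs_dotProduct_le_sqrt_mul_sqrt {L : Matrix n n ℝ} (hL : L.PosDef) (w x : n → ℝ) :
    |w ⬝ᵥ x| ≤ Real.sqrt (w ⬝ᵥ (L *ᵥ w)) * Real.sqrt (x ⬝ᵥ (L⁻¹ *ᵥ x)) := by
  obtain ⟨B, hB, rfl⟩ := exists_isUnit_transpose_mul_self hL
  have hBt : IsUnit Bᵀ.det := by rwa [det_transpose]
  have h1 : w ⬝ᵥ ((Bᵀ * B) *ᵥ w) = (B *ᵥ w) ⬝ᵥ (B *ᵥ w) := by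
    rw [← mulVec_mulVec, dotProduct_mulVec, vecMul_transpose]
  have h2 : x ⬝ᵥ ((Bᵀ * B)⁻¹ *ᵥ x) = (Bᵀ⁻¹ *ᵥ x) ⬝ᵥ (Bᵀ⁻¹ *ᵥ x) := by
    rw [Matrix.mul_inv_rev, ← mulVec_mulVec, dotProduct_mulVec, ← transpose_nonsing_inv,
      mulVec_transpose]
  have h3 : w ⬝ᵥ x = (B *ᵥ w) ⬝ᵥ (Bᵀ⁻¹ *ᵥ x) := by
    rw [dotProduct_mulVec, ← vecMul_transpose, vecMul_vecMul, mul_nonsing_inv _ hBt, vecMul_one]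
  rw [h1, h2, h3, ← Real.sqrt_mul (zero_le_dotProduct_self _)]
  refine Real.abs_le_sqrt ?_
  have := Finset.sum_mul_sq_le_sq_mul_sq Finset.univ (B *ᵥ w) (Bᵀ⁻¹ *ᵥ x)
  simpa [dotProduct, sq] using this

lemma det_le_pow {L : Matrix n n ℝ} (hL : L.PosSemidef) {c : ℝ}
    (h : ∀ v : n → ℝ, v ⬝ᵥ (L *ᵥ v) ≤ c * (v ⬝ᵥ v)) : L.det ≤ c ^ Fintype.card n := by
  have hd : L.det = ∏ i, hL.1.eigenvalues i := by simpa using hL.1.det_eq_prod_eigenvalues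
  rw [hd, ← Finset.card_univ, ← Finset.prod_const]
  refine Finset.prod_le_prod (fun i _ => hL.eigenvalues_nonneg i) fun i _ => ?_
  rw [eigenvalues_eq_dotProduct hL.1]
  simpa [eigenvectorBasis_dotProduct_self] using h (hL.1.eigenvectorBasis i)

lemma min_one_le_two_mul_log {u : ℝ} (hu : 0 ≤ u) : min 1 u ≤ 2 * Real.log (1 + u) := by
  rcases le_total u 1 with h | h
  · rw [min_eq_right h]
    have := Real.one_sub_inv_le_log_of_pos (show 0 < 1 + u by linarith)
    have h2 : u / 2 ≤ 1 - (1 + u)⁻¹ := by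
      have : 1 - (1 + u)⁻¹ = u / (1 + u) := by field_simp; ring
      rw [this]
      exact div_le_div_of_nonneg_left hu (by linarith) (by linarith)
    linarith
  · rw [min_eq_left h]
    have := Real.log_le_log (by norm_num) (show (2 : ℝ) ≤ 1 + u by linarith)
    linarith [Real.log_two_gt_d9]

variable {X : Type*} [Fintype X]

/-- The second moment matrix of the vectors `x` under the weights `p`. -/
def secondMoment (p : X → ℝ) (x : X → n → ℝ) : Matrix n n ℝ :=
  ∑ i, p i • vecMulVec (x i) (x i)

lemma secondMoment_posSemidef {p : X → ℝ} (hp : ∀ i, 0 ≤ p i) (x : X → n → ℝ) :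
    (secondMoment p x).PosSemidef := by
  refine posSemidef_sum _ fun i _ => ?_
  have := posSemidef_vecMulVec_self_star (x i)
  rw [star_trivial] at this
  exact this.smul (hp i)

lemma dotProduct_secondMoment (p : X → ℝ) (x : X → n → ℝ) (v : n → ℝ) :
    v ⬝ᵥ (secondMoment p x *ᵥ v) = ∑ i, p i * (v ⬝ᵥ x i) ^ 2 := by
  simp only [secondMoment, sum_mulVec, dotProduct_sum, smul_mulVec, dotProduct_smul, smul_eq_mul,
    vecMulVec_mulVec, op_smul_eq_smul]
  refine Finset.sum_congr rfl fun i _ => ?_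
  rw [dotProduct_comm (x i) v]; ring

lemma trace_mul_secondMoment (L : Matrix n n ℝ) (p : X → ℝ) (x : X → n → ℝ) :
    (L * secondMoment p x).trace = ∑ i, p i * (x i ⬝ᵥ (L *ᵥ x i)) := by
  simp only [secondMoment, Finset.mul_sum, trace_sum, Matrix.mul_smul, trace_smul, smul_eq_mul]
  refine Finset.sum_congr rfl fun i _ => ?_
  rw [mul_vecMulVec, trace_vecMulVec, dotProduct_comm]

/-- The regularized second moment matrices of the first `t` rounds. -/
def gram (lam : ℝ) (p : ℕ → X → ℝ) (x : X → n → ℝ) (t : ℕ) : Matrix n n ℝ :=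
  lam • 1 + ∑ s ∈ Finset.range t, secondMoment (p s) x

lemma gram_posDef {lam : ℝ} (hl : 0 < lam) {p : ℕ → X → ℝ} (hp : ∀ t i, 0 ≤ p t i)
    (x : X → n → ℝ) (t : ℕ) : (gram lam p x t).PosDef :=
  (PosDef.one.smul hl).add_posSemidef
    (posSemidef_sum _ fun s _ => secondMoment_posSemidef (hp s) x)

lemma dotProduct_gram (lam : ℝ) (p : ℕ → X → ℝ) (x : X → n → ℝ) (t : ℕ) (v : n → ℝ) :
    v ⬝ᵥ (gram lam p x t *ᵥ v) =
      lam * (v ⬝ᵥ v) + ∑ s ∈ Finset.range t, ∑ i, p s i * (v ⬝ᵥ x i) ^ 2 := by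
  simp only [gram, add_mulVec, dotProduct_add, smul_mulVec, one_mulVec, dotProduct_smul,
    smul_eq_mul, sum_mulVec, dotProduct_sum, dotProduct_secondMoment]

lemma sum_min_one_trace_le {lam b : ℝ} (hl : 0 < lam) {p : ℕ → X → ℝ} (hp : ∀ t i, 0 ≤ p t i)
    (hp1 : ∀ t, ∑ i, p t i ≤ 1) {x : X → n → ℝ} (hx : ∀ i, x i ⬝ᵥ x i ≤ b) (hb : 0 ≤ b) (T : ℕ) :
    ∑ t ∈ Finset.range T, min 1 (∑ i, p t i * (x i ⬝ᵥ ((gram lam p x t)⁻¹ *ᵥ x i))) ≤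
      2 * (Fintype.card n * Real.log (1 + T * b / lam)) := by
  set G := gram lam p x with hG
  have hpd : ∀ t, (G t).PosDef := gram_posDef hl hp x
  have hnn : ∀ t, 0 ≤ ∑ i, p t i * (x i ⬝ᵥ ((G t)⁻¹ *ᵥ x i)) := fun t =>
    Finset.sum_nonneg fun i _ => mul_nonneg (hp t i) (by
      simpa using (hpd t).inv.posSemidef.dotProduct_mulVec_nonneg (x i))
  have hstep : ∀ t, min 1 (∑ i, p t i * (x i ⬝ᵥ ((G t)⁻¹ *ᵥ x i))) ≤
      2 * (Real.log (G (t + 1)).det - Real.log (G t).det) := by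
    intro t
    refine (min_one_le_two_mul_log (hnn t)).trans ?_
    have h1 := det_mul_one_add_trace_le (hpd t) (secondMoment_posSemidef (hp t) x)
    rw [trace_mul_secondMoment] at h1
    have h2 : G (t + 1) = G t + secondMoment (p t) x := by
      simp only [hG, gram, Finset.sum_range_succ, add_assoc]
    rw [← h2] at h1
    have h3 := Real.log_le_log (mul_pos (hpd t).det_pos (by linarith [hnn t])) h1
    rw [Real.log_mul (hpd t).det_pos.ne' (by linarith [hnn t])] at h3
    linarith
  refine (Finset.sum_le_sum fun t _ => hstep t).trans ?_
  rw [← Finset.mul_sum, Finset.sum_range_sub (fun t => Real.log (G t).det)]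
  have h0 : (G 0).det = lam ^ Fintype.card n := by simp [hG, gram]
  have hT : (G T).det ≤ (lam + T * b) ^ Fintype.card n := by
    refine det_le_pow (hpd T).posSemidef fun v => ?_
    rw [hG, dotProduct_gram, add_mul]
    gcongr
    have : ∀ s, ∑ i, p s i * (v ⬝ᵥ x i) ^ 2 ≤ b * (v ⬝ᵥ v) := fun s => by
      calc ∑ i, p s i * (v ⬝ᵥ x i) ^ 2 ≤ ∑ i, p s i * (b * (v ⬝ᵥ v)) := by
            refine Finset.sum_le_sum fun i _ => mul_le_mul_of_nonneg_left ?_ (hp s i)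
            have := Finset.sum_mul_sq_le_sq_mul_sq Finset.univ v (x i)
            have h' : (v ⬝ᵥ x i) ^ 2 ≤ (v ⬝ᵥ v) * (x i ⬝ᵥ x i) := by
              simpa [dotProduct, sq] using this
            have hv : 0 ≤ v ⬝ᵥ v := zero_le_dotProduct_self v
            nlinarith [mul_le_mul_of_nonneg_left (hx i) hv]
        _ ≤ _ := by
            rw [← Finset.sum_mul]
            have hv : 0 ≤ b * (v ⬝ᵥ v) := mul_nonneg hb (zero_le_dotProduct_self v)
            nlinarith [hp1 s]
    calc _ ≤ ∑ s ∈ Finset.range T, b * (v ⬝ᵥ v) := Finset.sum_le_sum fun s _ => this s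
      _ = _ := by simp; ring
  have h4 := Real.log_le_log (hpd T).det_pos hT
  rw [Real.log_pow] at h4
  rw [h0, Real.log_pow]
  have h5 : Real.log (1 + T * b / lam) = Real.log (lam + T * b) - Real.log lam := by
    rw [← Real.log_div (by positivity) hl.ne']
    congr 1; field_simp
  rw [h5]
  linarith

/-- A generalized elliptical potential argument for the seminorms `v ↦ ∑ j, |w t j ⬝ᵥ v|`. -/
theorem sum_min_one_le_sqrt {J : Type*} [Fintype J] {a b : ℝ} (ha : 0 < a)
    {p : ℕ → X → ℝ} (hp : ∀ t i, 0 ≤ p t i) (hp1 : ∀ t, ∑ i, p t i ≤ 1) {x : X → n → ℝ}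
    (hx : ∀ i, ∑ k, |x i k| ≤ b) {w : ℕ → J → n → ℝ} (hw : ∀ t k, ∑ j, |w t j k| ≤ a) (T : ℕ) :
    ∑ t ∈ Finset.range T, min 1 (∑ i, p t i * ∑ j, |w t j ⬝ᵥ x i|) ≤
      Real.sqrt ((T + ∑ t ∈ Finset.range T, ∑ s ∈ Finset.range t,
        ∑ i, p s i * (∑ j, |w t j ⬝ᵥ x i|) ^ 2) *
        (2 * (Fintype.card n * Real.log (1 + T * (Fintype.card n * a ^ 2 * b ^ 2))))) := by
  rcases isEmpty_or_nonempty n with hn | hn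
  · simp
  have hd : (0 : ℝ) < Fintype.card n := by exact_mod_cast Fintype.card_pos
  set lam : ℝ := (Fintype.card n * a ^ 2)⁻¹ with hlam
  have hl : 0 < lam := by positivity
  set G := gram lam p x with hG
  have hpd : ∀ t, (G t).PosDef := gram_posDef hl hp x
  set S : ℕ → ℝ := fun t => ∑ s ∈ Finset.range t, ∑ i, p s i * (∑ j, |w t j ⬝ᵥ x i|) ^ 2 with hS
  have hS0 : ∀ t, 0 ≤ S t := fun t => Finset.sum_nonneg fun s _ => Finset.sum_nonneg fun i _ =>
    mul_nonneg (hp s i) (sq_nonneg _)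
  set r : ℕ → ℝ := fun t => ∑ i, p t i * (x i ⬝ᵥ ((G t)⁻¹ *ᵥ x i)) with hr
  have hq : ∀ t i, 0 ≤ x i ⬝ᵥ ((G t)⁻¹ *ᵥ x i) := fun t i => by
    simpa using (hpd t).inv.posSemidef.dotProduct_mulVec_nonneg (x i)
  have hr0 : ∀ t, 0 ≤ r t := fun t => Finset.sum_nonneg fun i _ => mul_nonneg (hp t i) (hq t i)
  have key : ∀ t i, ∑ j, |w t j ⬝ᵥ x i| ≤
      Real.sqrt (1 + S t) * Real.sqrt (x i ⬝ᵥ ((G t)⁻¹ *ᵥ x i)) := by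
    intro t i
    set v : n → ℝ := ∑ j, (SignType.sign (w t j ⬝ᵥ x i) : ℝ) • w t j with hv
    have hv2 : ∀ y : n → ℝ, v ⬝ᵥ y = ∑ j, (SignType.sign (w t j ⬝ᵥ x i) : ℝ) * (w t j ⬝ᵥ y) := by
      intro y
      rw [hv, sum_dotProduct]
      exact Finset.sum_congr rfl fun j _ => by rw [smul_dotProduct, smul_eq_mul]
    have hsgn : ∀ c : ℝ, |(SignType.sign c : ℝ)| ≤ 1 := by
      intro c
      rcases lt_trichotomy c 0 with h | h | h <;> simp [h]
    have h1 : ∑ j, |w t j ⬝ᵥ x i| = v ⬝ᵥ x i := by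
      rw [hv2]
      exact Finset.sum_congr rfl fun j _ => by rw [sign_mul_self]
    have h2 : ∀ i', (v ⬝ᵥ x i') ^ 2 ≤ (∑ j, |w t j ⬝ᵥ x i'|) ^ 2 := by
      intro i'
      rw [sq_le_sq, hv2]
      refine (Finset.abs_sum_le_sum_abs _ _).trans (le_trans ?_ (le_abs_self _))
      refine Finset.sum_le_sum fun j _ => ?_
      rw [abs_mul]
      exact mul_le_of_le_one_left (abs_nonneg _) (hsgn _)
    have h3 : lam * (v ⬝ᵥ v) ≤ 1 := by
      have h4 : ∀ k, |v k| ≤ a := by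
        intro k
        have : v k = ∑ j, (SignType.sign (w t j ⬝ᵥ x i) : ℝ) * w t j k := by
          have := hv2 (Pi.single k 1)
          simpa using this
        rw [this]
        refine (Finset.abs_sum_le_sum_abs _ _).trans (le_trans ?_ (hw t k))
        refine Finset.sum_le_sum fun j _ => ?_
        rw [abs_mul]
        exact mul_le_of_le_one_left (abs_nonneg _) (hsgn _)
      have h5 : v ⬝ᵥ v ≤ Fintype.card n * a ^ 2 := by
        calc v ⬝ᵥ v = ∑ k, |v k| ^ 2 := by simp [dotProduct, sq]
          _ ≤ ∑ k : n, a ^ 2 := Finset.sum_le_sum fun k _ => by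
            exact pow_le_pow_left₀ (abs_nonneg _) (h4 k) 2
          _ = _ := by simp
      calc lam * (v ⬝ᵥ v) ≤ lam * (Fintype.card n * a ^ 2) := by gcongr
        _ = 1 := inv_mul_cancel₀ (by positivity)
    rw [h1]
    refine (le_abs_self _).trans ((abs_dotProduct_le_sqrt_mul_sqrt (hpd t) v (x i)).trans ?_)
    gcongr
    rw [hG, dotProduct_gram]
    exact add_le_add h3 (Finset.sum_le_sum fun s _ => Finset.sum_le_sum fun i' _ =>
      mul_le_mul_of_nonneg_left (h2 i') (hp s i'))
  have key2 : ∀ t, min 1 (∑ i, p t i * ∑ j, |w t j ⬝ᵥ x i|) ≤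
      Real.sqrt (1 + S t) * Real.sqrt (min 1 (r t)) := by
    intro t
    have hs1 : 1 ≤ Real.sqrt (1 + S t) := Real.one_le_sqrt.mpr (by linarith [hS0 t])
    rcases le_total (r t) 1 with h | h
    · rw [min_eq_right h]
      refine (min_le_right _ _).trans ?_
      have h6 : ∑ i, p t i * Real.sqrt (x i ⬝ᵥ ((G t)⁻¹ *ᵥ x i)) ≤ Real.sqrt (r t) := by
        refine Real.le_sqrt_of_sq_le ?_
        have := Finset.sum_mul_sq_le_sq_mul_sq Finset.univ (fun i => Real.sqrt (p t i))
          (fun i => Real.sqrt (p t i) * Real.sqrt (x i ⬝ᵥ ((G t)⁻¹ *ᵥ x i)))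
        simp only [mul_pow, Real.sq_sqrt (hp t _), Real.sq_sqrt (hq t _), ← mul_assoc,
          Real.mul_self_sqrt (hp t _)] at this
        refine this.trans ?_
        have := hr0 t
        have h7 := hp1 t
        change (∑ i, p t i) * r t ≤ r t
        nlinarith
      calc ∑ i, p t i * ∑ j, |w t j ⬝ᵥ x i|
          ≤ ∑ i, p t i * (Real.sqrt (1 + S t) * Real.sqrt (x i ⬝ᵥ ((G t)⁻¹ *ᵥ x i))) :=
            Finset.sum_le_sum fun i _ => mul_le_mul_of_nonneg_left (key t i) (hp t i)
        _ = Real.sqrt (1 + S t) * ∑ i, p t i * Real.sqrt (x i ⬝ᵥ ((G t)⁻¹ *ᵥ x i)) := by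
            rw [Finset.mul_sum]; exact Finset.sum_congr rfl fun i _ => by ring
        _ ≤ _ := by gcongr
    · rw [min_eq_left h, Real.sqrt_one, mul_one]
      exact (min_le_left _ _).trans hs1
  refine (Finset.sum_le_sum fun t _ => key2 t).trans ?_
  refine Real.le_sqrt_of_sq_le ((Finset.sum_mul_sq_le_sq_mul_sq _ _ _).trans ?_)
  have h8 : ∑ t ∈ Finset.range T, Real.sqrt (1 + S t) ^ 2 =
      T + ∑ t ∈ Finset.range T, S t := by
    simp [Real.sq_sqrt (add_nonneg zero_le_one (hS0 _)), Finset.sum_add_distrib]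
  have h9 : ∑ t ∈ Finset.range T, Real.sqrt (min 1 (r t)) ^ 2 =
      ∑ t ∈ Finset.range T, min 1 (r t) :=
    Finset.sum_congr rfl fun t _ => Real.sq_sqrt (le_min zero_le_one (hr0 t))
  rw [h8, h9]
  refine mul_le_mul_of_nonneg_left ?_
    (add_nonneg (Nat.cast_nonneg _) (Finset.sum_nonneg fun t _ => hS0 t))
  have hx2 : ∀ i, x i ⬝ᵥ x i ≤ b ^ 2 := fun i => by
    calc x i ⬝ᵥ x i = ∑ k, |x i k| ^ 2 := by simp [dotProduct, sq]
      _ ≤ (∑ k, |x i k|) ^ 2 := Finset.sum_sq_le_sq_sum_of_nonneg fun k _ => abs_nonneg _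
      _ ≤ b ^ 2 := pow_le_pow_left₀ (Finset.sum_nonneg fun k _ => abs_nonneg _) (hx i) 2
  have h10 := sum_min_one_trace_le hl hp hp1 hx2 (sq_nonneg b) T
  refine h10.trans (le_of_eq ?_)
  congr 3
  rw [hlam, div_inv_eq_mul]
  ring_nf

end Elliptical

section Histories

variable {O A : Type*} [Fintype O] [Fintype A]

/-- The sum of `F` over all histories of length `n`. -/
def sumHist : ℕ → (Hist O A → ℝ) → ℝ
  | 0, F => F []
  | n + 1, F => ∑ x : O × A, sumHist n (fun τ => F (x :: τ))

lemma sum_ofFn_eq_sumHist (n : ℕ) (F : Hist O A → ℝ) :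
    ∑ τ : Fin n → O × A, F (List.ofFn τ) = sumHist n F := by
  induction n generalizing F with
  | zero => simp [sumHist]
  | succ n ih =>
    rw [sumHist, ← Fintype.sum_equiv (Fin.consEquiv (fun _ => O × A))
      (fun q => F (q.1 :: List.ofFn q.2)) _ (fun q => by simp [Fin.consEquiv, List.ofFn_succ]),
      Fintype.sum_prod_type]
    exact Finset.sum_congr rfl fun x _ => ih (fun τ => F (x :: τ))

lemma sumHist_le {n : ℕ} {F G : Hist O A → ℝ} (h : ∀ τ, τ.length = n → F τ ≤ G τ) :
    sumHist n F ≤ sumHist n G := by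
  rw [← sum_ofFn_eq_sumHist, ← sum_ofFn_eq_sumHist]
  exact Finset.sum_le_sum fun τ _ => h _ (List.length_ofFn)

lemma sumHist_congr {n : ℕ} {F G : Hist O A → ℝ} (h : ∀ τ, τ.length = n → F τ = G τ) :
    sumHist n F = sumHist n G :=
  le_antisymm (sumHist_le fun τ hτ => (h τ hτ).le) (sumHist_le fun τ hτ => (h τ hτ).ge)

lemma sumHist_nonneg {n : ℕ} {F : Hist O A → ℝ} (h : ∀ τ, τ.length = n → 0 ≤ F τ) :
    0 ≤ sumHist n F := by
  rw [← sum_ofFn_eq_sumHist]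
  exact Finset.sum_nonneg fun τ _ => h _ (List.length_ofFn)

lemma sumHist_const_mul (n : ℕ) (c : ℝ) (F : Hist O A → ℝ) :
    sumHist n (fun τ => c * F τ) = c * sumHist n F := by
  simp only [← sum_ofFn_eq_sumHist, Finset.mul_sum]

lemma sumHist_add_fun (n : ℕ) (F G : Hist O A → ℝ) :
    sumHist n (fun τ => F τ + G τ) = sumHist n F + sumHist n G := by
  simp only [← sum_ofFn_eq_sumHist, Finset.sum_add_distrib]

lemma sumHist_sum {ι : Type*} (s : Finset ι) (n : ℕ) (F : ι → Hist O A → ℝ) :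
    sumHist n (fun τ => ∑ i ∈ s, F i τ) = ∑ i ∈ s, sumHist n (F i) := by
  simp only [← sum_ofFn_eq_sumHist]
  exact Finset.sum_comm

lemma sumHist_add (n m : ℕ) (F : Hist O A → ℝ) :
    sumHist (n + m) F = sumHist n (fun τ => sumHist m (fun σ => F (τ ++ σ))) := by
  induction n generalizing F with
  | zero => simp [sumHist]
  | succ n ih =>
    rw [show n + 1 + m = (n + m) + 1 by ring, sumHist, sumHist]
    exact Finset.sum_congr rfl fun x _ => by rw [ih]; rfl

lemma sumHist_one (F : Hist O A → ℝ) : sumHist 1 F = ∑ x : O × A, F [x] := rfl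

lemma sumHist_succ' (n : ℕ) (F : Hist O A → ℝ) :
    sumHist (n + 1) F = sumHist n (fun τ => ∑ x : O × A, F (τ ++ [x])) := by
  rw [sumHist_add]; rfl

lemma exists_of_sumHist_pos {n : ℕ} {F : Hist O A → ℝ} (h : 0 < sumHist n F) :
    ∃ τ : Hist O A, τ.length = n ∧ 0 < F τ := by
  by_contra! hc
  have h0 : sumHist n F ≤ sumHist n (fun _ : Hist O A => 0) := sumHist_le hc
  rw [← sum_ofFn_eq_sumHist n (fun _ => 0), Finset.sum_const_zero] at h0
  exact absurd h (not_lt.mpr h0)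

lemma Model.segProb_nonneg (f : Model O A) (past σ : Hist O A) : 0 ≤ f.segProb past σ := by
  induction σ generalizing past with
  | nil => exact zero_le_one
  | cons x σ ih => exact mul_nonneg (f.trans_nonneg _ _) (ih _)

lemma Policy.segProb_nonneg (π : Policy O A) (past σ : Hist O A) : 0 ≤ π.segProb past σ := by
  induction σ generalizing past with
  | nil => exact zero_le_one
  | cons x σ ih => exact mul_nonneg (π.act_nonneg _ _ _) (ih _)

lemma Model.prob_nonneg (f : Model O A) (τ : Hist O A) : 0 ≤ f.prob τ := f.segProb_nonneg _ _

lemma Policy.prob_nonneg (π : Policy O A) (τ : Hist O A) : 0 ≤ π.prob τ := π.segProb_nonneg _ _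

lemma Model.segProb_append (f : Model O A) (past σ ρ : Hist O A) :
    f.segProb past (σ ++ ρ) = f.segProb past σ * f.segProb (past ++ σ) ρ := by
  induction σ generalizing past with
  | nil => simp [Model.segProb]
  | cons x σ ih => simp [Model.segProb, ih, mul_assoc]

lemma Policy.segProb_append (π : Policy O A) (past σ ρ : Hist O A) :
    π.segProb past (σ ++ ρ) = π.segProb past σ * π.segProb (past ++ σ) ρ := by
  induction σ generalizing past with
  | nil => simp [Policy.segProb]
  | cons x σ ih => simp [Policy.segProb, ih, mul_assoc]

lemma Model.prob_append (f : Model O A) (τ σ : Hist O A) :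
    f.prob (τ ++ σ) = f.prob τ * f.segProb τ σ := by simp [Model.prob, Model.segProb_append]

lemma Policy.prob_append (π : Policy O A) (τ σ : Hist O A) :
    π.prob (τ ++ σ) = π.prob τ * π.segProb τ σ := by simp [Policy.prob, Policy.segProb_append]

lemma Model.segProb_singleton (f : Model O A) (past : Hist O A) (x : O × A) :
    f.segProb past [x] = f.trans past x.1 := by simp [Model.segProb]

lemma Policy.segProb_singleton (π : Policy O A) (past : Hist O A) (x : O × A) :
    π.segProb past [x] = π.act past x.1 x.2 := by simp [Policy.segProb]

lemma Model.segProb_le_one (f : Model O A) (past σ : Hist O A) : f.segProb past σ ≤ 1 := by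
  induction σ generalizing past with
  | nil => exact le_rfl
  | cons x σ ih =>
    refine mul_le_one₀ ?_ (f.segProb_nonneg _ _) (ih _)
    rw [← f.trans_sum past]
    exact Finset.single_le_sum (fun o _ => f.trans_nonneg past o) (Finset.mem_univ _)

lemma Policy.segProb_le_one (π : Policy O A) (past σ : Hist O A) : π.segProb past σ ≤ 1 := by
  induction σ generalizing past with
  | nil => exact le_rfl
  | cons x σ ih =>
    refine mul_le_one₀ ?_ (π.segProb_nonneg _ _) (ih _)
    rw [← π.act_sum past x.1]
    exact Finset.single_le_sum (fun o _ => π.act_nonneg past x.1 o) (Finset.mem_univ _)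

lemma sumHist_segProb_mul (f : Model O A) (π : Policy O A) (n : ℕ) (past : Hist O A) :
    sumHist n (fun σ => f.segProb past σ * π.segProb past σ) = 1 := by
  induction n generalizing past with
  | zero => simp [sumHist, Model.segProb, Policy.segProb]
  | succ n ih =>
    have : ∀ x : O × A, sumHist n (fun σ => f.segProb past (x :: σ) * π.segProb past (x :: σ)) =
        f.trans past x.1 * π.act past x.1 x.2 := by
      intro x
      rw [← mul_one (_ * _), ← ih (past ++ [x]), ← sumHist_const_mul]
      exact sumHist_congr fun σ _ => by simp only [Model.segProb, Policy.segProb]; ring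
    simp only [sumHist, this, Fintype.sum_prod_type, ← Finset.mul_sum, π.act_sum, mul_one,
      f.trans_sum]

/-- The probability of a test after `τ`, without the convention for unreachable histories. -/
def Model.rawTest (f : Model O A) (τ : Hist O A) (t : Test O A) : ℝ :=
  f.segProb τ t.1 * t.2.elim 1 (f.trans (τ ++ t.1))

open Classical in
/-- The indicator of the histories reachable in `f`. -/
noncomputable def Model.reach (f : Model O A) (τ : Hist O A) : ℝ := if f.prob τ = 0 then 0 else 1

lemma Model.testProb_eq (f : Model O A) (τ : Hist O A) (t : Test O A) :
    f.testProb τ t = f.reach τ * f.rawTest τ t := by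
  unfold Model.testProb Model.reach Model.rawTest
  rcases t with ⟨s, _ | o⟩ <;> split_ifs <;> simp

lemma Model.reach_of_ne {f : Model O A} {τ : Hist O A} (h : f.prob τ ≠ 0) : f.reach τ = 1 := by
  simp [Model.reach, h]

lemma Model.reach_of_eq {f : Model O A} {τ : Hist O A} (h : f.prob τ = 0) : f.reach τ = 0 := by
  simp [Model.reach, h]

/-- The `ℓ¹` distance of the laws of the next `m` steps under `π`, with coefficients. -/
def segDist (f g : Model O A) (π : Policy O A) (a b : ℝ) (m : ℕ) (τ : Hist O A) : ℝ :=
  sumHist m (fun σ => π.segProb τ σ * |a * f.segProb τ σ - b * g.segProb τ σ|)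

lemma segDist_nonneg (f g : Model O A) (π : Policy O A) (a b : ℝ) (m : ℕ) (τ : Hist O A) :
    0 ≤ segDist f g π a b m τ :=
  sumHist_nonneg fun _ _ => mul_nonneg (π.segProb_nonneg _ _) (abs_nonneg _)

lemma sumHist_sum_trans (f g : Model O A) (π : Policy O A) (a b : ℝ) (m : ℕ) (τ : Hist O A) :
    sumHist m (fun σ => ∑ o, π.segProb τ σ * |a * (f.segProb τ σ * f.trans (τ ++ σ) o) -
      b * (g.segProb τ σ * g.trans (τ ++ σ) o)|) = segDist f g π a b (m + 1) τ := by
  rw [segDist, sumHist_succ']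
  refine sumHist_congr fun σ _ => ?_
  rw [Fintype.sum_prod_type]
  refine Finset.sum_congr rfl fun o _ => ?_
  simp only [Policy.segProb_append, Model.segProb_append, Policy.segProb_singleton,
    Model.segProb_singleton]
  rw [← Finset.sum_mul, ← Finset.mul_sum, π.act_sum, mul_one]

lemma segDist_le_succ (f g : Model O A) (π : Policy O A) (a b : ℝ) (m : ℕ) (τ : Hist O A) :
    segDist f g π a b m τ ≤ segDist f g π a b (m + 1) τ := by
  rw [← sumHist_sum_trans]
  refine sumHist_le fun σ _ => ?_
  rw [← Finset.mul_sum]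
  refine mul_le_mul_of_nonneg_left ?_ (π.segProb_nonneg _ _)
  refine le_trans (le_of_eq ?_) (Finset.abs_sum_le_sum_abs _ _)
  rw [Finset.sum_sub_distrib, ← Finset.mul_sum, ← Finset.mul_sum, ← Finset.mul_sum,
    ← Finset.mul_sum, f.trans_sum, g.trans_sum, mul_one, mul_one]

lemma segDist_mono (f g : Model O A) (π : Policy O A) (a b : ℝ) (τ : Hist O A) :
    Monotone fun m => segDist f g π a b m τ :=
  monotone_nat_of_le_succ fun m => segDist_le_succ f g π a b m τ

lemma sum_test_le_segDist (f g : Model O A) (π : Policy O A) (a b c : ℝ) {H k : ℕ}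
    {τ : Hist O A} (S : Finset (Test O A))
    (hS : ∀ v ∈ S, v ∈ validTests O A H (τ.length + 1))
    (hk : ∀ v ∈ S, v.1.length = k) (hc : ∀ v ∈ S, c ≤ π.segProb τ v.1) :
    c * ∑ v ∈ S, |a * f.rawTest τ v - b * g.rawTest τ v| ≤
      segDist f g π a b (H - τ.length) τ := by
  classical
  rw [Finset.mul_sum]
  refine (Finset.sum_le_sum fun v hv =>
    mul_le_mul_of_nonneg_right (hc v hv) (abs_nonneg _)).trans ?_
  by_cases hkH : τ.length + 1 + k ≤ H
  · have hsome : ∀ v ∈ S, ∃ o, v.2 = some o := fun v hv => by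
      rcases hS v hv with h | h
      · exact Option.isSome_iff_exists.mp h.1
      · have := hk v hv; omega
    refine le_trans ?_ (show segDist f g π a b (k + 1) τ ≤ _ from
      segDist_mono f g π a b τ (show k + 1 ≤ H - τ.length by omega))
    rw [← sumHist_sum_trans, ← sum_ofFn_eq_sumHist, ← Fintype.sum_prod_type'
      (f := fun (σ : Fin k → O × A) o => π.segProb τ (List.ofFn σ) *
        |a * (f.segProb τ (List.ofFn σ) * f.trans (τ ++ List.ofFn σ) o) -
          b * (g.segProb τ (List.ofFn σ) * g.trans (τ ++ List.ofFn σ) o)|)]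
    let e : (Fin k → O × A) × O ↪ Test O A :=
      ⟨fun q => (List.ofFn q.1, some q.2), fun q q' h => by
        simp only [Prod.mk.injEq, Option.some.injEq] at h
        exact Prod.ext (List.ofFn_injective h.1) h.2⟩
    have hsub : S ⊆ Finset.univ.map e := by
      intro v hv
      obtain ⟨o, ho⟩ := hsome v hv
      have hl := hk v hv
      subst hl
      refine Finset.mem_map.mpr ⟨(v.1.get, o), Finset.mem_univ _, ?_⟩
      exact Prod.ext (List.ofFn_get v.1) ho.symm
    refine (Finset.sum_le_sum_of_subset_of_nonneg hsub fun v _ _ =>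
      mul_nonneg (π.segProb_nonneg _ _) (abs_nonneg _)).trans (le_of_eq ?_)
    rw [Finset.sum_map]
    rfl
  · have hnone : ∀ v ∈ S, v.2 = none ∧ k = H - τ.length := fun v hv => by
      have := hk v hv
      rcases hS v hv with h | h
      · omega
      · exact ⟨h.1, by omega⟩
    rcases S.eq_empty_or_nonempty with rfl | ⟨v0, hv0⟩
    · simpa using segDist_nonneg f g π a b _ τ
    rw [← (hnone v0 hv0).2, segDist, ← sum_ofFn_eq_sumHist]
    let e : (Fin k → O × A) ↪ Test O A :=
      ⟨fun q => (List.ofFn q, none), fun q q' h => by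
        simp only [Prod.mk.injEq] at h
        exact List.ofFn_injective h.1⟩
    have hsub : S ⊆ Finset.univ.map e := by
      intro v hv
      have hl := hk v hv
      refine Finset.mem_map.mpr ⟨fun i => v.1.get (i.cast hl.symm), Finset.mem_univ _, ?_⟩
      refine Prod.ext ?_ (hnone v hv).1.symm
      subst hl
      exact List.ofFn_get v.1
    refine (Finset.sum_le_sum_of_subset_of_nonneg hsub fun v _ _ =>
      mul_nonneg (π.segProb_nonneg _ _) (abs_nonneg _)).trans (le_of_eq ?_)
    rw [Finset.sum_map]
    refine Finset.sum_congr rfl fun σ _ => ?_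
    change π.segProb τ (List.ofFn σ) * |a * (f.segProb τ (List.ofFn σ) * 1) -
      b * (g.segProb τ (List.ofFn σ) * 1)| = _
    rw [mul_one, mul_one]

end Histories

section Hellinger

lemma mul_sq_sum_abs_sub_le {X : Type*} [Fintype X] {α β : X → ℝ} (hα : ∀ i, 0 ≤ α i)
    (hβ : ∀ i, 0 ≤ β i) (hα1 : ∑ i, α i = 1) (hβ1 : ∑ i, β i = 1) {p q r : ℝ} (hp : 0 < p)
    (hq : 0 ≤ q) (hr0 : q = 0 → r = 0) (hr1 : q ≠ 0 → r = 1) :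
    p * (∑ i, |r * β i - α i|) ^ 2 ≤
      40 * ∑ i, (Real.sqrt (q * β i) - Real.sqrt (p * α i)) ^ 2 := by
  rcases hq.eq_or_lt with h | h
  · rw [← h, hr0 h.symm]
    simp only [zero_mul, zero_sub, Real.sqrt_zero, abs_neg, neg_sq, abs_of_nonneg (hα _), hα1,
      Real.sq_sqrt (mul_nonneg hp.le (hα _)), ← Finset.mul_sum]
    linarith
  rw [hr1 h.ne']
  set c := ∑ i, Real.sqrt (α i) * Real.sqrt (β i) with hc
  have hc0 : 0 ≤ c := Finset.sum_nonneg fun i _ => by positivity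
  have hD : ∑ i, (Real.sqrt (q * β i) - Real.sqrt (p * α i)) ^ 2 =
      q + p - 2 * (Real.sqrt q * Real.sqrt p * c) := by
    have : ∀ i, (Real.sqrt (q * β i) - Real.sqrt (p * α i)) ^ 2 = q * β i + p * α i -
        2 * (Real.sqrt q * Real.sqrt p * (Real.sqrt (α i) * Real.sqrt (β i))) := by
      intro i
      rw [sub_sq, Real.sq_sqrt (mul_nonneg hq (hβ i)), Real.sq_sqrt (mul_nonneg hp.le (hα i)),
        Real.sqrt_mul hq, Real.sqrt_mul hp.le]
      ring
    simp only [this, Finset.sum_sub_distrib, Finset.sum_add_distrib, ← Finset.mul_sum, hα1, hβ1,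
      mul_one, hc]
  have hm : ∑ i, (Real.sqrt (β i) - Real.sqrt (α i)) ^ 2 = 2 - 2 * c := by
    have : ∀ i, (Real.sqrt (β i) - Real.sqrt (α i)) ^ 2 = β i + α i -
        2 * (Real.sqrt (α i) * Real.sqrt (β i)) := by
      intro i; rw [sub_sq, Real.sq_sqrt (hβ i), Real.sq_sqrt (hα i)]; ring
    simp only [this, Finset.sum_sub_distrib, Finset.sum_add_distrib, ← Finset.mul_sum, hα1, hβ1, hc]
    ring
  have hpl : ∑ i, (Real.sqrt (β i) + Real.sqrt (α i)) ^ 2 = 2 + 2 * c := by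
    have : ∀ i, (Real.sqrt (β i) + Real.sqrt (α i)) ^ 2 = β i + α i +
        2 * (Real.sqrt (α i) * Real.sqrt (β i)) := by
      intro i; rw [add_sq, Real.sq_sqrt (hβ i), Real.sq_sqrt (hα i)]; ring
    simp only [this, Finset.sum_add_distrib, ← Finset.mul_sum, hα1, hβ1, hc]
    ring
  have hc1 : c ≤ 1 := by
    have : 0 ≤ 2 - 2 * c := by rw [← hm]; exact Finset.sum_nonneg fun i _ => sq_nonneg _
    linarith
  have hcs : (∑ i, |1 * β i - α i|) ^ 2 ≤ (2 - 2 * c) * (2 + 2 * c) := by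
    rw [← hm, ← hpl]
    have := Finset.sum_mul_sq_le_sq_mul_sq Finset.univ
      (fun i => |Real.sqrt (β i) - Real.sqrt (α i)|) (fun i => Real.sqrt (β i) + Real.sqrt (α i))
    simp only [sq_abs] at this
    refine le_trans (le_of_eq ?_) this
    congr 1
    refine Finset.sum_congr rfl fun i _ => ?_
    rw [← abs_of_nonneg (add_nonneg (Real.sqrt_nonneg (β i)) (Real.sqrt_nonneg (α i))), ← abs_mul]
    congr 1
    have h1 := Real.sq_sqrt (hβ i)
    have h2 := Real.sq_sqrt (hα i)
    nlinarith
  rw [hD]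
  set u := Real.sqrt q with hu
  set v := Real.sqrt p with hv
  have hu2 : u ^ 2 = q := Real.sq_sqrt hq
  have hv2 : v ^ 2 = p := Real.sq_sqrt hp.le
  have hu0 : 0 ≤ u := Real.sqrt_nonneg _
  have hv0 : 0 < v := Real.sqrt_pos.mpr hp
  have h8 : p * (∑ i, |1 * β i - α i|) ^ 2 ≤ p * (8 * (1 - c)) := by
    refine mul_le_mul_of_nonneg_left (hcs.trans ?_) hp.le
    nlinarith
  refine h8.trans ?_
  rw [← hu2, ← hv2]
  have h9 : u ^ 2 + v ^ 2 - 2 * (u * v * c) = (u - v) ^ 2 + 2 * (u * v) * (1 - c) := by ring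
  rw [h9]
  rcases le_total (v / 2) u with h' | h'
  · have : v ^ 2 / 2 ≤ u * v := by nlinarith
    nlinarith [sq_nonneg (u - v), mul_le_mul_of_nonneg_right this (sub_nonneg.mpr hc1),
      mul_nonneg (sq_nonneg v) (sub_nonneg.mpr hc1)]
  · have h10 : v ^ 2 / 4 ≤ (u - v) ^ 2 := by nlinarith
    nlinarith [mul_nonneg (mul_nonneg hu0 hv0.le) (sub_nonneg.mpr hc1), mul_nonneg (sq_nonneg v) hc0]

variable {O A : Type*} [Fintype O] [Fintype A]

/-- Twice the squared Hellinger distance of the laws of `τ_H` under `π`. -/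
noncomputable def hel (H : ℕ) (π : Policy O A) (f g : Model O A) : ℝ :=
  sumHist H (fun τ => π.prob τ * (Real.sqrt (f.prob τ) - Real.sqrt (g.prob τ)) ^ 2)

/-- The squared Hellinger distance controls the conditional `ℓ¹` distances after `n` steps. -/
lemma sumHist_sq_segDist_le_hel (f g : Model O A) (π : Policy O A) {H n : ℕ} (hn : n ≤ H) :
    sumHist n (fun τ => g.prob τ * π.prob τ *
      (segDist f g π (f.reach τ) (g.reach τ) (H - n) τ) ^ 2) ≤ 40 * hel H π f g := by
  have hH : H = n + (H - n) := by omega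
  rw [hel]
  conv_rhs => rw [hH]
  rw [sumHist_add, ← sumHist_const_mul]
  refine sumHist_le fun τ hτ => ?_
  set m := H - n
  rcases (mul_nonneg (g.prob_nonneg τ) (π.prob_nonneg τ)).eq_or_lt with h | h
  · rw [← h, zero_mul]
    exact mul_nonneg (by norm_num)
      (sumHist_nonneg fun _ _ => mul_nonneg (π.prob_nonneg _) (sq_nonneg _))
  have hg : g.prob τ ≠ 0 := fun h0 => by simp [h0] at h
  have hπ : π.prob τ ≠ 0 := fun h0 => by simp [h0] at h
  rw [Model.reach_of_ne hg]
  have key := mul_sq_sum_abs_sub_le (X := Fin m → O × A)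
    (α := fun σ => g.segProb τ (List.ofFn σ) * π.segProb τ (List.ofFn σ))
    (β := fun σ => f.segProb τ (List.ofFn σ) * π.segProb τ (List.ofFn σ))
    (fun σ => mul_nonneg (g.segProb_nonneg _ _) (π.segProb_nonneg _ _))
    (fun σ => mul_nonneg (f.segProb_nonneg _ _) (π.segProb_nonneg _ _))
    ((sum_ofFn_eq_sumHist m (fun σ => g.segProb τ σ * π.segProb τ σ)).trans
      (sumHist_segProb_mul g π m τ))
    ((sum_ofFn_eq_sumHist m (fun σ => f.segProb τ σ * π.segProb τ σ)).trans
      (sumHist_segProb_mul f π m τ)) h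
    (mul_nonneg (f.prob_nonneg τ) (π.prob_nonneg τ)) (r := f.reach τ)
    (fun h0 => Model.reach_of_eq (by simpa [hπ] using h0))
    (fun h0 => Model.reach_of_ne fun h1 => h0 (by simp [h1]))
  rw [segDist, ← sum_ofFn_eq_sumHist, ← sum_ofFn_eq_sumHist]
  refine le_trans (le_of_eq ?_) (key.trans (le_of_eq ?_))
  · congr 2
    refine Finset.sum_congr rfl fun σ _ => ?_
    rw [← abs_of_nonneg (π.segProb_nonneg τ (List.ofFn σ)), ← abs_mul,
      abs_of_nonneg (π.segProb_nonneg τ (List.ofFn σ))]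
    congr 1; ring
  · congr 1
    refine Finset.sum_congr rfl fun σ _ => ?_
    have e : ∀ f : Model O A, Real.sqrt (f.prob τ * π.prob τ *
        (f.segProb τ (List.ofFn σ) * π.segProb τ (List.ofFn σ))) =
        Real.sqrt (f.prob (τ ++ List.ofFn σ)) * Real.sqrt (π.prob (τ ++ List.ofFn σ)) := fun f => by
      rw [← Real.sqrt_mul (f.prob_nonneg _), f.prob_append, π.prob_append]
      congr 1; ring
    rw [e, e, ← sub_mul, mul_pow, Real.sq_sqrt (π.prob_nonneg _)]
    ring

lemma mul_hellingerSq_explore [Nonempty A] (f g : Model O A) (U : ℕ → Finset (Test O A)) {H : ℕ}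
    (π : Policy O A) (cont : List A → Policy O A) (h : ℕ) (hU : (coreActions U (h + 1)).Nonempty) :
    (coreActions U (h + 1)).card * (2 * hellingerSq
      (fun τ : Traj O A H => exploreTrajProb f U π cont h τ)
      (fun τ : Traj O A H => exploreTrajProb g U π cont h τ)) =
    ∑ acts ∈ coreActions U (h + 1), hel H (π.explore (cont acts) h acts) f g := by
  have hc : ((coreActions U (h + 1)).card : ℝ) ≠ 0 := by exact_mod_cast hU.card_ne_zero
  simp only [hel, ← sumHist_sum, ← Finset.sum_mul]
  rw [← sum_ofFn_eq_sumHist, hellingerSq]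
  have e0 : ∀ τ : Traj O A H, 0 ≤ exploreProb U π cont h τ := fun τ =>
    div_nonneg (Finset.sum_nonneg fun _ _ => Policy.prob_nonneg _ _) (Nat.cast_nonneg _)
  have e : ∀ τ : Traj O A H, (Real.sqrt (exploreTrajProb f U π cont h τ) -
      Real.sqrt (exploreTrajProb g U π cont h τ)) ^ 2 =
      exploreProb U π cont h τ *
        (Real.sqrt (f.prob (List.ofFn τ)) - Real.sqrt (g.prob (List.ofFn τ))) ^ 2 := fun τ => by
    rw [exploreTrajProb, exploreTrajProb, Real.sqrt_mul (f.prob_nonneg _),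
      Real.sqrt_mul (g.prob_nonneg _), ← sub_mul, mul_pow, Real.sq_sqrt (e0 τ), mul_comm]
  simp only [e]
  rw [← mul_assoc 2, mul_one_div_cancel two_ne_zero, one_mul, Finset.mul_sum]
  refine Finset.sum_congr rfl fun τ _ => ?_
  rw [exploreProb, ← mul_assoc, mul_div_cancel₀ _ hc]

end Hellinger

section ExplorationMoments

variable {O A : Type*} [Fintype O] [Fintype A] [Nonempty A]

lemma explore_act_of_lt (π cont : Policy O A) {h : ℕ} (acts : List A) {τ : Hist O A}
    (hτ : τ.length + 1 < h) (o : O) (a : A) :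
    (π.explore cont h acts).act τ o a = π.act τ o a := by simp [Policy.explore, hτ]

lemma explore_act_of_eq (π cont : Policy O A) {h : ℕ} (acts : List A) {τ : Hist O A}
    (hτ : τ.length + 1 = h) (o : O) (a : A) :
    (π.explore cont h acts).act τ o a = (Fintype.card A : ℝ)⁻¹ := by simp [Policy.explore, hτ]

lemma explore_segProb_of_lt (π cont : Policy O A) {h : ℕ} (acts : List A) (past σ : Hist O A)
    (hl : past.length + σ.length + 1 ≤ h) :
    (π.explore cont h acts).segProb past σ = π.segProb past σ := by
  induction σ generalizing past with
  | nil => rfl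
  | cons x σ ih =>
    simp only [List.length_cons] at hl
    simp only [Policy.segProb]
    rw [explore_act_of_lt _ _ _ (by omega), ih _ (by simp; omega)]

lemma explore_prob_of_lt (π cont : Policy O A) {h : ℕ} (acts : List A) {τ : Hist O A}
    (hl : τ.length + 1 ≤ h) : (π.explore cont h acts).prob τ = π.prob τ :=
  explore_segProb_of_lt π cont acts [] τ (by simpa using hl)

lemma prob_le_card_mul_explore_prob (π cont : Policy O A) {h : ℕ} (acts : List A) {τ : Hist O A}
    (hl : τ.length = h) :
    π.prob τ ≤ Fintype.card A * (π.explore cont h acts).prob τ := by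
  have hA : (1 : ℝ) ≤ Fintype.card A := by exact_mod_cast Fintype.card_pos
  rcases List.eq_nil_or_concat' τ with rfl | ⟨τ', x, rfl⟩
  · simpa [Policy.prob, Policy.segProb] using hA
  · simp only [List.length_append, List.length_singleton] at hl
    rw [Policy.prob_append, Policy.prob_append, explore_prob_of_lt _ _ _ (by omega),
      Policy.segProb_singleton, Policy.segProb_singleton, explore_act_of_eq _ _ _ hl,
      mul_left_comm, mul_inv_cancel₀ (by positivity)]
    refine mul_le_mul_of_nonneg_left ?_ (π.prob_nonneg _)
    rw [← Policy.segProb_singleton]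
    exact π.segProb_le_one _ _

lemma explore_segProb_eq_one (π cont : Policy O A) {h : ℕ} (acts : List A) (past σ : Hist O A)
    {i : ℕ} (hp : past.length = h + i) (hσ : σ.map Prod.snd = acts.drop i) :
    (π.explore cont h acts).segProb past σ = 1 := by
  induction σ generalizing past i with
  | nil => rfl
  | cons x σ ih =>
    have hi : i < acts.length := by
      by_contra hc
      rw [List.drop_eq_nil_of_le (by omega)] at hσ
      simp at hσ
    rw [List.map_cons, List.drop_eq_getElem_cons hi, List.cons.injEq] at hσ
    simp only [Policy.segProb]
    rw [ih (past ++ [x]) (i := i + 1) (by simp; omega) hσ.2, mul_one]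
    have h3 : past.length - h = i := by omega
    simp [Policy.explore, show ¬ past.length + 1 < h by omega, show ¬ past.length + 1 = h by omega,
      h3, hi, hσ.1]

lemma explore_segProb_cons (π cont : Policy O A) {h : ℕ} (acts : List A) (past σ : Hist O A)
    (x : O × A) (hp : past.length + 1 = h) (hσ : σ.map Prod.snd = acts) :
    (π.explore cont h acts).segProb past (x :: σ) = (Fintype.card A : ℝ)⁻¹ := by
  simp only [Policy.segProb]
  rw [explore_act_of_eq _ _ _ hp,
    explore_segProb_eq_one π cont acts _ σ (i := 0) (by simp; omega) (by simpa using hσ), mul_one]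

open Classical in
lemma sum_coreTests (U : ℕ → Finset (Test O A)) (h : ℕ) (F : Test O A → ℝ) :
    ∑ u ∈ U h, F u =
      ∑ acts ∈ coreActions U h, ∑ u ∈ U h with u.1.map Prod.snd = acts, F u :=
  (Finset.sum_fiberwise_of_maps_to (fun _ hu => Finset.mem_image_of_mem _ hu) F).symm

/-- The `ℓ¹` distance of the predictive states of `f` and `g`. -/
noncomputable def testDist (f g : Model O A) (U : ℕ → Finset (Test O A)) (n : ℕ) (τ : Hist O A) : ℝ :=
  ∑ u ∈ U (n + 1), |f.testProb τ u - g.testProb τ u|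

/-- The `ℓ¹` distance of the joint predictions of the next step and the core tests after it. -/
noncomputable def nextDist (f g : Model O A) (U : ℕ → Finset (Test O A)) (n : ℕ) (τ : Hist O A) : ℝ :=
  ∑ x : O × A, ∑ u ∈ U (n + 2), |f.testProb τ (x :: u.1, u.2) - g.testProb τ (x :: u.1, u.2)|

lemma sumHist_mul_sq_sum_le (n : ℕ) (w : Hist O A → ℝ)
    (hw : ∀ τ, 0 ≤ w τ) {ι : Type*} (s : Finset ι) (F : Hist O A → ℝ) (Y : ι → Hist O A → ℝ)
    (hF : ∀ τ, 0 ≤ F τ) (hFY : ∀ τ, τ.length = n → F τ ≤ ∑ i ∈ s, Y i τ) (C : ι → ℝ)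
    (hC : ∀ i ∈ s, sumHist n (fun τ => w τ * Y i τ ^ 2) ≤ C i) :
    sumHist n (fun τ => w τ * F τ ^ 2) ≤ s.card * ∑ i ∈ s, C i := by
  calc sumHist n (fun τ => w τ * F τ ^ 2)
      ≤ sumHist n (fun τ => s.card * ∑ i ∈ s, w τ * Y i τ ^ 2) := by
        refine sumHist_le fun τ hτ => ?_
        rw [← Finset.mul_sum, mul_left_comm]
        refine mul_le_mul_of_nonneg_left ?_ (hw τ)
        exact (pow_le_pow_left₀ (hF τ) (hFY τ hτ) 2).trans sq_sum_le_card_mul_sum_sq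
    _ = s.card * ∑ i ∈ s, sumHist n (fun τ => w τ * Y i τ ^ 2) := by
        rw [sumHist_const_mul, sumHist_sum]
    _ ≤ _ := mul_le_mul_of_nonneg_left (Finset.sum_le_sum hC) (Nat.cast_nonneg _)

lemma sumHist_sq_segDist_explore_le (f g : Model O A) (π cont : Policy O A) (acts : List A)
    {H n : ℕ} (hn : n ≤ H) :
    sumHist n (fun τ => g.prob τ * π.prob τ *
      (segDist f g (π.explore cont n acts) (f.reach τ) (g.reach τ) (H - n) τ) ^ 2) ≤
    Fintype.card A * (40 * hel H (π.explore cont n acts) f g) := by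
  refine le_trans ?_ (mul_le_mul_of_nonneg_left
    (sumHist_sq_segDist_le_hel f g (π.explore cont n acts) hn) (Nat.cast_nonneg _))
  rw [← sumHist_const_mul]
  refine sumHist_le fun τ hτ => ?_
  rw [← mul_assoc, mul_left_comm]
  refine mul_le_mul_of_nonneg_right ?_ (sq_nonneg _)
  exact mul_le_mul_of_nonneg_left (prob_le_card_mul_explore_prob π cont acts hτ)
    (g.prob_nonneg _)

lemma testDist_nonneg (f g : Model O A) (U : ℕ → Finset (Test O A)) (n : ℕ) (τ : Hist O A) :
    0 ≤ testDist f g U n τ := Finset.sum_nonneg fun _ _ => abs_nonneg _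

lemma nextDist_nonneg (f g : Model O A) (U : ℕ → Finset (Test O A)) (n : ℕ) (τ : Hist O A) :
    0 ≤ nextDist f g U n τ :=
  Finset.sum_nonneg fun _ _ => Finset.sum_nonneg fun _ _ => abs_nonneg _

lemma testDist_le_sum_segDist (f g : Model O A) (π : Policy O A) (cont : List A → Policy O A)
    {U : ℕ → Finset (Test O A)} {H n : ℕ} (hU : ∀ t ∈ U (n + 1), t ∈ validTests O A H (n + 1))
    {τ : Hist O A} (hτ : τ.length = n) :
    testDist f g U n τ ≤ ∑ acts ∈ coreActions U (n + 1),
      segDist f g (π.explore (cont acts) n acts) (f.reach τ) (g.reach τ) (H - n) τ := by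
  classical
  subst hτ
  rw [testDist, sum_coreTests]
  refine Finset.sum_le_sum fun acts _ => ?_
  have := sum_test_le_segDist f g (π.explore (cont acts) τ.length acts) (f.reach τ) (g.reach τ) 1
    (H := H) (k := acts.length) (τ := τ) ((U (τ.length + 1)).filter (fun u => u.1.map Prod.snd = acts))
    (fun v hv => hU v (Finset.mem_filter.mp hv).1)
    (fun v hv => by rw [← (Finset.mem_filter.mp hv).2, List.length_map])
    (fun v hv => (explore_segProb_eq_one π _ acts τ v.1 (i := 0) rfl
      (by simpa using (Finset.mem_filter.mp hv).2)).ge)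
  simpa only [Model.testProb_eq, one_mul] using this

lemma sumHist_sq_testDist_le (f g : Model O A) (π : Policy O A) (cont : List A → Policy O A)
    {U : ℕ → Finset (Test O A)} {H n : ℕ} (hn : n + 1 ≤ H)
    (hU : ∀ t ∈ U (n + 1), t ∈ validTests O A H (n + 1)) :
    sumHist n (fun τ => g.prob τ * π.prob τ * testDist f g U n τ ^ 2) ≤
      (coreActions U (n + 1)).card * ∑ acts ∈ coreActions U (n + 1),
        Fintype.card A * (40 * hel H (π.explore (cont acts) n acts) f g) :=
  sumHist_mul_sq_sum_le n (fun τ => g.prob τ * π.prob τ)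
    (fun τ => mul_nonneg (g.prob_nonneg _) (π.prob_nonneg _)) _ _ _ (testDist_nonneg f g U n)
    (fun _ hτ => testDist_le_sum_segDist f g π cont hU hτ) _
    (fun acts _ => sumHist_sq_segDist_explore_le f g π (cont acts) acts (by omega))

lemma sumHist_sq_nextDist_le (f g : Model O A) (π : Policy O A) (cont : List A → Policy O A)
    {U : ℕ → Finset (Test O A)} {H n : ℕ} (hn : n + 2 ≤ H)
    (hU : ∀ t ∈ U (n + 2), t ∈ validTests O A H (n + 2)) :
    sumHist n (fun τ => g.prob τ * π.prob τ * nextDist f g U n τ ^ 2) ≤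
      (coreActions U (n + 2)).card * ∑ acts ∈ coreActions U (n + 2),
        Fintype.card A ^ 2 * (40 * hel H (π.explore (cont acts) (n + 1) acts) f g) := by
  classical
  have hA : (0 : ℝ) < Fintype.card A := by exact_mod_cast Fintype.card_pos
  refine sumHist_mul_sq_sum_le n (fun τ => g.prob τ * π.prob τ)
    (fun τ => mul_nonneg (g.prob_nonneg _) (π.prob_nonneg _)) _ _
    (fun acts τ => Fintype.card A * segDist f g (π.explore (cont acts) (n + 1) acts) (f.reach τ)
      (g.reach τ) (H - n) τ) (nextDist_nonneg f g U n) ?_ _ ?_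
  · intro τ hτ
    subst hτ
    rw [nextDist]
    simp only [sum_coreTests U (τ.length + 2)]
    rw [Finset.sum_comm]
    refine Finset.sum_le_sum fun acts _ => ?_
    set S0 := (U (τ.length + 2)).filter (fun u => u.1.map Prod.snd = acts) with hS0
    let e : (O × A) × Test O A ↪ Test O A :=
      ⟨fun q => (q.1 :: q.2.1, q.2.2), fun q q' h => by
        simp only [Prod.mk.injEq, List.cons.injEq] at h
        exact Prod.ext h.1.1 (Prod.ext h.1.2 h.2)⟩
    have hmem : ∀ v ∈ (Finset.univ ×ˢ S0).map e, ∃ x : O × A, ∃ u ∈ U (τ.length + 2),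
        u.1.map Prod.snd = acts ∧ v = (x :: u.1, u.2) := by
      intro v hv
      obtain ⟨⟨x, u⟩, hq, rfl⟩ := Finset.mem_map.mp hv
      have hu := (Finset.mem_product.mp hq).2
      exact ⟨x, u, (Finset.mem_filter.mp hu).1, (Finset.mem_filter.mp hu).2, rfl⟩
    have := sum_test_le_segDist f g (π.explore (cont acts) (τ.length + 1) acts) (f.reach τ)
      (g.reach τ) (Fintype.card A : ℝ)⁻¹
      (H := H) (k := acts.length + 1) (τ := τ) ((Finset.univ ×ˢ S0).map e) ?_ ?_ ?_
    · rw [Finset.sum_map, Finset.sum_product] at this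
      rw [inv_mul_le_iff₀ hA] at this
      refine le_trans (le_of_eq ?_) this
      simp only [Model.testProb_eq]
      rfl
    · intro v hv
      obtain ⟨x, u, hu, -, rfl⟩ := hmem v hv
      have := hU u hu
      simp only [validTests, Set.mem_ofPred_eq, List.length_cons] at this ⊢
      rcases this with h | h
      · exact Or.inl ⟨h.1, by omega⟩
      · exact Or.inr ⟨h.1, by omega⟩
    · intro v hv
      obtain ⟨x, u, -, hu, rfl⟩ := hmem v hv
      simp [← hu]
    · intro v hv
      obtain ⟨x, u, -, hu, rfl⟩ := hmem v hv
      exact (explore_segProb_cons π _ acts τ u.1 x rfl hu).ge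
  · intro acts _
    have h1 := sumHist_sq_segDist_le_hel f g (π.explore (cont acts) (n + 1) acts)
      (show n ≤ H by omega)
    refine le_trans (le_of_eq ?_) (mul_le_mul_of_nonneg_left h1 (sq_nonneg (Fintype.card A : ℝ)))
    rw [← sumHist_const_mul]
    refine sumHist_congr fun τ hτ => ?_
    rw [explore_prob_of_lt π (cont acts) acts (by omega)]
    ring

lemma sumHist_sq_nextDist_last_le (f g : Model O A) (π : Policy O A)
    (cont : List A → Policy O A) {U : ℕ → Finset (Test O A)} {H n : ℕ} (hn : n + 1 = H)
    (hU : U (H + 1) = {dummyTest}) :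
    (coreActions U (n + 1)).card *
      sumHist n (fun τ => g.prob τ * π.prob τ * nextDist f g U n τ ^ 2) ≤
      ∑ acts ∈ coreActions U (n + 1),
        Fintype.card A ^ 3 * (40 * hel H (π.explore (cont acts) n acts) f g) := by
  classical
  rw [← nsmul_eq_mul, ← Finset.sum_const]
  refine Finset.sum_le_sum fun acts _ => ?_
  have hd : ∀ τ : Hist O A, τ.length = n → nextDist f g U n τ ≤ Fintype.card A *
      segDist f g (π.explore (cont acts) n acts) (f.reach τ) (g.reach τ) (H - n) τ := by
    intro τ hτ
    subst hτ
    rw [nextDist, show τ.length + 2 = H + 1 by omega, hU]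
    simp only [Finset.sum_singleton]
    let e : O ↪ Test O A := ⟨fun o => ([], some o), fun o o' h => by simpa using h⟩
    have hm : ∀ v ∈ Finset.univ.map e, ∃ o, v = ([], some o) := fun v hv => by
      obtain ⟨o, -, rfl⟩ := Finset.mem_map.mp hv
      exact ⟨o, rfl⟩
    have := sum_test_le_segDist f g (π.explore (cont acts) τ.length acts) (f.reach τ)
      (g.reach τ) 1 (H := H) (k := 0) (τ := τ) (Finset.univ.map e) ?_ ?_ ?_
    · rw [one_mul, Finset.sum_map] at this
      rw [Fintype.sum_prod_type]
      refine le_trans (le_of_eq ?_) (mul_le_mul_of_nonneg_left this (Nat.cast_nonneg _))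
      rw [Finset.mul_sum]
      refine Finset.sum_congr rfl fun o _ => ?_
      have he : e o = ([], some o) := rfl
      simp [Model.testProb_eq, Model.rawTest, dummyTest, he, Model.segProb]
    · intro v hv
      obtain ⟨o, rfl⟩ := hm v hv
      exact Or.inl ⟨rfl, by simp; omega⟩
    · intro v hv
      obtain ⟨o, rfl⟩ := hm v hv
      rfl
    · intro v hv
      obtain ⟨o, rfl⟩ := hm v hv
      exact le_rfl
  have h1 := sumHist_sq_segDist_explore_le f g π (cont acts) acts (show n ≤ H by omega)
  refine le_trans ?_ (le_of_le_of_eq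
    (mul_le_mul_of_nonneg_left h1 (sq_nonneg (Fintype.card A : ℝ))) (by ring))
  rw [← sumHist_const_mul]
  refine sumHist_le fun τ hτ => ?_
  rw [mul_left_comm]
  refine mul_le_mul_of_nonneg_left ?_ (mul_nonneg (g.prob_nonneg _) (π.prob_nonneg _))
  rw [← mul_pow]
  exact pow_le_pow_left₀ (nextDist_nonneg f g U n τ) (hd τ hτ) 2

lemma sum_abs_testProb_le_card (f : Model O A) {U : ℕ → Finset (Test O A)} {H n : ℕ}
    (hU : ∀ t ∈ U (n + 1), t ∈ validTests O A H (n + 1)) {τ : Hist O A} (hτ : τ.length = n) :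
    ∑ u ∈ U (n + 1), |f.testProb τ u| ≤ (coreActions U (n + 1)).card := by
  classical
  subst hτ
  rw [sum_coreTests, ← nsmul_one, ← Finset.sum_const]
  refine Finset.sum_le_sum fun acts _ => ?_
  let π : Policy O A := ⟨fun _ _ _ => (Fintype.card A : ℝ)⁻¹, fun _ _ _ => by positivity, by simp⟩
  have := sum_test_le_segDist f f (π.explore π τ.length acts) (f.reach τ) 0 1
    (H := H) (k := acts.length) (τ := τ) ((U (τ.length + 1)).filter (fun u => u.1.map Prod.snd = acts))
    (fun v hv => hU v (Finset.mem_filter.mp hv).1)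
    (fun v hv => by rw [← (Finset.mem_filter.mp hv).2, List.length_map])
    (fun v hv => (explore_segProb_eq_one π _ acts τ v.1 (i := 0) rfl
      (by simpa using (Finset.mem_filter.mp hv).2)).ge)
  simp only [one_mul, zero_mul, sub_zero, ← Model.testProb_eq] at this
  refine this.trans ?_
  have hr : 0 ≤ f.reach τ ∧ f.reach τ ≤ 1 := by unfold Model.reach; split_ifs <;> simp
  rw [← sumHist_segProb_mul f (π.explore π τ.length acts) (H - τ.length) τ, segDist]
  refine sumHist_le fun σ _ => ?_
  rw [zero_mul, sub_zero, abs_of_nonneg (mul_nonneg hr.1 (f.segProb_nonneg _ _)), mul_comm]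
  exact mul_le_mul_of_nonneg_right (mul_le_of_le_one_left (f.segProb_nonneg _ _) hr.2)
    (Policy.segProb_nonneg _ _ _)

end ExplorationMoments

section Operators

variable {O A : Type*} [Fintype O] [Fintype A]

lemma applyOps_append (U : ℕ → Finset (Test O A)) (M : Operators O A) (h : ℕ) (σ ρ : Hist O A)
    (x : Test O A → ℝ) :
    applyOps U M h (σ ++ ρ) x = applyOps U M (h + σ.length) ρ (applyOps U M h σ x) := by
  induction σ generalizing h x with
  | nil => rfl
  | cons y σ ih =>
    simp only [List.cons_append, applyOps, ih, List.length_cons]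
    rw [show h + 1 + σ.length = h + (σ.length + 1) by ring]

lemma applyOps_sub (U : ℕ → Finset (Test O A)) (M : Operators O A) (h : ℕ) (σ : Hist O A)
    (x y : Test O A → ℝ) (u : Test O A) :
    applyOps U M h σ (fun t => x t - y t) u = applyOps U M h σ x u - applyOps U M h σ y u := by
  induction σ generalizing h x y with
  | nil => rfl
  | cons z σ ih =>
    simp only [applyOps, mul_sub, Finset.sum_sub_distrib, ih]

lemma Model.rawTest_cons (f : Model O A) (τ : Hist O A) (x : O × A) (u : Test O A) :
    f.rawTest τ (x :: u.1, u.2) = f.trans τ x.1 * f.rawTest (τ ++ [x]) u := by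
  simp [Model.rawTest, Model.segProb, mul_assoc]

lemma Model.testProb_cons (f : Model O A) (τ : Hist O A) (x : O × A) (u : Test O A) :
    f.prob τ * f.testProb τ (x :: u.1, u.2) =
      f.testProb (τ ++ [x]) u * f.prob (τ ++ [x]) := by
  rw [Model.testProb_eq, Model.testProb_eq, Model.rawTest_cons, Model.prob_append,
    Model.segProb_singleton]
  by_cases h : f.prob τ = 0
  · simp [h]
  rw [Model.reach_of_ne h]
  by_cases h2 : f.trans τ x.1 = 0
  · simp [h2]
  rw [Model.reach_of_ne (by
    rw [Model.prob_append, Model.segProb_singleton]; exact mul_ne_zero h h2)]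
  ring

lemma Model.testProb_dummy_mul (f : Model O A) (τ : Hist O A) :
    f.testProb τ dummyTest * f.prob τ = f.prob τ := by
  by_cases h : f.prob τ = 0
  · simp [h]
  · rw [Model.testProb_eq, Model.reach_of_ne h]; simp [Model.rawTest, dummyTest, Model.segProb]

lemma IsOperatorRep.sum_mul_prob {f : Model O A} {H : ℕ} {U : ℕ → Finset (Test O A)}
    {M : Operators O A} (hM : IsOperatorRep f H U M) {n : ℕ} (hn : n + 1 ≤ H) {τ : Hist O A}
    (hτ : τ.length = n) (x : O × A) {u : Test O A} (hu : u ∈ U (n + 2)) :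
    ∑ t ∈ U (n + 1), M (n + 1) x.1 x.2 u t * (f.testProb τ t * f.prob τ) =
      f.testProb (τ ++ [x]) u * f.prob (τ ++ [x]) := by
  subst hτ
  rw [← hM (τ ++ [x]) (by simp; omega) u (by simpa using hu), applyOps_append]
  simp only [applyOps]
  rw [add_comm 1 τ.length]
  exact Finset.sum_congr rfl fun t ht => by rw [hM τ (by omega) t ht]

lemma IsOperatorRep.sum_mul_testProb {f : Model O A} {H : ℕ} {U : ℕ → Finset (Test O A)}
    {M : Operators O A} (hM : IsOperatorRep f H U M) {n : ℕ} (hn : n + 1 ≤ H) {τ : Hist O A}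
    (hτ : τ.length = n) (x : O × A) {u : Test O A} (hu : u ∈ U (n + 2)) :
    ∑ t ∈ U (n + 1), M (n + 1) x.1 x.2 u t * f.testProb τ t = f.testProb τ (x :: u.1, u.2) := by
  by_cases h : f.prob τ = 0
  · simp [Model.testProb_eq, Model.reach_of_eq h]
  · have h1 := hM.sum_mul_prob hn hτ x hu
    rw [← Model.testProb_cons] at h1
    refine mul_left_cancel₀ h ?_
    rw [← h1, Finset.mul_sum]
    exact Finset.sum_congr rfl fun t _ => by ring

lemma IsOperatorRep.applyOps_dummy {f : Model O A} {H : ℕ} {U : ℕ → Finset (Test O A)}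
    {M : Operators O A} (hM : IsOperatorRep f H U M) (hU : U (H + 1) = {dummyTest})
    {τ : Hist O A} (hτ : τ.length = H) :
    applyOps U M 1 τ (fun t => f.testProb [] t) dummyTest = f.prob τ := by
  rw [hM τ hτ.le dummyTest (by rw [hτ, hU]; simp), Model.testProb_dummy_mul]

/-- The policy `π` after the history `τ`. -/
def Policy.shift (π : Policy O A) (τ : Hist O A) : Policy O A :=
  ⟨fun σ => π.act (τ ++ σ), fun _ _ _ => π.act_nonneg _ _ _, fun _ _ => π.act_sum _ _⟩

lemma Policy.shift_segProb (π : Policy O A) (τ past σ : Hist O A) :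
    (π.shift τ).segProb past σ = π.segProb (τ ++ past) σ := by
  induction σ generalizing past with
  | nil => rfl
  | cons x σ ih => simp only [Policy.segProb, ih, List.append_assoc]; rfl

lemma Policy.shift_prob (π : Policy O A) (τ σ : Hist O A) :
    (π.shift τ).prob σ = π.segProb τ σ := by
  rw [Policy.prob, Policy.shift_segProb, List.append_nil]

/-- `M` is an operator representation of `f` with the two stability properties. -/
structure RegularOps (f : Model O A) (H : ℕ) (U : ℕ → Finset (Test O A)) (α : ℝ)
    (M : Operators O A) : Prop where
  rep : IsOperatorRep f H U M
  future : ∀ n, n + 1 ≤ H → ∀ (x : Test O A → ℝ) (π : Policy O A) (τ : Hist O A),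
    sumHist (H - n) (fun σ => π.segProb τ σ * |applyOps U M (n + 1) σ x dummyTest|) ≤
      (∑ t ∈ U (n + 1), |x t|) / α
  step : ∀ n, n + 2 ≤ H → ∀ (x : Test O A → ℝ) (π : Policy O A),
      ∑ oa : O × A, (∑ u ∈ U (n + 2), |∑ t ∈ U (n + 1), M (n + 1) oa.1 oa.2 u t * x t|) *
        π.act [] oa.1 oa.2 ≤ (coreActions U (n + 2)).card / α * ∑ t ∈ U (n + 1), |x t|

lemma IsGeneralizedRegular.exists_regularOps {f : Model O A} {H : ℕ} {U : ℕ → Finset (Test O A)}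
    {α : ℝ} (hf : IsGeneralizedRegular f H U α) : ∃ M, RegularOps f H U α M := by
  obtain ⟨-, M, hrep, h1, h2⟩ := hf
  refine ⟨M, hrep, fun n hn x π τ => ?_, fun n hn x π => ?_⟩
  · have := h1 (n + 1) (Finset.mem_Icc.mpr ⟨by omega, hn⟩) x (π.shift τ)
    rw [show H + 1 - (n + 1) = H - n by omega, sum_ofFn_eq_sumHist (H - n)
      (fun σ => |applyOps U M (n + 1) σ x dummyTest| * (π.shift τ).prob σ)] at this
    refine le_trans (le_of_eq (sumHist_congr fun σ _ => ?_)) this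
    rw [Policy.shift_prob, mul_comm]
  · exact h2 (n + 1) (Finset.mem_Icc.mpr ⟨by omega, by omega⟩) x π

variable {f g : Model O A} {H : ℕ} {U : ℕ → Finset (Test O A)} {α : ℝ} {M Mf Mg : Operators O A}

/-- The total size of the one-step images of `x` under the operators. -/
def opNorm (U : ℕ → Finset (Test O A)) (M : Operators O A) (n : ℕ) (x : Test O A → ℝ) : ℝ :=
  ∑ oa : O × A, ∑ u ∈ U (n + 2), |∑ t ∈ U (n + 1), M (n + 1) oa.1 oa.2 u t * x t|

lemma opNorm_nonneg (n : ℕ) (x : Test O A → ℝ) : 0 ≤ opNorm U M n x :=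
  Finset.sum_nonneg fun _ _ => Finset.sum_nonneg fun _ _ => abs_nonneg _

/-- The factor with which errors of step `n + 1` enter the error at the end of the episode. -/
noncomputable def errFactor (H : ℕ) (α : ℝ) (n : ℕ) : ℝ := if n + 1 = H then 1 else α⁻¹

/-- The number of action sequences after step `n + 1`; after the last step only the dummy test is
left. -/
noncomputable def actFactor (H : ℕ) (U : ℕ → Finset (Test O A)) (n : ℕ) : ℝ :=
  if n + 1 = H then 1 else (coreActions U (n + 2)).card

lemma RegularOps.opNorm_le [Nonempty A] (hM : RegularOps f H U α M)
    (hU : U (H + 1) = {dummyTest}) {n : ℕ} (hn : n + 1 ≤ H) (x : Test O A → ℝ) :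
    opNorm U M n x ≤ Fintype.card A * actFactor H U n / α * ∑ t ∈ U (n + 1), |x t| := by
  have hA : (0 : ℝ) < Fintype.card A := by exact_mod_cast Fintype.card_pos
  let π : Policy O A := ⟨fun _ _ _ => (Fintype.card A : ℝ)⁻¹, fun _ _ _ => by positivity, by simp⟩
  by_cases h : n + 1 = H
  · have := hM.future n hn x π []
    rw [show H - n = 1 by omega, sumHist_one] at this
    rw [opNorm, actFactor, if_pos h, mul_one, show n + 2 = H + 1 by omega, hU]
    simp only [Finset.sum_singleton]
    simp only [Policy.segProb_singleton, applyOps] at this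
    rw [← Finset.mul_sum, inv_mul_le_iff₀ hA] at this
    exact this.trans_eq (by ring)
  · have := hM.step n (by omega) x π
    rw [← Finset.sum_mul, ← div_eq_mul_inv, div_le_iff₀ hA] at this
    rw [opNorm, actFactor, if_neg h]
    exact this.trans_eq (by ring)

/-- The difference of two families of operators. -/
def opSub (Mf Mg : Operators O A) : Operators O A := fun h o a u t => Mf h o a u t - Mg h o a u t

lemma opNorm_opSub_le (n : ℕ) (x : Test O A → ℝ) :
    opNorm U (opSub Mf Mg) n x ≤ opNorm U Mf n x + opNorm U Mg n x := by
  simp only [opNorm, opSub, ← Finset.sum_add_distrib]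
  refine Finset.sum_le_sum fun oa _ => Finset.sum_le_sum fun u _ => ?_
  simp only [sub_mul, Finset.sum_sub_distrib]
  exact abs_sub _ _

lemma RegularOps.opNorm_opSub_testProb_le [Nonempty A] (hf : RegularOps f H U α Mf)
    (hg : RegularOps g H U α Mg) (hU : U (H + 1) = {dummyTest}) {n : ℕ} (hn : n + 1 ≤ H)
    {τ : Hist O A} (hτ : τ.length = n) :
    opNorm U (opSub Mf Mg) n (g.testProb τ) ≤ nextDist f g U n τ +
      Fintype.card A * actFactor H U n / α * testDist f g U n τ := by
  have h1 := hf.opNorm_le hU hn (fun t => f.testProb τ t - g.testProb τ t)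
  refine le_trans ?_ (add_le_add_right h1 _)
  simp only [opNorm, nextDist, ← Finset.sum_add_distrib]
  refine Finset.sum_le_sum fun oa _ => Finset.sum_le_sum fun u hu => ?_
  rw [← hf.rep.sum_mul_testProb hn hτ oa hu, ← hg.rep.sum_mul_testProb hn hτ oa hu]
  simp only [opSub, sub_mul, mul_sub, Finset.sum_sub_distrib]
  rw [abs_sub_comm (∑ t ∈ U (n + 1), Mf (n + 1) oa.1 oa.2 u t * f.testProb τ t)
    (∑ t ∈ U (n + 1), Mf (n + 1) oa.1 oa.2 u t * g.testProb τ t), add_comm]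
  refine le_trans (le_of_eq ?_) (abs_add_le _ _)
  congr 1; ring

/-- The error at the end of the episode of the hybrid model that follows `g` for `n` steps and the
operators of `f` afterwards. -/
noncomputable def hybridErr (f g : Model O A) (H : ℕ) (U : ℕ → Finset (Test O A)) (Mf : Operators O A)
    (π : Policy O A) (n : ℕ) : ℝ :=
  sumHist n (fun τ => π.prob τ * sumHist (H - n) (fun σ => π.segProb τ σ *
    |applyOps U Mf (n + 1) σ (fun t => g.testProb τ t * g.prob τ) dummyTest - f.prob (τ ++ σ)|))

lemma RegularOps.hybridErr_zero_le (hf : RegularOps f H U α Mf) (hU : U (H + 1) = {dummyTest})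
    (hH : 1 ≤ H) (π : Policy O A) :
    hybridErr f g H U Mf π 0 ≤ testDist f g U 0 [] / α := by
  have := hf.future 0 hH (fun t => g.testProb [] t - f.testProb [] t) π []
  have e : testDist f g U 0 [] = ∑ t ∈ U (0 + 1), |g.testProb [] t - f.testProb [] t| :=
    Finset.sum_congr rfl fun t _ => abs_sub_comm _ _
  rw [e]
  refine le_trans (le_of_eq ?_) this
  simp only [hybridErr, sumHist, Policy.prob, Policy.segProb, one_mul]
  refine sumHist_congr fun σ hσ => ?_
  rw [applyOps_sub, List.nil_append]
  have : g.prob [] = 1 := rfl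
  simp only [this, mul_one]
  rw [hf.rep.applyOps_dummy hU (by simpa using hσ)]

lemma hybridErr_last (π : Policy O A) :
    hybridErr f g H U Mf π H = sumHist H (fun τ => π.prob τ * |g.prob τ - f.prob τ|) := by
  simp only [hybridErr, Nat.sub_self, sumHist, applyOps, Policy.segProb, List.append_nil, one_mul,
    Model.testProb_dummy_mul]

lemma RegularOps.hybridErr_succ_le (hf : RegularOps f H U α Mf) (hg : RegularOps g H U α Mg)
    (hU : U (H + 1) = {dummyTest}) (π : Policy O A) (hα : 0 < α) {n : ℕ} (hn : n + 1 ≤ H) :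
    hybridErr f g H U Mf π (n + 1) ≤ hybridErr f g H U Mf π n +
      sumHist n (fun τ => g.prob τ * π.prob τ *
        (errFactor H α n * opNorm U (opSub Mf Mg) n (g.testProb τ))) := by
  rw [hybridErr, hybridErr, sumHist_succ', ← sumHist_add_fun]
  refine sumHist_le fun τ hτ => ?_
  obtain ⟨m, hm⟩ : ∃ m, H - n = m + 1 := ⟨H - n - 1, by omega⟩
  have hm' : H - (n + 1) = m := by omega
  rw [hm, hm', sumHist, Finset.mul_sum, opNorm, Finset.mul_sum, Finset.mul_sum,
    ← Finset.sum_add_distrib]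
  refine Finset.sum_le_sum fun x _ => ?_
  simp only [Policy.segProb, applyOps]
  set q : Test O A → ℝ := fun t => g.testProb (τ ++ [x]) t * g.prob (τ ++ [x]) with hq
  set q' : Test O A → ℝ :=
    fun u => ∑ t ∈ U (n + 1), Mf (n + 1) x.1 x.2 u t * (g.testProb τ t * g.prob τ) with hq'
  have hdiff : ∀ u ∈ U (n + 2), q u - q' u =
      -(g.prob τ * ∑ t ∈ U (n + 1), opSub Mf Mg (n + 1) x.1 x.2 u t * g.testProb τ t) := by
    intro u hu
    simp only [hq, hq', ← hg.rep.sum_mul_prob hn hτ x hu, ← Finset.sum_sub_distrib,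
      Finset.mul_sum, ← Finset.sum_neg_distrib, opSub]
    exact Finset.sum_congr rfl fun t _ => by ring
  have hsum : ∑ u ∈ U (n + 2), |q u - q' u| = g.prob τ *
      ∑ u ∈ U (n + 2), |∑ t ∈ U (n + 1), opSub Mf Mg (n + 1) x.1 x.2 u t * g.testProb τ t| := by
    rw [Finset.mul_sum]
    refine Finset.sum_congr rfl fun u hu => ?_
    rw [hdiff u hu, abs_neg, abs_mul, abs_of_nonneg (g.prob_nonneg τ)]
  have hmain : sumHist m (fun σ => π.segProb (τ ++ [x]) σ *
      |applyOps U Mf (n + 2) σ (fun t => q t - q' t) dummyTest|) ≤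
      errFactor H α n * ∑ u ∈ U (n + 2), |q u - q' u| := by
    by_cases h : n + 1 = H
    · have h0 : m = 0 := by omega
      subst h0
      rw [errFactor, if_pos h, show n + 2 = H + 1 by omega, hU]
      simp [sumHist, Policy.segProb, applyOps]
    · have := hf.future (n + 1) (by omega) (fun t => q t - q' t) π (τ ++ [x])
      rw [hm'] at this
      rw [errFactor, if_neg h]
      exact this.trans_eq (by ring)
  have hact : π.act τ x.1 x.2 ≤ 1 := by
    have := π.segProb_le_one τ [x]
    rwa [Policy.segProb_singleton] at this
  have htri : sumHist m (fun σ => π.segProb (τ ++ [x]) σ *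
        |applyOps U Mf (n + 1 + 1) σ q dummyTest - f.prob (τ ++ [x] ++ σ)|) ≤
      sumHist m (fun σ => π.segProb (τ ++ [x]) σ *
        |applyOps U Mf (n + 1 + 1) σ q' dummyTest - f.prob (τ ++ x :: σ)|) +
      errFactor H α n * ∑ u ∈ U (n + 2), |q u - q' u| := by
    refine le_trans ?_ (add_le_add_right hmain _)
    rw [← sumHist_add_fun]
    refine sumHist_le fun σ _ => ?_
    rw [← mul_add]
    refine mul_le_mul_of_nonneg_left ?_ (π.segProb_nonneg _ _)
    rw [applyOps_sub, List.append_assoc, List.singleton_append, add_comm]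
    refine le_trans (le_of_eq ?_) (abs_add_le _ _)
    congr 1; ring
  have he : 0 ≤ errFactor H α n := by unfold errFactor; split_ifs <;> positivity
  rw [Policy.prob_append, Policy.segProb_singleton]
  have e1 : sumHist m (fun σ => π.act τ x.1 x.2 * π.segProb (τ ++ [x]) σ *
        |applyOps U Mf (n + 1 + 1) σ q' dummyTest - f.prob (τ ++ x :: σ)|) =
      π.act τ x.1 x.2 * sumHist m (fun σ => π.segProb (τ ++ [x]) σ *
        |applyOps U Mf (n + 1 + 1) σ q' dummyTest - f.prob (τ ++ x :: σ)|) := by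
    rw [← sumHist_const_mul]
    exact sumHist_congr fun σ _ => by ring
  rw [e1]
  have hpi := mul_nonneg (π.prob_nonneg τ) (π.act_nonneg τ x.1 x.2)
  have h2 := mul_le_mul_of_nonneg_left htri hpi
  refine h2.trans ?_
  rw [mul_add, hsum, ← mul_assoc (π.prob τ)]
  refine add_le_add_right ?_ _
  have h3 : 0 ≤ g.prob τ * π.prob τ * (errFactor H α n * ∑ u ∈ U (n + 2),
      |∑ t ∈ U (n + 1), opSub Mf Mg (n + 1) x.1 x.2 u t * g.testProb τ t|) :=
    mul_nonneg (mul_nonneg (g.prob_nonneg τ) (π.prob_nonneg τ))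
      (mul_nonneg he (Finset.sum_nonneg fun _ _ => abs_nonneg _))
  nlinarith [mul_le_mul_of_nonneg_right hact h3]

theorem RegularOps.sumHist_abs_prob_sub_le (hf : RegularOps f H U α Mf)
    (hg : RegularOps g H U α Mg) (hU : U (H + 1) = {dummyTest}) (hH : 1 ≤ H) (hα : 0 < α)
    (π : Policy O A) :
    sumHist H (fun τ => π.prob τ * |f.prob τ - g.prob τ|) ≤ testDist f g U 0 [] / α +
      ∑ n ∈ Finset.range H, sumHist n (fun τ => g.prob τ * π.prob τ *
        (errFactor H α n * opNorm U (opSub Mf Mg) n (g.testProb τ))) := by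
  have key : ∀ k ≤ H, hybridErr f g H U Mf π k ≤ testDist f g U 0 [] / α +
      ∑ n ∈ Finset.range k, sumHist n (fun τ => g.prob τ * π.prob τ *
        (errFactor H α n * opNorm U (opSub Mf Mg) n (g.testProb τ))) := by
    intro k hk
    induction k with
    | zero => simpa using hf.hybridErr_zero_le hU hH π
    | succ k ih =>
      rw [Finset.sum_range_succ, ← add_assoc]
      exact (hf.hybridErr_succ_le hg hU π hα hk).trans (add_le_add_left (ih (by omega)) _)
  have := key H le_rfl
  rw [hybridErr_last] at this
  simpa only [abs_sub_comm (g.prob _)] using this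

/-! ### Bounds on `α` -/

lemma exists_coreTest [Nonempty A] (hf : IsCoreTestSets f H U) {h : ℕ}
    (hh : h ∈ Finset.Icc 1 H) : (U h).Nonempty := by
  let π : Policy O A := ⟨fun _ _ _ => (Fintype.card A : ℝ)⁻¹, fun _ _ _ => by positivity, by simp⟩
  have hh' := Finset.mem_Icc.mp hh
  obtain ⟨τ, hτ, hpos⟩ := exists_of_sumHist_pos
    (by rw [sumHist_segProb_mul f π (h - 1) []]; exact one_pos)
  have hp : f.prob τ ≠ 0 := fun h0 => by
    rw [Model.prob] at h0; simp [h0] at hpos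
  obtain ⟨o, -, ho⟩ := Finset.exists_ne_zero_of_sum_ne_zero
    (by rw [f.trans_sum τ]; exact one_ne_zero)
  obtain ⟨m, hm⟩ := (hf.2 h hh).2 ([], some o) (Or.inl ⟨rfl, by simpa using hh'.2⟩)
  by_contra hne
  rw [Finset.not_nonempty_iff_eq_empty] at hne
  have := hm τ (by omega)
  rw [hne, Finset.sum_empty, Model.testProb_eq, Model.reach_of_ne hp] at this
  simp [Model.rawTest, Model.segProb] at this
  exact ho this

lemma coreActions_nonempty {h : ℕ} (hh : (U h).Nonempty) : (coreActions U h).Nonempty := by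
  classical exact hh.image _

lemma card_coreActions_le {h : ℕ} (hh : h ∈ Finset.Icc 1 H) :
    (coreActions U h).card ≤ maxCoreActions H U :=
  Finset.le_sup (f := fun h => (coreActions U h).card) hh

lemma RegularOps.alpha_le_maxCoreActions [Nonempty A] (hf : RegularOps f H U α M)
    (hc : IsCoreTestSets f H U) (hα : 0 < α) (hH : 1 ≤ H) : α ≤ maxCoreActions H U := by
  let π : Policy O A := ⟨fun _ _ _ => (Fintype.card A : ℝ)⁻¹, fun _ _ _ => by positivity, by simp⟩
  have h1 := hf.future 0 hH (fun t => f.testProb [] t) π []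
  have h2 : sumHist (H - 0) (fun σ => π.segProb [] σ *
      |applyOps U M (0 + 1) σ (fun t => f.testProb [] t) dummyTest|) = 1 := by
    rw [← sumHist_segProb_mul f π H []]
    refine sumHist_congr fun σ hσ => ?_
    rw [hf.rep.applyOps_dummy hc.1 hσ, abs_of_nonneg (f.prob_nonneg σ), mul_comm]
    rfl
  rw [h2, le_div_iff₀ hα, one_mul] at h1
  have hm : 1 ∈ Finset.Icc 1 H := Finset.mem_Icc.mpr ⟨le_rfl, hH⟩
  refine h1.trans ((sum_abs_testProb_le_card f (H := H) (n := 0) (hc.2 1 hm).1 rfl).trans ?_)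
  exact_mod_cast card_coreActions_le hm

lemma RegularOps.alpha_le_two_mul_card [Nonempty A] (hf : RegularOps f H U α M)
    (hc : IsCoreTestSets f H U) (hα : 0 < α) (hH : 1 ≤ H) : α ≤ 2 * Fintype.card A := by
  classical
  have hA : (1 : ℝ) ≤ Fintype.card A := by exact_mod_cast Fintype.card_pos
  let π : Policy O A := ⟨fun _ _ _ => (Fintype.card A : ℝ)⁻¹, fun _ _ _ => by positivity, by simp⟩
  obtain ⟨n, rfl⟩ : ∃ n, H = n + 1 := ⟨H - 1, by omega⟩
  obtain ⟨τ, hτ, hpos⟩ := exists_of_sumHist_pos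
    (by rw [sumHist_segProb_mul f π n []]; exact one_pos)
  have hp : f.prob τ ≠ 0 := fun h0 => by
    rw [Model.prob] at h0; simp [h0] at hpos
  have hm : n + 1 ∈ Finset.Icc 1 (n + 1) := Finset.mem_Icc.mpr ⟨by omega, le_rfl⟩
  have h1 := hf.future n le_rfl (f.testProb τ) π τ
  have h2 : sumHist (n + 1 - n) (fun σ => π.segProb τ σ *
      |applyOps U M (n + 1) σ (f.testProb τ) dummyTest|) = 1 := by
    rw [← sumHist_segProb_mul f π 1 τ, show n + 1 - n = 1 by omega, sumHist_one, sumHist_one]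
    refine Finset.sum_congr rfl fun x _ => ?_
    simp only [applyOps]
    rw [hf.rep.sum_mul_testProb le_rfl hτ x (u := dummyTest)
      (by rw [show n + 2 = n + 1 + 1 from rfl, hc.1]; simp), Model.testProb_eq,
      Model.reach_of_ne hp]
    simp only [Model.rawTest, dummyTest, Option.elim_none, mul_one, one_mul]
    rw [abs_of_nonneg (f.segProb_nonneg _ _), mul_comm]
  rw [h2, le_div_iff₀ hα, one_mul] at h1
  refine h1.trans ((sum_abs_testProb_le_card f (hc.2 _ hm).1 hτ).trans ?_)
  have hsub : coreActions U (n + 1) ⊆ insert [] (Finset.univ.image fun a : A => [a]) := by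
    intro b hb
    obtain ⟨u, hu, rfl⟩ := Finset.mem_image.mp hb
    have hl : u.1.length ≤ 1 := by
      rcases (hc.2 _ hm).1 u hu with h | h <;> omega
    rcases u with ⟨l, e⟩
    match l, hl with
    | [], _ => simp
    | [x], _ => simp
  have hcard : (coreActions U (n + 1)).card ≤ Fintype.card A + 1 :=
    (Finset.card_le_card hsub).trans ((Finset.card_insert_le _ _).trans
      (Nat.add_le_add_right (Finset.card_image_le.trans_eq Finset.card_univ) 1))
  have : ((coreActions U (n + 1)).card : ℝ) ≤ Fintype.card A + 1 := by exact_mod_cast hcard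
  linarith

end Operators

section Factorization

variable {O A : Type*} [Fintype O] [Fintype A]
variable {g : Model O A} {H : ℕ} {U : ℕ → Finset (Test O A)}

lemma sum_abs_le_matNormOne {m n : Type*} [Fintype m] [Finite n] (K : Matrix m n ℝ) (j : n) :
    ∑ i, |K i j| ≤ matNormOne K :=
  le_ciSup (f := fun j => ∑ i, |K i j|) (Set.finite_range _).bddAbove j

lemma matNormOne_nonneg {m n : Type*} [Fintype m] (K : Matrix m n ℝ) : 0 ≤ matNormOne K :=
  Real.iSup_nonneg fun _ => Finset.sum_nonneg fun _ _ => abs_nonneg _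

lemma mem_validTests_of_mem (hc : IsCoreTestSets g H U) {n : ℕ} (hn : n ≤ H) {t : Test O A}
    (ht : t ∈ U (n + 1)) : t ∈ validTests O A H (n + 1) := by
  rcases hn.eq_or_lt with rfl | h
  · rw [hc.1, Finset.mem_singleton] at ht
    subst ht
    exact Or.inr ⟨rfl, by simp [dummyTest]⟩
  · exact (hc.2 _ (Finset.mem_Icc.mpr ⟨by omega, by omega⟩)).1 t ht

lemma exists_coreMatrix_eq_mul (hc : IsCoreTestSets g H U) {n : ℕ} (hn : n ≤ H) :
    ∃ (K : Matrix (U (n + 1)) (Fin (psrRankAt g H n)) ℝ)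
      (V : Matrix (Fin (psrRankAt g H n)) (Fin n → O × A) ℝ), coreMatrix g U n = K * V := by
  classical
  let L := (dynMatrix g H n).mulVecLin
  let b : Module.Basis (Fin (psrRankAt g H n)) ℝ (LinearMap.range L) :=
    Module.finBasisOfFinrankEq ℝ (LinearMap.range L) rfl
  let y : (Fin n → O × A) → LinearMap.range L :=
    fun τ => ⟨L (Pi.single τ 1), LinearMap.mem_range_self _ _⟩
  refine ⟨Matrix.of fun t i =>
      (b i : validTests O A H (n + 1) → ℝ) ⟨t.1, mem_validTests_of_mem hc hn t.2⟩,
    Matrix.of fun i τ => b.repr (y τ) i, ?_⟩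
  ext t τ
  have h1 := congrArg (Subtype.val) (b.sum_repr (y τ))
  have h2 := congrFun h1 ⟨t.1, mem_validTests_of_mem hc hn t.2⟩
  have h3 : (y τ : validTests O A H (n + 1) → ℝ) ⟨t.1, mem_validTests_of_mem hc hn t.2⟩ =
      coreMatrix g U n t τ := by
    simp [y, L, coreMatrix, dynMatrix]
  rw [← h3, Matrix.mul_apply]
  refine h2.symm.trans ?_
  simp only [Submodule.coe_sum, Submodule.coe_smul, Finset.sum_apply, Pi.smul_apply, smul_eq_mul,
    Matrix.of_apply]
  exact Finset.sum_congr rfl fun i _ => mul_comm _ _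

lemma one_le_of_coreMatrix_last [Nonempty A] (hc : IsCoreTestSets g H U) {r : ℕ}
    (K : Matrix (U (H + 1)) (Fin r) ℝ) (V : Matrix (Fin r) (Fin H → O × A) ℝ)
    (h : coreMatrix g U H = K * V) : 1 ≤ r ∧ 1 ≤ matNormOne K * matNormOne V := by
  let π : Policy O A := ⟨fun _ _ _ => (Fintype.card A : ℝ)⁻¹, fun _ _ _ => by positivity, by simp⟩
  obtain ⟨τ, hτ, hpos⟩ := exists_of_sumHist_pos
    (by rw [sumHist_segProb_mul g π H []]; exact one_pos)
  have hp : g.prob τ ≠ 0 := fun h0 => by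
    rw [Model.prob] at h0; simp [h0] at hpos
  subst hτ
  have hd : (dummyTest : Test O A) ∈ U (τ.length + 1) := by rw [hc.1]; simp
  have h1 := congrFun (congrFun h ⟨dummyTest, hd⟩) τ.get
  rw [coreMatrix, List.ofFn_get, Model.testProb_eq, Model.reach_of_ne hp, Matrix.mul_apply] at h1
  simp only [Model.rawTest, dummyTest, Model.segProb, Option.elim_none, mul_one] at h1
  constructor
  · by_contra hr
    have hr0 : r = 0 := by omega
    subst hr0
    simp at h1
  · rw [h1]
    calc _ ≤ ∑ i, matNormOne K * |V i τ.get| := by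
          refine Finset.sum_le_sum fun i _ => (le_abs_self _).trans ?_
          rw [abs_mul]
          refine mul_le_mul_of_nonneg_right ?_ (abs_nonneg _)
          exact (Finset.single_le_sum (f := fun t => |K t i|) (fun _ _ => abs_nonneg _)
            (Finset.mem_univ _)).trans (sum_abs_le_matNormOne K i)
      _ ≤ _ := by
          rw [← Finset.mul_sum]
          exact mul_le_mul_of_nonneg_left (sum_abs_le_matNormOne V _) (matNormOne_nonneg K)

lemma one_le_psrRank [Nonempty A] (hc : IsCoreTestSets g H U) (hH : 1 ≤ H) : 1 ≤ psrRank g H := by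
  obtain ⟨K, V, h⟩ := exists_coreMatrix_eq_mul hc le_rfl
  exact (one_le_of_coreMatrix_last hc K V h).1.trans
    (Finset.le_sup (f := psrRankAt g H) (Finset.mem_Icc.mpr ⟨hH, le_rfl⟩))

lemma one_le_deltaPSR [Nonempty A] (hc : IsCoreTestSets g H U) (hH : 1 ≤ H) :
    1 ≤ deltaPSR g H U := by
  refine le_trans ?_ (le_ciSup (Set.finite_range _).bddAbove (⟨H, hH, le_rfl⟩ : Set.Icc 1 H))
  refine le_csInf ?_ ?_
  · obtain ⟨K, V, h⟩ := exists_coreMatrix_eq_mul hc le_rfl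
    exact ⟨_, K, V, h, rfl⟩
  · rintro r ⟨K, V, h, rfl⟩
    exact (one_le_of_coreMatrix_last hc K V h).2

lemma exists_predictive_factorization [Nonempty A] (hc : IsCoreTestSets g H U) {n : ℕ}
    (hn1 : 1 ≤ n) (hn : n ≤ H) :
    ∃ (K : Test O A → Fin (psrRankAt g H n) → ℝ)
      (V : (Fin n → O × A) → Fin (psrRankAt g H n) → ℝ) (a b : ℝ), 0 < a ∧ 0 ≤ b ∧
      (∀ t ∈ U (n + 1), ∀ τ, g.testProb (List.ofFn τ) t = ∑ i, K t i * V τ i) ∧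
      (∀ i, ∑ t ∈ U (n + 1), |K t i| ≤ a) ∧ (∀ τ, ∑ i, |V τ i| ≤ b) ∧
      a * b ≤ 3 * deltaPSR g H U := by
  classical
  have hδ := one_le_deltaPSR hc (hn1.trans hn)
  have hle := le_ciSup (f := fun h : Set.Icc 1 H => sInf {r : ℝ |
    ∃ (K : Matrix (U (h.1 + 1)) (Fin (psrRankAt g H h.1)) ℝ)
      (V : Matrix (Fin (psrRankAt g H h.1)) (Fin h.1 → O × A) ℝ),
      coreMatrix g U h.1 = K * V ∧ r = matNormOne K * matNormOne V})
    (Set.finite_range _).bddAbove ⟨n, hn1, hn⟩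
  have hlt := lt_of_le_of_lt hle (show deltaPSR g H U < 2 * deltaPSR g H U by linarith)
  obtain ⟨r, ⟨K, V, hKV, rfl⟩, hr⟩ := exists_lt_of_csInf_lt (by
    obtain ⟨K, V, h⟩ := exists_coreMatrix_eq_mul hc hn
    exact ⟨_, K, V, h, rfl⟩) hlt
  have hV0 := matNormOne_nonneg V
  have hK0 := matNormOne_nonneg K
  set ζ := deltaPSR g H U / (matNormOne V + 1) with hζ
  have hζ0 : 0 < ζ := by positivity
  refine ⟨fun t i => if h : t ∈ U (n + 1) then K ⟨t, h⟩ i else 0, fun τ i => V i τ,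
    matNormOne K + ζ, matNormOne V, by positivity, hV0, ?_, ?_, ?_, ?_⟩
  · intro t ht τ
    have := congrFun (congrFun hKV ⟨t, ht⟩) τ
    rw [Matrix.mul_apply] at this
    change g.testProb (List.ofFn τ) t = _ at this
    simpa only [dif_pos ht] using this
  · intro i
    refine le_trans ?_ (le_add_of_nonneg_right hζ0.le)
    refine le_trans (le_of_eq ?_) (sum_abs_le_matNormOne K i)
    rw [← Finset.sum_coe_sort]
    exact Finset.sum_congr rfl fun t _ => by simp
  · exact fun τ => sum_abs_le_matNormOne V τ
  · have : ζ * matNormOne V ≤ deltaPSR g H U := by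
      rw [hζ, div_mul_eq_mul_div, div_le_iff₀ (by positivity)]
      nlinarith
    nlinarith

end Factorization

section Moments

variable {O A : Type*} [Fintype O] [Fintype A] [Nonempty A]
variable {f g : Model O A} {H : ℕ} {U : ℕ → Finset (Test O A)} {α : ℝ} {Mf Mg : Operators O A}

/-- The squared Hellinger distance under the exploration policy at index `k`, for `k < H`. -/
noncomputable def expDist (f g : Model O A) (U : ℕ → Finset (Test O A)) (H : ℕ) (π : Policy O A)
    (cont : ℕ → List A → Policy O A) (k : ℕ) : ℝ :=
  if k < H then hellingerSq (fun τ : Traj O A H => exploreTrajProb f U π (cont k) k τ)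
    (fun τ : Traj O A H => exploreTrajProb g U π (cont k) k τ) else 0

lemma hellingerSq_nonneg {X : Type*} [Fintype X] (P Q : X → ℝ) : 0 ≤ hellingerSq P Q :=
  mul_nonneg (by norm_num) (Finset.sum_nonneg fun _ _ => sq_nonneg _)

lemma expDist_nonneg (π : Policy O A) (cont : ℕ → List A → Policy O A) (k : ℕ) :
    0 ≤ expDist f g U H π cont k := by
  unfold expDist; split_ifs
  · exact hellingerSq_nonneg _ _
  · exact le_rfl

/-- The factor `A³ U_A⁴ / α⁴`. -/
noncomputable def momentFactor (O : Type*) {A : Type*} [Fintype A] (H : ℕ) (U : ℕ → Finset (Test O A)) (α : ℝ) : ℝ :=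
  (Fintype.card A : ℝ) ^ 3 * (maxCoreActions H U : ℝ) ^ 4 / α ^ 4

lemma sum_hel_explore (hc : IsCoreTestSets g H U) (π : Policy O A)
    (cont : ℕ → List A → Policy O A) {k : ℕ} (hk : k + 1 ≤ H) :
    ∑ acts ∈ coreActions U (k + 1), hel H (π.explore (cont k acts) k acts) f g =
      (coreActions U (k + 1)).card * (2 * expDist f g U H π cont k) := by
  rw [expDist, if_pos (by omega), mul_hellingerSq_explore f g U π (cont k) k
    (coreActions_nonempty (exists_coreTest hc (Finset.mem_Icc.mpr ⟨by omega, hk⟩)))]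

lemma sumHist_sq_testDist_le_expDist (hc : IsCoreTestSets g H U) (π : Policy O A)
    (cont : ℕ → List A → Policy O A) {n : ℕ} (hn : n + 1 ≤ H) :
    sumHist n (fun τ => g.prob τ * π.prob τ * testDist f g U n τ ^ 2) ≤
      80 * Fintype.card A * (maxCoreActions H U : ℝ) ^ 2 * expDist f g U H π cont n := by
  have hm : n + 1 ∈ Finset.Icc 1 H := Finset.mem_Icc.mpr ⟨by omega, hn⟩
  have h1 := sumHist_sq_testDist_le f g π (cont n) hn (hc.2 _ hm).1
  simp only [← Finset.mul_sum, sum_hel_explore hc π cont hn] at h1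
  have hcard : ((coreActions U (n + 1)).card : ℝ) ≤ maxCoreActions H U := by
    exact_mod_cast card_coreActions_le hm
  refine h1.trans ?_
  have h2 : ((coreActions U (n + 1)).card : ℝ) ^ 2 ≤ (maxCoreActions H U : ℝ) ^ 2 :=
    pow_le_pow_left₀ (Nat.cast_nonneg _) hcard 2
  have h3 : 0 ≤ 80 * (Fintype.card A : ℝ) * expDist f g U H π cont n :=
    mul_nonneg (by positivity) (expDist_nonneg _ _ _)
  nlinarith [mul_le_mul_of_nonneg_left h2 h3]

lemma sumHist_sq_nextDist_le_expDist (hc : IsCoreTestSets g H U) (π : Policy O A)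
    (cont : ℕ → List A → Policy O A) {n : ℕ} (hn : n + 2 ≤ H) :
    sumHist n (fun τ => g.prob τ * π.prob τ * nextDist f g U n τ ^ 2) ≤
      80 * (Fintype.card A : ℝ) ^ 2 * (maxCoreActions H U : ℝ) ^ 2 *
        expDist f g U H π cont (n + 1) := by
  have hm : n + 2 ∈ Finset.Icc 1 H := Finset.mem_Icc.mpr ⟨by omega, hn⟩
  have h1 := sumHist_sq_nextDist_le f g π (cont (n + 1)) hn (hc.2 _ hm).1
  simp only [← Finset.mul_sum] at h1
  rw [sum_hel_explore hc π cont (k := n + 1) hn] at h1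
  have hcard : ((coreActions U (n + 2)).card : ℝ) ≤ maxCoreActions H U := by
    exact_mod_cast card_coreActions_le hm
  refine h1.trans ?_
  have h2 : ((coreActions U (n + 2)).card : ℝ) ^ 2 ≤ (maxCoreActions H U : ℝ) ^ 2 :=
    pow_le_pow_left₀ (Nat.cast_nonneg _) hcard 2
  have h3 : 0 ≤ 80 * (Fintype.card A : ℝ) ^ 2 * expDist f g U H π cont (n + 1) :=
    mul_nonneg (by positivity) (expDist_nonneg _ _ _)
  rw [show n + 1 + 1 = n + 2 from rfl]
  nlinarith [mul_le_mul_of_nonneg_left h2 h3]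

lemma sumHist_sq_nextDist_last_le_expDist (hc : IsCoreTestSets g H U) (π : Policy O A)
    (cont : ℕ → List A → Policy O A) {n : ℕ} (hn : n + 1 = H) :
    sumHist n (fun τ => g.prob τ * π.prob τ * nextDist f g U n τ ^ 2) ≤
      80 * (Fintype.card A : ℝ) ^ 3 * expDist f g U H π cont n := by
  have hm : n + 1 ∈ Finset.Icc 1 H := Finset.mem_Icc.mpr ⟨by omega, hn.le⟩
  have h1 := sumHist_sq_nextDist_last_le f g π (cont n) hn hc.1
  simp only [← Finset.mul_sum] at h1
  rw [sum_hel_explore hc π cont (k := n) hn.le] at h1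
  have hpos : (0 : ℝ) < (coreActions U (n + 1)).card := by
    exact_mod_cast (coreActions_nonempty (exists_coreTest hc hm)).card_pos
  refine le_of_mul_le_mul_left (h1.trans_eq ?_) hpos
  ring

lemma RegularOps.sumHist_sq_opNorm_le (hf : RegularOps f H U α Mf) (hg : RegularOps g H U α Mg)
    (hc : IsCoreTestSets g H U) (hα : 0 < α) (π : Policy O A)
    (cont : ℕ → List A → Policy O A) {n : ℕ} (hn : n + 1 ≤ H) :
    sumHist n (fun τ => g.prob τ * π.prob τ *
      (errFactor H α n * opNorm U (opSub Mf Mg) n (g.testProb τ)) ^ 2) ≤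
      320 * momentFactor O H U α *
        (expDist f g U H π cont n + expDist f g U H π cont (n + 1)) := by
  have hA : (1 : ℝ) ≤ Fintype.card A := by exact_mod_cast Fintype.card_pos
  have hαU := hg.alpha_le_maxCoreActions hc hα (by omega)
  set a : ℝ := (Fintype.card A : ℝ) with ha
  set z : ℝ := maxCoreActions H U / α with hz
  have hz1 : 1 ≤ z := (one_le_div hα).mpr hαU
  have hB : momentFactor O H U α = a ^ 3 * z ^ 4 := by
    rw [momentFactor, hz, div_pow, mul_div_assoc]
  have hz2 : 1 ≤ z ^ 2 := one_le_pow₀ hz1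
  have hz4 : z ^ 2 ≤ z ^ 4 := pow_le_pow_right₀ hz1 (by norm_num)
  have ha3 : a ^ 2 ≤ a ^ 3 := pow_le_pow_right₀ hA (by norm_num)
  set c := errFactor H α n
  set k := actFactor H U n
  set D0 := expDist f g U H π cont n with hD0
  set D1 := expDist f g U H π cont (n + 1) with hD1
  have hD0' : 0 ≤ D0 := expDist_nonneg _ _ _
  have hD1' : 0 ≤ D1 := expDist_nonneg _ _ _
  have hc0 : 0 ≤ c := by simp only [c, errFactor]; split_ifs <;> positivity
  have hk0 : 0 ≤ k := by simp only [k, actFactor]; split_ifs <;> positivity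
  have hQ := sumHist_sq_testDist_le_expDist (f := f) hc π cont hn
  have step : sumHist n (fun τ => g.prob τ * π.prob τ *
      (c * opNorm U (opSub Mf Mg) n (g.testProb τ)) ^ 2) ≤
      2 * c ^ 2 * sumHist n (fun τ => g.prob τ * π.prob τ * nextDist f g U n τ ^ 2) +
      2 * (c * k / α) ^ 2 * a ^ 2 *
        sumHist n (fun τ => g.prob τ * π.prob τ * testDist f g U n τ ^ 2) := by
    rw [← sumHist_const_mul, ← sumHist_const_mul, ← sumHist_add_fun]
    refine sumHist_le fun τ hτ => ?_
    have h1 := hf.opNorm_opSub_testProb_le hg hc.1 hn hτ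
    have h2 : c * opNorm U (opSub Mf Mg) n (g.testProb τ) ≤
        c * (nextDist f g U n τ + a * k / α * testDist f g U n τ) :=
      mul_le_mul_of_nonneg_left h1 hc0
    have h3 := pow_le_pow_left₀ (mul_nonneg hc0 (opNorm_nonneg _ _)) h2 2
    have hw := mul_nonneg (g.prob_nonneg τ) (π.prob_nonneg τ)
    refine (mul_le_mul_of_nonneg_left h3 hw).trans ?_
    have h4 : (c * (nextDist f g U n τ + a * k / α * testDist f g U n τ)) ^ 2 ≤
        2 * c ^ 2 * nextDist f g U n τ ^ 2 +
        2 * (c * k / α) ^ 2 * a ^ 2 * testDist f g U n τ ^ 2 := by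
      have : c * (a * k / α * testDist f g U n τ) = (c * k / α) * a * testDist f g U n τ := by ring
      rw [mul_add, this]
      nlinarith [sq_nonneg (c * nextDist f g U n τ - (c * k / α) * a * testDist f g U n τ)]
    exact (mul_le_mul_of_nonneg_left h4 hw).trans_eq (by ring)
  refine step.trans ?_
  rw [hB]
  have hQ0 : 0 ≤ sumHist n (fun τ => g.prob τ * π.prob τ * testDist f g U n τ ^ 2) :=
    sumHist_nonneg fun τ _ =>
      mul_nonneg (mul_nonneg (g.prob_nonneg τ) (π.prob_nonneg τ)) (sq_nonneg _)
  have hU2 : (maxCoreActions H U : ℝ) ^ 2 = α ^ 2 * z ^ 2 := by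
    rw [hz, div_pow]; field_simp
  rw [hU2] at hQ
  by_cases h : n + 1 = H
  · have hR := sumHist_sq_nextDist_last_le_expDist (f := f) hc π cont h
    have hc1 : c = 1 := by simp only [c, errFactor, if_pos h]
    have hk1 : k = 1 := by simp only [k, actFactor, if_pos h]
    rw [hc1, hk1]
    have e : 2 * (1 * 1 / α) ^ 2 * a ^ 2 * (80 * a * (α ^ 2 * z ^ 2) * D0) =
        160 * (a ^ 3 * z ^ 2) * D0 := by field_simp; ring
    have h5 : 2 * (1 * 1 / α) ^ 2 * a ^ 2 *
        sumHist n (fun τ => g.prob τ * π.prob τ * testDist f g U n τ ^ 2) ≤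
        160 * (a ^ 3 * z ^ 2) * D0 := by
      rw [← e]; exact mul_le_mul_of_nonneg_left hQ (by positivity)
    have h6 : a ^ 3 ≤ a ^ 3 * z ^ 4 := le_mul_of_one_le_right (by positivity) (hz2.trans hz4)
    have h7 : a ^ 3 * z ^ 2 ≤ a ^ 3 * z ^ 4 := mul_le_mul_of_nonneg_left hz4 (by positivity)
    have h8 := mul_le_mul_of_nonneg_right h6 hD0'
    have h9 := mul_le_mul_of_nonneg_right h7 hD0'
    have h10 : 0 ≤ a ^ 3 * z ^ 4 * D1 := by positivity
    nlinarith
  · have hR := sumHist_sq_nextDist_le_expDist (f := f) hc π cont (show n + 2 ≤ H by omega)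
    rw [hU2] at hR
    have hc1 : c = α⁻¹ := by simp only [c, errFactor, if_neg h]
    have hk1 : k ≤ α * z := by
      simp only [k, actFactor, if_neg h]
      rw [hz, mul_div_cancel₀ _ hα.ne']
      exact_mod_cast card_coreActions_le (Finset.mem_Icc.mpr ⟨by omega, by omega⟩)
    have hck : (c * k / α) ^ 2 ≤ (z / α) ^ 2 := by
      refine pow_le_pow_left₀ (by positivity) ?_ 2
      rw [hc1]
      refine div_le_div_of_nonneg_right ?_ hα.le
      rw [inv_mul_le_iff₀ hα]; exact hk1
    have e : 2 * (z / α) ^ 2 * a ^ 2 * (80 * a * (α ^ 2 * z ^ 2) * D0) =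
        160 * (a ^ 3 * z ^ 4) * D0 := by field_simp; ring
    have h5 : 2 * (c * k / α) ^ 2 * a ^ 2 *
        sumHist n (fun τ => g.prob τ * π.prob τ * testDist f g U n τ ^ 2) ≤
        160 * (a ^ 3 * z ^ 4) * D0 := by
      rw [← e]
      exact mul_le_mul (by gcongr) hQ hQ0 (by positivity)
    have e2 : 2 * c ^ 2 * (80 * a ^ 2 * (α ^ 2 * z ^ 2) * D1) = 160 * (a ^ 2 * z ^ 2) * D1 := by
      rw [hc1]; field_simp; ring
    have h6 : 2 * c ^ 2 * sumHist n (fun τ => g.prob τ * π.prob τ * nextDist f g U n τ ^ 2) ≤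
        160 * (a ^ 2 * z ^ 2) * D1 := by
      rw [← e2]; exact mul_le_mul_of_nonneg_left hR (by positivity)
    have h7 : a ^ 2 * z ^ 2 ≤ a ^ 3 * z ^ 4 := mul_le_mul ha3 hz4 (by positivity) (by positivity)
    have h8 := mul_le_mul_of_nonneg_right h7 hD1'
    have h10 : 0 ≤ a ^ 3 * z ^ 4 * D1 := by positivity
    have h11 : 0 ≤ a ^ 3 * z ^ 4 * D0 := by positivity
    nlinarith

lemma RegularOps.sq_testDist_nil_le (hg : RegularOps g H U α Mg)
    (hc : IsCoreTestSets g H U) (hα : 0 < α) (hH : 1 ≤ H) (π : Policy O A)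
    (cont : ℕ → List A → Policy O A) :
    (testDist f g U 0 [] / α) ^ 2 ≤ 320 * momentFactor O H U α * expDist f g U H π cont 0 := by
  have hA : (1 : ℝ) ≤ Fintype.card A := by exact_mod_cast Fintype.card_pos
  have hαU := hg.alpha_le_maxCoreActions hc hα hH
  have hz1 : 1 ≤ (maxCoreActions H U : ℝ) / α := (one_le_div hα).mpr hαU
  have h1 := sumHist_sq_testDist_le_expDist (f := f) hc π cont (n := 0) hH
  have e : g.prob [] = 1 ∧ π.prob [] = 1 := ⟨rfl, rfl⟩
  simp only [sumHist, e.1, e.2, one_mul] at h1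
  have hD : 0 ≤ expDist f g U H π cont 0 := expDist_nonneg _ _ _
  rw [div_pow, div_le_iff₀ (by positivity)]
  refine h1.trans ?_
  have hB : momentFactor O H U α * α ^ 2 = (Fintype.card A : ℝ) ^ 3 * (maxCoreActions H U : ℝ) ^ 2 *
      ((maxCoreActions H U : ℝ) / α) ^ 2 := by
    rw [momentFactor]; field_simp
  have h2 : (Fintype.card A : ℝ) * (maxCoreActions H U : ℝ) ^ 2 ≤ momentFactor O H U α * α ^ 2 := by
    rw [hB]
    have h3 : (1 : ℝ) ≤ ((maxCoreActions H U : ℝ) / α) ^ 2 := one_le_pow₀ hz1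
    have h4 : (Fintype.card A : ℝ) ≤ (Fintype.card A : ℝ) ^ 3 := le_self_pow₀ hA (by norm_num)
    calc (Fintype.card A : ℝ) * (maxCoreActions H U : ℝ) ^ 2
        ≤ (Fintype.card A : ℝ) ^ 3 * (maxCoreActions H U : ℝ) ^ 2 := by gcongr
      _ ≤ _ := le_mul_of_one_le_right (by positivity) h3
  have h5 := mul_le_mul_of_nonneg_right h2 hD
  have h6 : 0 ≤ (Fintype.card A : ℝ) * (maxCoreActions H U : ℝ) ^ 2 * expDist f g U H π cont 0 := by
    positivity
  nlinarith

end Moments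

lemma sum_min_one_le_sqrt_of_sq_le {e : ℕ → ℝ} {D : ℕ → ℕ → ℝ} (he : ∀ t, 0 ≤ e t)
    (h : ∀ t s, e t ^ 2 ≤ D t s) (T : ℕ) :
    ∑ t ∈ Finset.range T, min 1 (e t) ≤
      Real.sqrt ((T + ∑ t ∈ Finset.range T, ∑ s ∈ Finset.range t, D t s) *
        (2 * Real.log (1 + T))) := by
  have h1 := sum_min_one_le_sqrt (X := Unit) (n := Unit) (J := Unit) (a := 1) (b := 1) one_pos
    (p := fun _ _ => 1) (fun _ _ => zero_le_one) (fun _ => by simp) (x := fun _ _ => 1)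
    (fun _ => by simp) (w := fun t _ _ => min 1 (e t))
    (fun t _ => by simp [abs_of_nonneg (le_min zero_le_one (he t))]) T
  have hm : ∀ t, |min 1 (e t)| = min 1 (e t) := fun t => abs_of_nonneg (le_min zero_le_one (he t))
  simp only [dotProduct, Finset.univ_unique, Finset.sum_singleton, mul_one, one_mul, hm,
    ← min_assoc, min_self, Fintype.card_unit, Nat.cast_one, one_pow] at h1
  refine h1.trans (Real.sqrt_le_sqrt ?_)
  have hl : 0 ≤ Real.log (1 + (T : ℝ)) := Real.log_nonneg (by simp)
  refine mul_le_mul_of_nonneg_right ?_ (by positivity)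
  refine add_le_add_right (Finset.sum_le_sum fun t _ => Finset.sum_le_sum fun s _ => ?_) _
  exact (pow_le_pow_left₀ (le_min zero_le_one (he t)) (min_le_right _ _) 2).trans (h t s)

section Bound

variable {O A : Type*} [Fintype O] [Fintype A] [Nonempty A]
variable {f g : Model O A} {H : ℕ} {U : ℕ → Finset (Test O A)} {α : ℝ} {Mf Mg : Operators O A}

lemma iota_nonneg (T : ℕ) : 0 ≤ iota g H U α T := by
  refine mul_nonneg zero_le_two (Real.log_nonneg ?_)
  have : (0 : ℝ) ≤ 4 * (psrRank g H : ℝ) * (Fintype.card A : ℝ) ^ 2 *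
    (maxCoreActions H U : ℝ) ^ 2 * (deltaPSR g H U) ^ 2 * (T : ℝ) / α ^ 4 := by positivity
  linarith

lemma RegularOps.two_mul_log_le_iota (hg : RegularOps g H U α Mg)
    (hc : IsCoreTestSets g H U) (hα : 0 < α) (hH : 1 ≤ H) (T : ℕ) :
    2 * Real.log (1 + T) ≤ iota g H U α T := by
  have h1 := hg.alpha_le_maxCoreActions hc hα hH
  have h2 := hg.alpha_le_two_mul_card hc hα hH
  have h3 : (1 : ℝ) ≤ psrRank g H := by exact_mod_cast one_le_psrRank hc hH
  have h4 : (1 : ℝ) ≤ deltaPSR g H U ^ 2 := one_le_pow₀ (one_le_deltaPSR hc hH)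
  unfold iota
  refine mul_le_mul_of_nonneg_left (Real.log_le_log (by positivity) ?_) zero_le_two
  rw [add_le_add_iff_left, le_div_iff₀ (by positivity)]
  have h5 : α ^ 4 ≤ (2 * (Fintype.card A : ℝ)) ^ 2 * (maxCoreActions H U : ℝ) ^ 2 := by
    calc α ^ 4 = α ^ 2 * α ^ 2 := by ring
      _ ≤ _ := by gcongr
  have h6 : (1 : ℝ) ≤ (psrRank g H : ℝ) * deltaPSR g H U ^ 2 := one_le_mul_of_one_le_of_one_le h3 h4
  calc (T : ℝ) * α ^ 4
      ≤ T * ((2 * (Fintype.card A : ℝ)) ^ 2 * (maxCoreActions H U : ℝ) ^ 2) * 1 := by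
        rw [mul_one]; gcongr
    _ ≤ T * ((2 * (Fintype.card A : ℝ)) ^ 2 * (maxCoreActions H U : ℝ) ^ 2) *
        ((psrRank g H : ℝ) * deltaPSR g H U ^ 2) := by gcongr
    _ = _ := by ring

lemma RegularOps.sum_min_one_error_le {M : ℕ → Operators O A} {F : ℕ → Model O A}
    (hf : ∀ t, RegularOps (F t) H U α (M t)) (hg : RegularOps g H U α Mg)
    (hc : IsCoreTestSets g H U) (hα : 0 < α) (π : ℕ → Policy O A) {n : ℕ} (hn1 : 1 ≤ n)
    (hn : n + 1 ≤ H) (T : ℕ) :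
    ∑ t ∈ Finset.range T, min 1 (sumHist n (fun τ => g.prob τ * (π t).prob τ *
        (errFactor H α n * opNorm U (opSub (M t) Mg) n (g.testProb τ)))) ≤
      Real.sqrt ((T + ∑ t ∈ Finset.range T, ∑ s ∈ Finset.range t,
        sumHist n (fun τ => g.prob τ * (π s).prob τ *
          (errFactor H α n * opNorm U (opSub (M t) Mg) n (g.testProb τ)) ^ 2)) *
        (9 * psrRank g H * iota g H U α T)) := by
  classical
  have hH : 1 ≤ H := by omega
  obtain ⟨K, V, a, b, ha, hb, hKV, hK, hV, hab⟩ :=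
    exists_predictive_factorization hc hn1 (show n ≤ H by omega)
  have hA : (1 : ℝ) ≤ Fintype.card A := by exact_mod_cast Fintype.card_pos
  have hαU := hg.alpha_le_maxCoreActions hc hα hH
  have hUpos : (0 : ℝ) < maxCoreActions H U := hα.trans_le hαU
  set c := errFactor H α n with hcdef
  have hc0 : 0 ≤ c := by simp only [hcdef, errFactor]; split_ifs <;> positivity
  set a' : ℝ := 2 * Fintype.card A * maxCoreActions H U / α ^ 2 * a with ha'
  have ha'0 : 0 < a' := by positivity
  have hck : c * actFactor H U n / α ≤ maxCoreActions H U / α ^ 2 := by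
    by_cases h : n + 1 = H
    · rw [hcdef, errFactor, actFactor, if_pos h, if_pos h, one_mul, div_le_div_iff₀ hα (by positivity)]
      nlinarith
    · rw [hcdef, errFactor, actFactor, if_neg h, if_neg h]
      have : ((coreActions U (n + 2)).card : ℝ) ≤ maxCoreActions H U := by
        exact_mod_cast card_coreActions_le (Finset.mem_Icc.mpr ⟨by omega, by omega⟩)
      rw [show α⁻¹ * ((coreActions U (n + 2)).card : ℝ) / α =
        ((coreActions U (n + 2)).card : ℝ) / α ^ 2 by field_simp]
      gcongr
  let w : ℕ → (O × A) × U (n + 2) → Fin (psrRankAt g H n) → ℝ := fun t j i =>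
    c * ∑ v ∈ U (n + 1), opSub (M t) Mg (n + 1) j.1.1 j.1.2 j.2 v * K v i
  have hw : ∀ t i, ∑ j, |w t j i| ≤ a' := by
    intro t i
    have e : ∑ j, |w t j i| = c * opNorm U (opSub (M t) Mg) n (fun v => K v i) := by
      simp only [w, abs_mul, abs_of_nonneg hc0, ← Finset.mul_sum, opNorm, Fintype.sum_prod_type]
      congr 1
      refine Finset.sum_congr rfl fun o _ => Finset.sum_congr rfl fun a _ => ?_
      exact Finset.sum_coe_sort (U (n + 2))
        (fun u => |∑ v ∈ U (n + 1), opSub (M t) Mg (n + 1) o a u v * K v i|)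
    have h1 := opNorm_opSub_le (U := U) (Mf := M t) (Mg := Mg) n (fun v => K v i)
    have h2 := (hf t).opNorm_le hc.1 hn (fun v => K v i)
    have h3 := hg.opNorm_le hc.1 hn (fun v => K v i)
    have h4 : opNorm U (opSub (M t) Mg) n (fun v => K v i) ≤
        2 * Fintype.card A * (actFactor H U n / α) * a := by
      have hk0 : 0 ≤ actFactor H U n := by unfold actFactor; split_ifs <;> positivity
      have h5 : (Fintype.card A : ℝ) * actFactor H U n / α * ∑ v ∈ U (n + 1), |K v i| ≤
          Fintype.card A * actFactor H U n / α * a :=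
        mul_le_mul_of_nonneg_left (hK i) (by positivity)
      calc _ ≤ _ := h1.trans (add_le_add (h2.trans h5) (h3.trans h5))
        _ = _ := by ring
    rw [e]
    calc c * opNorm U (opSub (M t) Mg) n (fun v => K v i)
        ≤ c * (2 * Fintype.card A * (actFactor H U n / α) * a) :=
          mul_le_mul_of_nonneg_left h4 hc0
      _ = 2 * Fintype.card A * a * (c * actFactor H U n / α) := by ring
      _ ≤ 2 * Fintype.card A * a * (maxCoreActions H U / α ^ 2) :=
          mul_le_mul_of_nonneg_left hck (by positivity)
      _ = a' := by rw [ha']; ring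
  have hG : ∀ t (τ : Fin n → O × A), ∑ j, |w t j ⬝ᵥ V τ| =
      c * opNorm U (opSub (M t) Mg) n (g.testProb (List.ofFn τ)) := by
    intro t τ
    have e : ∀ j, w t j ⬝ᵥ V τ = c * ∑ v ∈ U (n + 1),
        opSub (M t) Mg (n + 1) j.1.1 j.1.2 j.2 v * g.testProb (List.ofFn τ) v := by
      intro j
      simp only [w, dotProduct, mul_assoc, ← Finset.mul_sum, Finset.sum_mul]
      congr 1
      rw [Finset.sum_comm]
      refine Finset.sum_congr rfl fun v hv => ?_
      rw [hKV v hv τ, Finset.mul_sum]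
    simp only [e, abs_mul, abs_of_nonneg hc0, ← Finset.mul_sum, opNorm, Fintype.sum_prod_type]
    congr 1
    refine Finset.sum_congr rfl fun o _ => Finset.sum_congr rfl fun a _ => ?_
    exact Finset.sum_coe_sort (U (n + 2)) (fun u => |∑ v ∈ U (n + 1),
      opSub (M t) Mg (n + 1) o a u v * g.testProb (List.ofFn τ) v|)
  have key := sum_min_one_le_sqrt (X := Fin n → O × A) (a := a') (b := b) ha'0
    (p := fun t τ => g.prob (List.ofFn τ) * (π t).prob (List.ofFn τ))
    (fun t τ => mul_nonneg (g.prob_nonneg _) (Policy.prob_nonneg _ _))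
    (fun t => ((sum_ofFn_eq_sumHist n (fun τ => g.prob τ * (π t).prob τ)).trans
      (sumHist_segProb_mul g (π t) n [])).le) (x := V) hV (w := w) hw T
  simp only [hG] at key
  have e1 : ∀ t, ∑ τ : Fin n → O × A, g.prob (List.ofFn τ) * (π t).prob (List.ofFn τ) *
      (c * opNorm U (opSub (M t) Mg) n (g.testProb (List.ofFn τ))) = sumHist n (fun τ =>
      g.prob τ * (π t).prob τ * (c * opNorm U (opSub (M t) Mg) n (g.testProb τ))) :=
    fun t => sum_ofFn_eq_sumHist n
      (fun τ => g.prob τ * (π t).prob τ * (c * opNorm U (opSub (M t) Mg) n (g.testProb τ)))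
  have e2 : ∀ t s, ∑ τ : Fin n → O × A, g.prob (List.ofFn τ) * (π s).prob (List.ofFn τ) *
      (c * opNorm U (opSub (M t) Mg) n (g.testProb (List.ofFn τ))) ^ 2 = sumHist n (fun τ =>
      g.prob τ * (π s).prob τ * (c * opNorm U (opSub (M t) Mg) n (g.testProb τ)) ^ 2) :=
    fun t s => sum_ofFn_eq_sumHist n
      (fun τ => g.prob τ * (π s).prob τ * (c * opNorm U (opSub (M t) Mg) n (g.testProb τ)) ^ 2)
  simp only [e1, e2] at key
  refine key.trans (Real.sqrt_le_sqrt ?_)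
  refine mul_le_mul_of_nonneg_left ?_ (add_nonneg (Nat.cast_nonneg _)
    (Finset.sum_nonneg fun t _ => Finset.sum_nonneg fun s _ => sumHist_nonneg fun τ _ =>
      mul_nonneg (mul_nonneg (g.prob_nonneg _) (Policy.prob_nonneg _ _)) (sq_nonneg _)))
  rw [Fintype.card_fin]
  have hd : (psrRankAt g H n : ℝ) ≤ psrRank g H := by
    exact_mod_cast Finset.le_sup (f := psrRankAt g H) (Finset.mem_Icc.mpr ⟨hn1, by omega⟩)
  set y : ℝ := 4 * (psrRank g H : ℝ) * (Fintype.card A : ℝ) ^ 2 *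
    (maxCoreActions H U : ℝ) ^ 2 * (deltaPSR g H U) ^ 2 * (T : ℝ) / α ^ 4 with hy
  have hy0 : 0 ≤ y := by positivity
  have harg : (T : ℝ) * (psrRankAt g H n * a' ^ 2 * b ^ 2) ≤ 9 * y := by
    have h1 : (a * b) ^ 2 ≤ (3 * deltaPSR g H U) ^ 2 := pow_le_pow_left₀ (by positivity) hab 2
    calc (T : ℝ) * (psrRankAt g H n * a' ^ 2 * b ^ 2)
        = psrRankAt g H n * (4 * (Fintype.card A : ℝ) ^ 2 * (maxCoreActions H U : ℝ) ^ 2 * T / α ^ 4 *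
            (a * b) ^ 2) := by rw [ha']; field_simp; ring
      _ ≤ psrRank g H * (4 * (Fintype.card A : ℝ) ^ 2 * (maxCoreActions H U : ℝ) ^ 2 * T / α ^ 4 *
            (3 * deltaPSR g H U) ^ 2) := by gcongr
      _ = 9 * y := by rw [hy]; ring
  have hlog : Real.log (1 + T * (psrRankAt g H n * a' ^ 2 * b ^ 2)) ≤ 9 * Real.log (1 + y) := by
    have h2 : 1 + 9 * y ≤ (1 + y) ^ 9 := by
      have := one_add_mul_le_pow (show (-2 : ℝ) ≤ y by linarith) 9
      exact_mod_cast this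
    rw [show (9 : ℝ) * Real.log (1 + y) = Real.log ((1 + y) ^ 9) by rw [Real.log_pow]; norm_num]
    exact Real.log_le_log (by positivity) (le_trans (by linarith) h2)
  have hl0 : 0 ≤ Real.log (1 + y) := Real.log_nonneg (by linarith)
  have hiota : iota g H U α T = 2 * Real.log (1 + y) := rfl
  rw [hiota]
  calc 2 * (psrRankAt g H n * Real.log (1 + T * (psrRankAt g H n * a' ^ 2 * b ^ 2)))
      ≤ 2 * (psrRank g H * (9 * Real.log (1 + y))) :=
        mul_le_mul_of_nonneg_left (mul_le_mul hd hlog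
          (Real.log_nonneg (le_add_of_nonneg_right (by positivity))) (Nat.cast_nonneg _)) zero_le_two
    _ = _ := by ring

/-- The sum of the value differences along any sequence of models of the class. -/
theorem RegularOps.sum_min_one_prob_sub_le {M : ℕ → Operators O A} {F : ℕ → Model O A}
    (hf : ∀ t, RegularOps (F t) H U α (M t)) (hg : RegularOps g H U α Mg)
    (hc : IsCoreTestSets g H U) (hα : 0 < α) (hH : 1 ≤ H) (π : ℕ → Policy O A)
    (cont : ℕ → ℕ → List A → Policy O A) (T : ℕ) :
    ∑ t ∈ Finset.range T,
        min 1 (sumHist H (fun τ => (π t).prob τ * |(F t).prob τ - g.prob τ|)) ≤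
      Real.sqrt (17280 * gecRate g H U α T * ∑ h ∈ Finset.range H, ∑ t ∈ Finset.range T,
        ∑ s ∈ Finset.range t, expDist (F t) g U H (π s) (cont s) h) +
      Real.sqrt (17280 * gecRate g H U α T * H * T) := by
  set B := 320 * momentFactor O H U α with hB
  set d : ℝ := (psrRank g H : ℝ) with hd
  set ι := iota g H U α T with hι
  set D : ℕ → ℝ := fun k => ∑ t ∈ Finset.range T, ∑ s ∈ Finset.range t,
    expDist (F t) g U H (π s) (cont s) k with hD
  have hD0 : ∀ k, 0 ≤ D k := fun k => Finset.sum_nonneg fun _ _ => Finset.sum_nonneg fun _ _ =>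
    expDist_nonneg _ _ _
  have hDH : D H = 0 := by simp [hD, expDist]
  have hA : (1 : ℝ) ≤ Fintype.card A := by exact_mod_cast Fintype.card_pos
  have hαU := hg.alpha_le_maxCoreActions hc hα hH
  have hmf1 : 1 ≤ momentFactor O H U α := by
    rw [momentFactor, mul_div_assoc, ← div_pow]
    exact one_le_mul_of_one_le_of_one_le (one_le_pow₀ hA)
      (one_le_pow₀ ((one_le_div hα).mpr hαU))
  have hB0 : 0 ≤ B := by rw [hB]; linarith
  have hd1 : 1 ≤ d := by rw [hd]; exact_mod_cast one_le_psrRank hc hH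
  have hι0 : 0 ≤ ι := iota_nonneg T
  have hH1 : (1 : ℝ) ≤ H := by exact_mod_cast hH
  have hlog : 2 * Real.log (1 + T) ≤ 9 * d * ι := by
    refine (hg.two_mul_log_le_iota hc hα hH T).trans ?_
    nlinarith
  set init : ℕ → ℝ := fun t => testDist (F t) g U 0 [] / α with hinit
  set e : ℕ → ℕ → ℝ := fun n t => sumHist n (fun τ => g.prob τ * (π t).prob τ *
    (errFactor H α n * opNorm U (opSub (M t) Mg) n (g.testProb τ))) with he
  have hec : 0 ≤ errFactor H α := fun n => by
    simp only [errFactor, Pi.zero_apply]; split_ifs <;> positivity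
  have he0 : ∀ n t, 0 ≤ e n t := fun n t => sumHist_nonneg fun τ _ =>
    mul_nonneg (mul_nonneg (g.prob_nonneg _) (Policy.prob_nonneg _ _))
      (mul_nonneg (hec n) (opNorm_nonneg _ _))
  have hinit0 : ∀ t, 0 ≤ init t := fun t => div_nonneg (testDist_nonneg _ _ _ _ _) hα.le
  have hsplit : ∀ (G : ℕ → ℕ → ℝ) (G' : ℕ → ℕ → ℝ),
      ∑ t ∈ Finset.range T, ∑ s ∈ Finset.range t, B * (G t s + G' t s) =
      B * (∑ t ∈ Finset.range T, ∑ s ∈ Finset.range t, G t s +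
        ∑ t ∈ Finset.range T, ∑ s ∈ Finset.range t, G' t s) := by
    intro G G'
    simp only [← Finset.mul_sum, Finset.sum_add_distrib]
  have hEn : ∀ n < H, ∑ t ∈ Finset.range T, min 1 (e n t) ≤
      Real.sqrt ((T + B * (D n + D (n + 1))) * (9 * d * ι)) := by
    intro n hn
    have hmom : ∀ t s, sumHist n (fun τ => g.prob τ * (π s).prob τ *
        (errFactor H α n * opNorm U (opSub (M t) Mg) n (g.testProb τ)) ^ 2) ≤
        B * (expDist (F t) g U H (π s) (cont s) n + expDist (F t) g U H (π s) (cont s) (n + 1)) :=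
      fun t s => (hf t).sumHist_sq_opNorm_le hg hc hα (π s) (cont s) hn
    rcases Nat.eq_zero_or_pos n with rfl | hn1
    · refine (sum_min_one_le_sqrt_of_sq_le (he0 0) (D := fun t s =>
        B * (expDist (F t) g U H (π s) (cont s) 0 + expDist (F t) g U H (π s) (cont s) (0 + 1)))
        (fun t s => ?_) T).trans (Real.sqrt_le_sqrt ?_)
      · refine le_trans (le_of_eq ?_) (hmom t s)
        have h1 : ∀ π : Policy O A, g.prob [] * π.prob [] = 1 := fun π => by
          simp [Model.prob, Policy.prob, Model.segProb, Policy.segProb]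
        simp only [he, sumHist, h1, one_mul]
      · rw [hsplit]
        exact mul_le_mul_of_nonneg_left hlog
          (add_nonneg (Nat.cast_nonneg _) (mul_nonneg hB0 (add_nonneg (hD0 _) (hD0 _))))
    · refine (RegularOps.sum_min_one_error_le hf hg hc hα π hn1 hn T).trans
        (Real.sqrt_le_sqrt ?_)
      refine mul_le_mul_of_nonneg_right ?_ (by positivity)
      rw [hD, ← hsplit]
      exact add_le_add_right (Finset.sum_le_sum fun t _ => Finset.sum_le_sum fun s _ => hmom t s) _
  have hEi : ∑ t ∈ Finset.range T, min 1 (init t) ≤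
      Real.sqrt ((T + B * (D 0 + 0)) * (9 * d * ι)) := by
    refine (sum_min_one_le_sqrt_of_sq_le hinit0 (D := fun t s =>
      B * expDist (F t) g U H (π s) (cont s) 0)
      (fun t s => hg.sq_testDist_nil_le hc hα hH (π s) (cont s)) T).trans
      (Real.sqrt_le_sqrt ?_)
    simp only [← Finset.mul_sum, add_zero]
    exact mul_le_mul_of_nonneg_left hlog
      (add_nonneg (Nat.cast_nonneg _) (mul_nonneg hB0 (hD0 _)))
  have hmin : ∀ x y : ℝ, 0 ≤ x → 0 ≤ y → min 1 (x + y) ≤ min 1 x + min 1 y := by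
    intro x y hx hy
    rcases le_total x 1 with h | h <;> rcases le_total y 1 with h' | h' <;>
      rcases le_total (x + y) 1 with h'' | h'' <;> simp [*] <;> linarith
  have hminsum : ∀ t k, min 1 (∑ n ∈ Finset.range k, e n t) ≤ ∑ n ∈ Finset.range k, min 1 (e n t) := by
    intro t k
    induction k with
    | zero => simp
    | succ k ih =>
      rw [Finset.sum_range_succ, Finset.sum_range_succ]
      exact (hmin _ _ (Finset.sum_nonneg fun n _ => he0 n t) (he0 k t)).trans
        (add_le_add_left ih _)
  have hstep : ∑ t ∈ Finset.range T,
      min 1 (sumHist H (fun τ => (π t).prob τ * |(F t).prob τ - g.prob τ|)) ≤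
      ∑ n ∈ Finset.range H, ∑ t ∈ Finset.range T, min 1 (e n t) +
        ∑ t ∈ Finset.range T, min 1 (init t) := by
    rw [Finset.sum_comm, ← Finset.sum_add_distrib]
    refine Finset.sum_le_sum fun t _ => ?_
    have h1 := (hf t).sumHist_abs_prob_sub_le hg hc.1 hH hα (π t)
    refine (min_le_min_left 1 h1).trans ((hmin _ _ (hinit0 t)
      (Finset.sum_nonneg fun n _ => he0 n t)).trans ?_)
    rw [add_comm]
    exact add_le_add_left (hminsum t H) _
  set Y : ℕ → ℝ := fun n => (T + B * (if n < H then D n + D (n + 1) else D 0 + 0)) *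
    (9 * d * ι) with hY
  have hY0 : ∀ n, 0 ≤ Y n := fun n => by
    have : 0 ≤ (if n < H then D n + D (n + 1) else D 0 + 0) := by
      split_ifs
      · exact add_nonneg (hD0 _) (hD0 _)
      · exact add_nonneg (hD0 _) le_rfl
    exact mul_nonneg (add_nonneg (Nat.cast_nonneg _) (mul_nonneg hB0 this)) (by positivity)
  have hsq : ∑ n ∈ Finset.range H, ∑ t ∈ Finset.range T, min 1 (e n t) +
        ∑ t ∈ Finset.range T, min 1 (init t) ≤ ∑ n ∈ Finset.range (H + 1), Real.sqrt (Y n) := by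
    rw [Finset.sum_range_succ]
    refine add_le_add (Finset.sum_le_sum fun n hn => ?_) ?_
    · simpa only [hY, if_pos (Finset.mem_range.mp hn)] using hEn n (Finset.mem_range.mp hn)
    · simpa only [hY, if_neg (lt_irrefl H)] using hEi
  set Δ := ∑ h ∈ Finset.range H, D h with hΔ
  have hΔ0 : 0 ≤ Δ := Finset.sum_nonneg fun h _ => hD0 h
  have hsumY : ∑ n ∈ Finset.range (H + 1), Y n ≤ (2 * H * T + 3 * B * Δ) * (9 * d * ι) := by
    rw [hY, ← Finset.sum_mul]
    refine mul_le_mul_of_nonneg_right ?_ (by positivity)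
    have hif : ∑ n ∈ Finset.range (H + 1), (if n < H then D n + D (n + 1) else D 0 + 0) =
        Δ + ∑ n ∈ Finset.range H, D (n + 1) + (D 0 + 0) := by
      rw [Finset.sum_range_succ, if_neg (lt_irrefl H), Finset.sum_congr rfl
        (fun n hn => if_pos (Finset.mem_range.mp hn)), Finset.sum_add_distrib]
    rw [Finset.sum_add_distrib, ← Finset.mul_sum, hif]
    have h1 : ∑ n ∈ Finset.range H, D (n + 1) ≤ Δ := by
      have h2 := Finset.sum_range_succ' D H
      rw [Finset.sum_range_succ, hDH, add_zero] at h2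
      linarith [hD0 0]
    have h2 : D 0 ≤ Δ := Finset.single_le_sum (fun h _ => hD0 h) (Finset.mem_range.mpr hH)
    simp only [Finset.sum_const, Finset.card_range, nsmul_eq_mul, Nat.cast_add, Nat.cast_one]
    have h3 : B * (Δ + ∑ n ∈ Finset.range H, D (n + 1) + (D 0 + 0)) ≤ B * (3 * Δ) :=
      mul_le_mul_of_nonneg_left (by linarith) hB0
    have h4 : ((H : ℝ) + 1) * T ≤ 2 * H * T := by
      have : (0 : ℝ) ≤ T := Nat.cast_nonneg _
      nlinarith
    linarith
  have hrate : gecRate g H U α T = d * H * ι * momentFactor O H U α := by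
    rw [gecRate, momentFactor]; ring
  refine hstep.trans (hsq.trans ?_)
  have hcs : ∑ n ∈ Finset.range (H + 1), Real.sqrt (Y n) ≤
      Real.sqrt ((H + 1) * ∑ n ∈ Finset.range (H + 1), Y n) := by
    refine Real.le_sqrt_of_sq_le (sq_sum_le_card_mul_sum_sq.trans (le_of_eq ?_))
    simp only [Finset.card_range, Real.sq_sqrt (hY0 _), Nat.cast_add, Nat.cast_one]
  refine hcs.trans ?_
  have hfin : ((H : ℝ) + 1) * ∑ n ∈ Finset.range (H + 1), Y n ≤
      17280 * gecRate g H U α T * Δ + 17280 * gecRate g H U α T * H * T := by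
    have h1 : ((H : ℝ) + 1) * ∑ n ∈ Finset.range (H + 1), Y n ≤
        (2 * H) * ((2 * H * T + 3 * B * Δ) * (9 * d * ι)) :=
      mul_le_mul (by linarith) hsumY (Finset.sum_nonneg fun n _ => hY0 n) (by positivity)
    refine h1.trans ?_
    rw [hrate, hB]
    have h5 : 36 * (d * H * ι * H * T) ≤ 17280 * (d * H * ι * momentFactor O H U α) * H * T := by
      have h6 : 0 ≤ d * H * ι * H * T := by positivity
      nlinarith [mul_le_mul_of_nonneg_left hmf1 h6]
    nlinarith
  refine (Real.sqrt_le_sqrt hfin).trans (Real.sqrt_le_iff.mpr ⟨by positivity, ?_⟩)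
  have hr0 : 0 ≤ gecRate g H U α T := by
    rw [hrate]; exact mul_nonneg (by positivity) (by linarith)
  have p1 : 0 ≤ 17280 * gecRate g H U α T * Δ := by positivity
  have p2 : 0 ≤ 17280 * gecRate g H U α T * H * T := by positivity
  rw [add_sq, Real.sq_sqrt p1, Real.sq_sqrt p2]
  have := mul_nonneg (Real.sqrt_nonneg (17280 * gecRate g H U α T * Δ))
    (Real.sqrt_nonneg (17280 * gecRate g H U α T * H * T))
  linarith

end Bound

section Coefficient

variable {O A : Type*} [Fintype O] [Fintype A] {H : ℕ} {R : Fin H → O → A → ℝ}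

lemma reward_nonneg (hR : ∀ i o a, 0 ≤ R i o a) (τ : Traj O A H) :
    0 ≤ ∑ i, R i (τ i).1 (τ i).2 := Finset.sum_nonneg fun _ _ => hR _ _ _

lemma Model.trajProb_nonneg (f : Model O A) (π : Policy O A) (τ : Traj O A H) :
    0 ≤ f.trajProb π τ := mul_nonneg (f.prob_nonneg _) (π.prob_nonneg _)

lemma Model.sum_trajProb (f : Model O A) (π : Policy O A) :
    ∑ τ : Traj O A H, f.trajProb π τ = 1 :=
  (sum_ofFn_eq_sumHist H (fun τ => f.prob τ * π.prob τ)).trans (sumHist_segProb_mul f π H [])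

lemma Model.value_nonneg (hR : ∀ i o a, 0 ≤ R i o a) (f : Model O A) (π : Policy O A) :
    0 ≤ f.value R π :=
  Finset.sum_nonneg fun τ _ => mul_nonneg (f.trajProb_nonneg π τ) (reward_nonneg hR τ)

lemma Model.value_le_one (hR1 : ∀ τ : Traj O A H, ∑ i, R i (τ i).1 (τ i).2 ≤ 1)
    (f : Model O A) (π : Policy O A) : f.value R π ≤ 1 := by
  rw [← f.sum_trajProb (H := H) π]
  exact Finset.sum_le_sum fun τ _ => mul_le_of_le_one_right (f.trajProb_nonneg π τ) (hR1 τ)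

lemma Model.value_sub_le (hR : ∀ i o a, 0 ≤ R i o a)
    (hR1 : ∀ τ : Traj O A H, ∑ i, R i (τ i).1 (τ i).2 ≤ 1) (f g : Model O A) (π : Policy O A) :
    f.value R π - g.value R π ≤
      min 1 (sumHist H (fun τ => π.prob τ * |f.prob τ - g.prob τ|)) := by
  refine le_min (by linarith [f.value_le_one hR1 π, g.value_nonneg hR π]) ?_
  rw [← sum_ofFn_eq_sumHist, Model.value, Model.value, ← Finset.sum_sub_distrib]
  refine Finset.sum_le_sum fun τ _ => ?_
  rw [← sub_mul, Model.trajProb, Model.trajProb, ← sub_mul, mul_comm (π.prob _)]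
  have h1 := mul_le_mul_of_nonneg_right (le_abs_self (f.prob (List.ofFn τ) - g.prob (List.ofFn τ)))
    (π.prob_nonneg (List.ofFn τ))
  refine (mul_le_mul_of_nonneg_right h1 (reward_nonneg hR τ)).trans ?_
  exact mul_le_of_le_one_right (mul_nonneg (abs_nonneg _) (π.prob_nonneg _)) (hR1 τ)

lemma Model.optValue_eq {f : Model O A} {π : Policy O A}
    (h : ∀ π', f.value R π' ≤ f.value R π) : f.optValue R = f.value R π :=
  haveI : Nonempty (Policy O A) := ⟨π⟩
  le_antisymm (ciSup_le h) (le_ciSup ⟨f.value R π, by rintro _ ⟨π', rfl⟩; exact h π'⟩ π)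

lemma sum_fin_Iio {T : ℕ} (F : ℕ → ℕ → ℝ) :
    ∑ t : Fin T, ∑ s ∈ Finset.Iio t, F t s = ∑ t ∈ Finset.range T, ∑ s ∈ Finset.range t, F t s := by
  rw [Finset.sum_range]
  refine Finset.sum_congr rfl fun t _ => ?_
  rw [← Nat.Iio_eq_range, ← Fin.map_valEmbedding_Iio, Finset.sum_map]
  rfl

variable [Nonempty A] {U : ℕ → Finset (Test O A)} {α : ℝ} {𝓗 : Set (Model O A)}

theorem gecRate_mem (hH : 1 ≤ H) (hR : ∀ i o a, 0 ≤ R i o a)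
    (hR1 : ∀ τ : Traj O A H, ∑ i, R i (τ i).1 (τ i).2 ≤ 1) (hα : 0 < α)
    (h𝓗 : ∀ f ∈ 𝓗, IsGeneralizedRegular f H U α) (fstar : 𝓗) (optPol : 𝓗 → Policy O A)
    (hopt : ∀ (f : 𝓗) (π : Policy O A), f.1.value R π ≤ f.1.value R (optPol f))
    (cont : 𝓗 → ℕ → List A → Policy O A) (T : ℕ) (f : Fin T → 𝓗) :
    ∑ t, ((f t).1.optValue R - fstar.1.value R (optPol (f t))) ≤
      Real.sqrt (17280 * gecRate fstar.1 H U α T * ∑ h : Fin H, ∑ t, ∑ s ∈ Finset.Iio t,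
        hellingerSq
          (fun τ : Traj O A H => exploreTrajProb (f t).1 U (optPol (f s)) (cont (f s) h) h τ)
          (fun τ : Traj O A H => exploreTrajProb fstar.1 U (optPol (f s)) (cont (f s) h) h τ))
      + Real.sqrt (17280 * gecRate fstar.1 H U α T * H * T) := by
  set F : ℕ → 𝓗 := fun t => if h : t < T then f ⟨t, h⟩ else fstar with hF
  have hFt : ∀ t : Fin T, F t = f t := fun t => by simp [hF]
  choose M hM using fun t => (h𝓗 (F t).1 (F t).2).exists_regularOps
  obtain ⟨Mg, hMg⟩ := (h𝓗 fstar.1 fstar.2).exists_regularOps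
  have key := RegularOps.sum_min_one_prob_sub_le (F := fun t => (F t).1) hM hMg (h𝓗 _ fstar.2).1
    hα hH (fun t => optPol (F t)) (fun t => cont (F t)) T
  refine le_trans ?_ (key.trans (le_of_eq ?_))
  · rw [Finset.sum_range]
    refine Finset.sum_le_sum fun t _ => ?_
    simp only [hFt]
    rw [Model.optValue_eq (hopt (f t))]
    exact Model.value_sub_le hR hR1 _ _ _
  · congr 3
    rw [Finset.sum_range]
    refine Finset.sum_congr rfl fun h _ => ?_
    rw [← sum_fin_Iio]
    refine Finset.sum_congr rfl fun t _ => Finset.sum_congr rfl fun s _ => ?_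
    simp only [hFt, expDist, if_pos h.2]

end Coefficient

/-! ### Bounded measurable functions -/

/-- Bounded measurable real functions. -/
structure BddMeas {X : Type*} [MeasurableSpace X] (f : X → ℝ) : Prop where
  meas : Measurable f
  bdd : ∃ C, ∀ x, |f x| ≤ C

namespace BddMeas

variable {X Y : Type*} [MeasurableSpace X] [MeasurableSpace Y] {f g : X → ℝ}

lemma mk' (hf : Measurable f) {C : ℝ} (h : ∀ x, |f x| ≤ C) : BddMeas f := ⟨hf, C, h⟩

lemma const (c : ℝ) : BddMeas (fun _ : X => c) := mk' measurable_const (fun _ => le_refl |c|)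

lemma add (hf : BddMeas f) (hg : BddMeas g) : BddMeas (fun x => f x + g x) := by
  obtain ⟨C, hC⟩ := hf.bdd
  obtain ⟨D, hD⟩ := hg.bdd
  exact mk' (hf.meas.add hg.meas) fun x => (abs_add_le _ _).trans (add_le_add (hC x) (hD x))

lemma sub (hf : BddMeas f) (hg : BddMeas g) : BddMeas (fun x => f x - g x) := by
  obtain ⟨C, hC⟩ := hf.bdd
  obtain ⟨D, hD⟩ := hg.bdd
  exact mk' (hf.meas.sub hg.meas) fun x => (abs_sub _ _).trans (add_le_add (hC x) (hD x))

lemma mul (hf : BddMeas f) (hg : BddMeas g) : BddMeas (fun x => f x * g x) := by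
  obtain ⟨C, hC⟩ := hf.bdd
  obtain ⟨D, hD⟩ := hg.bdd
  refine mk' (hf.meas.mul hg.meas) (C := C * D) fun x => ?_
  rw [abs_mul]
  exact mul_le_mul (hC x) (hD x) (abs_nonneg _) ((abs_nonneg _).trans (hC x))

lemma const_mul (c : ℝ) (hf : BddMeas f) : BddMeas (fun x => c * f x) := (const c).mul hf

lemma sum {ι : Type*} (s : Finset ι) {F : ι → X → ℝ} (h : ∀ i ∈ s, BddMeas (F i)) :
    BddMeas (fun x => ∑ i ∈ s, F i x) := by
  classical
  induction s using Finset.induction_on with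
  | empty => simpa using const 0
  | insert a s ha ih =>
    simp only [Finset.sum_insert ha]
    exact (h a (by simp)).add (ih fun i hi => h i (by simp [hi]))

lemma prod {ι : Type*} (s : Finset ι) {F : ι → X → ℝ} (h : ∀ i ∈ s, BddMeas (F i)) :
    BddMeas (fun x => ∏ i ∈ s, F i x) := by
  classical
  induction s using Finset.induction_on with
  | empty => simpa using const 1
  | insert a s ha ih =>
    simp only [Finset.prod_insert ha]
    exact (h a (by simp)).mul (ih fun i hi => h i (by simp [hi]))

lemma exp (hf : BddMeas f) : BddMeas (fun x => Real.exp (f x)) := by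
  obtain ⟨C, hC⟩ := hf.bdd
  refine mk' (hf.meas.exp) (C := Real.exp C) fun x => ?_
  rw [abs_of_pos (Real.exp_pos _)]
  exact Real.exp_le_exp.mpr ((le_abs_self _).trans (hC x))

lemma comp (hf : BddMeas f) {φ : Y → X} (hφ : Measurable φ) : BddMeas (fun y => f (φ y)) := by
  obtain ⟨C, hC⟩ := hf.bdd
  exact mk' (hf.meas.comp hφ) fun y => hC _

lemma of_discrete [Finite X] [DiscreteMeasurableSpace X] (f : X → ℝ) : BddMeas f := by
  obtain ⟨C, hC⟩ := (Set.finite_range fun x => |f x|).bddAbove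
  exact mk' Measurable.of_discrete fun x => hC ⟨x, rfl⟩

/-- A function of a pair that is bounded measurable in the first variable, for a finite discrete
second variable. -/
lemma uncurry_discrete {Z : Type*} [Fintype Z] [MeasurableSpace Z] [DiscreteMeasurableSpace Z]
    {F : X → Z → ℝ} (h : ∀ z, BddMeas (fun x => F x z)) : BddMeas (fun p : X × Z => F p.1 p.2) := by
  classical
  have e : (fun p : X × Z => F p.1 p.2) =
      fun p : X × Z => ∑ z, (if p.2 = z then 1 else 0) * F p.1 z := by
    funext p; simp
  rw [e]
  refine sum _ fun z _ => BddMeas.mul ?_ ((h z).comp measurable_fst)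
  exact (of_discrete (fun z' : Z => if z' = z then (1 : ℝ) else 0)).comp measurable_snd

lemma integrable (hf : BddMeas f) (μ : Measure X) [IsFiniteMeasure μ] : Integrable f μ := by
  obtain ⟨C, hC⟩ := hf.bdd
  exact Integrable.of_bound hf.meas.aestronglyMeasurable C (Filter.Eventually.of_forall hC)

lemma integral_right {f : X × Y → ℝ} (hf : BddMeas f) (ν : Measure Y) [IsProbabilityMeasure ν] :
    BddMeas (fun x => ∫ y, f (x, y) ∂ν) := by
  obtain ⟨C, hC⟩ := hf.bdd
  refine mk' (C := C) ?_ fun x => ?_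
  · exact (StronglyMeasurable.integral_prod_right (f := fun x y => f (x, y))
      hf.meas.stronglyMeasurable).measurable
  · have := norm_integral_le_of_norm_le_const (μ := ν) (f := fun y => f (x, y)) (C := C)
      (Filter.Eventually.of_forall fun y => hC _)
    simpa using this

end BddMeas

/-! ### Interaction with the environment -/

section Path

variable {F D : Type*} [MeasurableSpace F] [Fintype D] [MeasurableSpace D]
  [DiscreteMeasurableSpace D]

/-- Draw `f` from `P` and then data from `k f`. -/
noncomputable def stepLaw (k : F → D → ℝ) (P : Measure F) : Measure (F × D) :=
  P.bind (fun f => ∑ d : D, ENNReal.ofReal (k f d) • Measure.dirac (f, d))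

/-- The law of the first `n` rounds, when `f` is drawn from `P S` given the earlier data `S`. -/
noncomputable def pathLaw (k : F → D → ℝ) (P : ∀ n, (Fin n → D) → Measure F) :
    (n : ℕ) → Measure (Fin n → F × D)
  | 0 => Measure.dirac Fin.elim0
  | n + 1 => (pathLaw k P n).bind (fun ρ =>
      (stepLaw k (P n fun i => (ρ i).2)).map (fun r => (Fin.snoc ρ r : Fin (n + 1) → F × D)))

lemma stepLaw_eq {k : F → D → ℝ} (hk : ∀ d, Measurable fun f => k f d) (P : Measure F) :
    stepLaw k P = ∑ d, (P.withDensity fun f => ENNReal.ofReal (k f d)).map (fun f => (f, d)) := by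
  classical
  have hm : ∀ d : D, Measurable fun f : F => (f, d) := fun d => measurable_prodMk_right
  have hker : Measurable (fun f : F => ∑ d : D, ENNReal.ofReal (k f d) •
      (Measure.dirac (f, d) : Measure (F × D))) := by
    refine Measure.measurable_of_measurable_coe _ fun s hs => ?_
    simp only [Measure.coe_finsetSum, Finset.sum_apply, Measure.smul_apply, smul_eq_mul,
      Measure.dirac_apply' _ hs]
    exact Finset.measurable_fun_sum _ fun d _ => (hk d).ennreal_ofReal.mul
      ((measurable_one.indicator hs).comp (hm d))
  ext s hs
  rw [stepLaw, Measure.bind_apply hs hker.aemeasurable]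
  simp only [Measure.coe_finsetSum, Finset.sum_apply, Measure.smul_apply, smul_eq_mul,
    Measure.dirac_apply' _ hs]
  have hms : ∀ d, Measurable fun f : F =>
      ENNReal.ofReal (k f d) * s.indicator (1 : F × D → ENNReal) (f, d) := fun d =>
    (hk d).ennreal_ofReal.mul ((measurable_one.indicator hs).comp (hm d))
  rw [lintegral_finsetSum _ fun d _ => hms d]
  refine Finset.sum_congr rfl fun d _ => ?_
  rw [Measure.map_apply (hm d) hs, withDensity_apply _ (hm d hs), ← lintegral_indicator (hm d hs)]
  refine lintegral_congr fun f => ?_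
  by_cases h : (f, d) ∈ s <;> simp [h]

variable {k : F → D → ℝ} (hk : ∀ d, Measurable fun f => k f d) (hk0 : ∀ f d, 0 ≤ k f d)
  (hk1 : ∀ f, ∑ d, k f d = 1)

include hk hk0 hk1

lemma stepLaw_univ (P : Measure F) : stepLaw k P Set.univ = P Set.univ := by
  rw [stepLaw_eq hk, Measure.coe_finsetSum, Finset.sum_apply]
  simp only [Measure.map_apply (measurable_prodMk_right (α := F)) MeasurableSet.univ,
    Set.preimage_univ, withDensity_apply _ MeasurableSet.univ, Measure.restrict_univ]
  rw [← lintegral_finsetSum _ fun d _ => (hk d).ennreal_ofReal]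
  have : ∀ f, ∑ d, ENNReal.ofReal (k f d) = 1 := fun f => by
    rw [← ENNReal.ofReal_sum_of_nonneg fun d _ => hk0 f d, hk1, ENNReal.ofReal_one]
  simp [this]

lemma integral_stepLaw (P : Measure F) [IsFiniteMeasure P] {G : F × D → ℝ} (hG : BddMeas G) :
    ∫ r, G r ∂(stepLaw k P) = ∫ f, ∑ d, k f d * G (f, d) ∂P := by
  have hm : ∀ d : D, Measurable fun f : F => (f, d) := fun d => measurable_prodMk_right
  have hfin : IsFiniteMeasure (stepLaw k P) := ⟨by
    rw [stepLaw_univ hk hk0 hk1]; exact measure_lt_top _ _⟩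
  have hle : ∀ d, (P.withDensity fun f => ENNReal.ofReal (k f d)).map (fun f => (f, d)) ≤
      stepLaw k P := fun d => by
    rw [stepLaw_eq hk]
    exact Finset.single_le_sum (f := fun d =>
      (P.withDensity fun f => ENNReal.ofReal (k f d)).map (fun f => (f, d)))
      (fun _ _ => bot_le) (Finset.mem_univ d)
  have hint := hG.integrable (stepLaw k P)
  have hkb : ∀ d, BddMeas (fun f => k f d) := fun d => BddMeas.mk' (hk d) (C := 1) fun f => by
    rw [abs_of_nonneg (hk0 f d), ← hk1 f]
    exact Finset.single_le_sum (fun d _ => hk0 f d) (Finset.mem_univ d)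
  rw [stepLaw_eq hk, integral_finsetSum_measure fun d _ => hint.mono_measure (hle d),
    integral_finsetSum _ fun d _ => ((hkb d).mul (hG.comp (hm d))).integrable P]
  refine Finset.sum_congr rfl fun d _ => ?_
  rw [integral_map (hm d).aemeasurable hG.meas.aestronglyMeasurable,
    integral_withDensity_eq_integral_toReal_smul (hk d).ennreal_ofReal
      (Filter.Eventually.of_forall fun _ => ENNReal.ofReal_lt_top)]
  exact integral_congr_ae (Filter.Eventually.of_forall fun f => by
    simp [ENNReal.toReal_ofReal (hk0 f d)])

omit [Fintype D] [MeasurableSpace D] [DiscreteMeasurableSpace D] [MeasurableSpace F] hk hk0 hk1 in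
open ProbabilityTheory in
lemma bind_map_eq_map_compProd {X Y Z : Type*} [MeasurableSpace X] [MeasurableSpace Y]
    [MeasurableSpace Z] (m : Measure X) [SFinite m] (κ : Kernel X Y) [IsFiniteKernel κ]
    {φ : X → Y → Z} (hφ : Measurable fun p : X × Y => φ p.1 p.2) :
    m.bind (fun x => (κ x).map (φ x)) = (m.compProd κ).map (fun p => φ p.1 p.2) := by
  have hsn : ∀ x, Measurable (φ x) := fun x => hφ.comp measurable_prodMk_left
  have hmeas : Measurable fun x => (κ x).map (φ x) := by
    refine Measure.measurable_of_measurable_coe _ fun s hs => ?_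
    simp only [Measure.map_apply (hsn _) hs]
    exact Kernel.measurable_kernel_prodMk_left (κ := κ) (hφ hs)
  ext s hs
  rw [Measure.map_apply hφ hs, Measure.compProd_apply (hφ hs),
    Measure.bind_apply hs hmeas.aemeasurable]
  refine lintegral_congr fun x => ?_
  rw [Measure.map_apply (hsn x) hs]
  rfl

omit [Fintype D] [DiscreteMeasurableSpace D] hk hk0 hk1 in
lemma measurable_snoc (n : ℕ) :
    Measurable fun p : (Fin n → F × D) × (F × D) => (Fin.snoc p.1 p.2 : Fin (n + 1) → F × D) := by
  refine measurable_pi_lambda _ fun i => ?_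
  induction i using Fin.lastCases with
  | last => simpa using measurable_snd
  | cast i =>
    simp only [Fin.snoc_castSucc]
    exact (measurable_pi_apply i).comp measurable_fst

variable {P : ∀ n, (Fin n → D) → Measure F} (hP : ∀ n S, IsProbabilityMeasure (P n S))

include hP

open ProbabilityTheory in
lemma pathLaw_succ_eq (n : ℕ) : ∃ κ : Kernel (Fin n → F × D) (F × D), IsMarkovKernel κ ∧
    (∀ ρ, κ ρ = stepLaw k (P n fun i => (ρ i).2)) ∧
    (IsFiniteMeasure (pathLaw k P n) → pathLaw k P (n + 1) =
      ((pathLaw k P n).compProd κ).map (fun p => Fin.snoc p.1 p.2)) := by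
  have hS : Measurable fun ρ : Fin n → F × D => fun i => (ρ i).2 :=
    measurable_pi_lambda _ fun i => measurable_snd.comp (measurable_pi_apply i)
  obtain ⟨κ, hκ⟩ : ∃ κ : Kernel (Fin n → F × D) (F × D),
      ∀ ρ, κ ρ = stepLaw k (P n fun i => (ρ i).2) :=
    ⟨⟨fun ρ => stepLaw k (P n fun i => (ρ i).2),
      (Measurable.of_discrete (f := fun S : Fin n → D => stepLaw k (P n S))).comp hS⟩,
      fun _ => rfl⟩
  have hfin : IsMarkovKernel κ := ⟨fun ρ => ⟨by
    have := hP n fun i => (ρ i).2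
    rw [hκ, stepLaw_univ hk hk0 hk1, measure_univ]⟩⟩
  refine ⟨κ, hfin, hκ, fun hfm => ?_⟩
  rw [← bind_map_eq_map_compProd (φ := fun ρ r => (Fin.snoc ρ r : Fin (n + 1) → F × D)) _ _
    (measurable_snoc n), pathLaw]
  simp only [hκ]

lemma isProbabilityMeasure_pathLaw (n : ℕ) : IsProbabilityMeasure (pathLaw k P n) := by
  induction n with
  | zero => unfold pathLaw; infer_instance
  | succ n ih =>
    obtain ⟨κ, hfin, -, h⟩ := pathLaw_succ_eq hk hk0 hk1 hP n
    rw [h inferInstance]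
    exact Measure.isProbabilityMeasure_map (measurable_snoc n).aemeasurable

/-- The tower formula: condition on the first `n` rounds. -/
lemma integral_pathLaw_succ (n : ℕ) {G : (Fin (n + 1) → F × D) → ℝ} (hG : BddMeas G) :
    Integrable (fun ρ => ∫ f, ∑ d, k f d * G (Fin.snoc ρ (f, d)) ∂(P n fun i => (ρ i).2))
      (pathLaw k P n) ∧
    ∫ ρ, G ρ ∂(pathLaw k P (n + 1)) = ∫ ρ, ∫ f, ∑ d, k f d * G (Fin.snoc ρ (f, d))
      ∂(P n fun i => (ρ i).2) ∂(pathLaw k P n) := by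
  have ih := isProbabilityMeasure_pathLaw hk hk0 hk1 hP n
  obtain ⟨κ, hfin, hκ, h⟩ := pathLaw_succ_eq hk hk0 hk1 hP n
  have hG' : BddMeas (fun p : (Fin n → F × D) × (F × D) => G (Fin.snoc p.1 p.2)) :=
    hG.comp (measurable_snoc n)
  have e : ∀ ρ, ∫ f, ∑ d, k f d * G (Fin.snoc ρ (f, d)) ∂(P n fun i => (ρ i).2) =
      ∫ r, G (Fin.snoc ρ r) ∂(κ ρ) := by
    intro ρ
    have := hP n fun i => (ρ i).2
    rw [hκ]
    exact (integral_stepLaw hk hk0 hk1 _ (hG'.comp measurable_prodMk_left)).symm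
  simp only [e]
  have hint := hG'.integrable ((pathLaw k P n).compProd κ)
  refine ⟨hint.integral_compProd, ?_⟩
  rw [h inferInstance, integral_map (measurable_snoc n).aemeasurable
    hG.meas.aestronglyMeasurable, Measure.integral_compProd hint]

end Path

section PathMoments

variable {F D : Type*} [MeasurableSpace F] [Fintype D] [MeasurableSpace D]
  [DiscreteMeasurableSpace D]
  {k : F → D → ℝ} (hk : ∀ d, Measurable fun f => k f d) (hk0 : ∀ f d, 0 ≤ k f d)
  (hk1 : ∀ f, ∑ d, k f d = 1)
  {P : ∀ n, (Fin n → D) → Measure F} (hP : ∀ n S, IsProbabilityMeasure (P n S))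

include hk hk0 hk1 hP

lemma integral_prod_pathLaw_le {Q : F × D → ℝ} (hQ : BddMeas Q) (hQ0 : ∀ r, 0 ≤ Q r)
    (h1 : ∀ f, ∑ d, k f d * Q (f, d) ≤ 1) (n : ℕ) :
    ∫ ρ, ∏ s, Q (ρ s) ∂(pathLaw k P n) ≤ 1 := by
  have hB : ∀ n, BddMeas fun ρ : Fin n → F × D => ∏ s, Q (ρ s) := fun n =>
    BddMeas.prod _ fun s _ => hQ.comp (measurable_pi_apply s)
  induction n with
  | zero =>
    have := isProbabilityMeasure_pathLaw hk hk0 hk1 hP 0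
    simp
  | succ n ih =>
    have := isProbabilityMeasure_pathLaw hk hk0 hk1 hP n
    obtain ⟨hi, he⟩ := integral_pathLaw_succ hk hk0 hk1 hP n (hB (n + 1))
    rw [he]
    refine (integral_mono hi ((hB n).integrable _) fun ρ => ?_).trans ih
    have := hP n fun i => (ρ i).2
    simp only [Fin.prod_univ_castSucc, Fin.snoc_castSucc, Fin.snoc_last]
    have hp : 0 ≤ ∏ s, Q (ρ s) := Finset.prod_nonneg fun s _ => hQ0 _
    have e : ∀ f, ∑ d, k f d * ((∏ s, Q (ρ s)) * Q (f, d)) =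
        (∏ s, Q (ρ s)) * ∑ d, k f d * Q (f, d) := fun f => by
      rw [Finset.mul_sum]; exact Finset.sum_congr rfl fun d _ => by ring
    simp only [e]
    rw [integral_const_mul]
    refine mul_le_of_le_one_right hp ?_
    refine (integral_mono_of_nonneg (Filter.Eventually.of_forall fun f =>
      Finset.sum_nonneg fun d _ => mul_nonneg (hk0 f d) (hQ0 _)) (integrable_const (1 : ℝ))
      (Filter.Eventually.of_forall h1)).trans ?_
    simp

lemma integral_predictable_le {Φ : ∀ n, (Fin n → F × D) → F → ℝ}
    (hΦ : ∀ n, BddMeas fun p : (Fin n → F × D) × F => Φ n p.1 p.2) {b : ℕ → ℝ}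
    (hb : ∀ n, ∫ ρ, ∫ f, Φ n ρ f ∂(P n fun i => (ρ i).2) ∂(pathLaw k P n) ≤ b n) (T : ℕ) :
    ∫ ρ, ∑ t : Fin T, Φ t (fun i => ρ (Fin.castLE t.2.le i)) (ρ t).1 ∂(pathLaw k P T) ≤
      ∑ n ∈ Finset.range T, b n := by
  have hB : ∀ T, BddMeas fun ρ : Fin T → F × D =>
      ∑ t : Fin T, Φ t (fun i => ρ (Fin.castLE t.2.le i)) (ρ t).1 := fun T =>
    BddMeas.sum _ fun t _ => (hΦ t).comp
      (φ := fun ρ : Fin T → F × D => (fun i => ρ (Fin.castLE t.2.le i), (ρ t).1))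
      ((measurable_pi_lambda _ fun i => measurable_pi_apply _).prodMk
        (measurable_fst.comp (measurable_pi_apply t)))
  induction T with
  | zero => simp
  | succ n ih =>
    have := isProbabilityMeasure_pathLaw hk hk0 hk1 hP n
    obtain ⟨hi, he⟩ := integral_pathLaw_succ hk hk0 hk1 hP n (hB (n + 1))
    rw [he, Finset.sum_range_succ]
    have e : ∀ ρ : Fin n → F × D, ∫ f, ∑ d, k f d * (∑ t : Fin (n + 1), Φ t
        (fun i => (Fin.snoc ρ (f, d) : Fin (n + 1) → F × D) (Fin.castLE t.2.le i))
          ((Fin.snoc ρ (f, d) : Fin (n + 1) → F × D) t).1) ∂(P n fun i => (ρ i).2) =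
        (∑ t : Fin n, Φ t (fun i => ρ (Fin.castLE t.2.le i)) (ρ t).1) +
          ∫ f, Φ n ρ f ∂(P n fun i => (ρ i).2) := by
      intro ρ
      have := hP n fun i => (ρ i).2
      have e1 : ∀ f, ∑ d, k f d * (∑ t : Fin (n + 1), Φ t
        (fun i => (Fin.snoc ρ (f, d) : Fin (n + 1) → F × D) (Fin.castLE t.2.le i))
          ((Fin.snoc ρ (f, d) : Fin (n + 1) → F × D) t).1) =
          (∑ t : Fin n, Φ t (fun i => ρ (Fin.castLE t.2.le i)) (ρ t).1) + Φ n ρ f := by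
        intro f
        have e2 : ∀ d, ∑ t : Fin (n + 1), Φ t
            (fun i => (Fin.snoc ρ (f, d) : Fin (n + 1) → F × D) (Fin.castLE t.2.le i))
              ((Fin.snoc ρ (f, d) : Fin (n + 1) → F × D) t).1 =
            (∑ t : Fin n, Φ t (fun i => ρ (Fin.castLE t.2.le i)) (ρ t).1) + Φ n ρ f := by
          intro d
          rw [Fin.sum_univ_castSucc]
          congr 1
          · refine Finset.sum_congr rfl fun t _ => ?_
            rw [Fin.snoc_castSucc]
            congr 1
            funext i
            exact Fin.snoc_castSucc (α := fun _ => F × D) (f, d) ρ (Fin.castLE t.2.le i)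
          · rw [Fin.snoc_last]
            change Φ n _ f = _
            congr 1
            funext i
            exact Fin.snoc_castSucc (α := fun _ => F × D) (f, d) ρ i
        simp only [e2]
        rw [← Finset.sum_mul, hk1, one_mul]
      simp only [e1]
      rw [integral_add (integrable_const _)
        (((hΦ n).comp measurable_prodMk_left).integrable _)]
      simp
    simp only [e] at hi ⊢
    have h2 : Integrable (fun ρ => ∫ f, Φ n ρ f ∂(P n fun i => (ρ i).2)) (pathLaw k P n) := by
      have := hi.sub ((hB n).integrable (pathLaw k P n))
      refine this.congr (Filter.Eventually.of_forall fun ρ => ?_)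
      simp
    rw [integral_add ((hB n).integrable _) h2]
    exact add_le_add ih (hb n)

lemma integral_sum_pathLaw_le {g : D → ℝ} {c : ℝ} (h1 : ∀ f, ∑ d, k f d * g d ≤ c) (n : ℕ) :
    ∫ ρ, ∑ s, g (ρ s).2 ∂(pathLaw k P n) ≤ n * c := by
  have hg : BddMeas fun r : F × D => g r.2 := (BddMeas.of_discrete g).comp measurable_snd
  have hB : ∀ n, BddMeas fun ρ : Fin n → F × D => ∑ s, g (ρ s).2 := fun n =>
    BddMeas.sum _ fun s _ => hg.comp (measurable_pi_apply s)
  have hkb : ∀ d, BddMeas (fun f => k f d) := fun d => BddMeas.mk' (hk d) (C := 1) fun f => by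
    rw [abs_of_nonneg (hk0 f d), ← hk1 f]
    exact Finset.single_le_sum (fun d _ => hk0 f d) (Finset.mem_univ d)
  induction n with
  | zero => simp
  | succ n ih =>
    have := isProbabilityMeasure_pathLaw hk hk0 hk1 hP n
    obtain ⟨hi, he⟩ := integral_pathLaw_succ hk hk0 hk1 hP n (hB (n + 1))
    rw [he]
    refine (integral_mono hi (((hB n).add (BddMeas.const c)).integrable _) fun ρ => ?_).trans ?_
    · have := hP n fun i => (ρ i).2
      simp only [Fin.sum_univ_castSucc, Fin.snoc_castSucc, Fin.snoc_last, mul_add,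
        Finset.sum_add_distrib, ← Finset.sum_mul, hk1, one_mul]
      rw [integral_add (integrable_const _)
        ((BddMeas.sum _ fun d _ => (hkb d).mul (BddMeas.const _)).integrable _)]
      have := integral_mono (μ := P n fun i => (ρ i).2) (g := fun _ => c)
        ((BddMeas.sum _ fun d _ => (hkb d).mul (BddMeas.const (g d))).integrable _)
        (integrable_const _) h1
      simpa using this
    · rw [integral_add ((hB n).integrable _) (integrable_const _)]
      simp only [integral_const, probReal_univ, one_smul]
      push_cast
      linarith

lemma ae_pathLaw {q : D → Prop} (hq : ∀ f d, k f d ≠ 0 → q d) (n : ℕ) :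
    ∀ᵐ ρ ∂(pathLaw k P n), ∀ i, q (ρ i).2 := by
  classical
  have := isProbabilityMeasure_pathLaw hk hk0 hk1 hP n
  have h := integral_sum_pathLaw_le hk hk0 hk1 hP (g := fun d => if q d then 0 else 1) (c := 0)
    (fun f => Finset.sum_nonpos fun d _ => by
      by_cases hd : q d
      · simp [hd]
      · simp [hd, not_not.mp (mt (hq f d) hd)]) n
  have hg : BddMeas fun ρ : Fin n → F × D => ∑ s, (if q (ρ s).2 then (0 : ℝ) else 1) :=
    BddMeas.sum _ fun s _ => (BddMeas.of_discrete fun d => if q d then (0 : ℝ) else 1).comp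
      (measurable_snd.comp (measurable_pi_apply s))
  have h0 : ∀ ρ : Fin n → F × D, 0 ≤ ∑ s, (if q (ρ s).2 then (0 : ℝ) else 1) := fun ρ =>
    Finset.sum_nonneg fun s _ => by split_ifs <;> norm_num
  have h' := (integral_eq_zero_iff_of_nonneg h0 (hg.integrable _)).mp
    (le_antisymm (by simpa using h) (integral_nonneg h0))
  filter_upwards [h'] with ρ hρ i
  by_contra hi
  have := (Finset.sum_eq_zero_iff_of_nonneg (fun s _ => by split_ifs <;> norm_num)).mp hρ i
    (Finset.mem_univ i)
  simp [hi] at this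

lemma pathLaw_congr {q : D → Prop} (hq : ∀ f d, k f d ≠ 0 → q d)
    {P' : ∀ n, (Fin n → D) → Measure F} (h : ∀ n S, (∀ i, q (S i)) → P' n S = P n S) (n : ℕ) :
    pathLaw k P' n = pathLaw k P n := by
  induction n with
  | zero => rfl
  | succ n ih =>
    rw [pathLaw, pathLaw, ih]
    refine Measure.bind_congr_right ?_
    filter_upwards [ae_pathLaw hk hk0 hk1 hP hq n] with ρ hρ
    rw [h n _ hρ]

end PathMoments

/-! ### Gibbs measures -/

section Gibbs

variable {F : Type*} [MeasurableSpace F] (p0 : Measure F) [IsProbabilityMeasure p0]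

/-- The probability measure with density proportional to `w`. -/
noncomputable def gibbs (w : F → ℝ) : Measure F :=
  (∫⁻ f, ENNReal.ofReal (w f) ∂p0)⁻¹ • p0.withDensity fun f => ENNReal.ofReal (w f)

variable {w : F → ℝ} (hw : BddMeas w) (hw0 : ∀ f, 0 ≤ w f)

include hw hw0

lemma lintegral_ofReal_eq : ∫⁻ f, ENNReal.ofReal (w f) ∂p0 = ENNReal.ofReal (∫ f, w f ∂p0) :=
  (ofReal_integral_eq_lintegral_ofReal (hw.integrable p0)
    (Filter.Eventually.of_forall hw0)).symm

lemma isProbabilityMeasure_gibbs (hZ : 0 < ∫ f, w f ∂p0) : IsProbabilityMeasure (gibbs p0 w) := by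
  refine ⟨?_⟩
  rw [gibbs, Measure.smul_apply, withDensity_apply _ MeasurableSet.univ, Measure.restrict_univ,
    smul_eq_mul, lintegral_ofReal_eq p0 hw hw0]
  exact ENNReal.inv_mul_cancel (by simpa using hZ) ENNReal.ofReal_ne_top

lemma integral_gibbs (g : F → ℝ) :
    ∫ f, g f ∂(gibbs p0 w) = (∫ f, w f ∂p0)⁻¹ * ∫ f, w f * g f ∂p0 := by
  rw [gibbs, integral_smul_measure, lintegral_ofReal_eq p0 hw hw0, ENNReal.toReal_inv,
    ENNReal.toReal_ofReal (integral_nonneg hw0), smul_eq_mul,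
    integral_withDensity_eq_integral_toReal_smul hw.meas.ennreal_ofReal
      (Filter.Eventually.of_forall fun _ => ENNReal.ofReal_lt_top)]
  congr 1
  exact integral_congr_ae (Filter.Eventually.of_forall fun f => by
    simp [ENNReal.toReal_ofReal (hw0 f)])

/-- A change of measure inequality for Gibbs measures. -/
lemma integral_gibbs_le (hZ : 0 < ∫ f, w f ∂p0) {X W : F → ℝ} (hX : BddMeas X) (hW : BddMeas W)
    (hW0 : ∀ f, 0 ≤ W f) {c : ℝ}
    (h : ∀ᵐ f ∂p0, 0 < w f → Real.exp (X f) * w f ≤ Real.exp c * W f) :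
    ∫ f, X f ∂(gibbs p0 w) ≤ -Real.log (∫ f, w f ∂p0) + c + ∫ f, W f ∂p0 - 1 := by
  rw [integral_gibbs p0 hw hw0]
  set Z := ∫ f, w f ∂p0 with hZd
  have key : ∀ᵐ f ∂p0, Z⁻¹ * (w f * X f) ≤ Z⁻¹ * (w f * (-Real.log Z + c - 1)) + W f := by
    filter_upwards [h] with f hf
    rcases (hw0 f).eq_or_lt with h0 | h0
    · simpa [← h0] using hW0 f
    have h1 := hf h0
    have hq : 0 < Z⁻¹ * w f := mul_pos (inv_pos.mpr hZ) h0
    have h2 : Real.exp (X f - c + Real.log Z) ≤ W f / (Z⁻¹ * w f) := by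
      rw [le_div_iff₀ hq, Real.exp_add, Real.exp_sub, Real.exp_log hZ]
      calc Real.exp (X f) / Real.exp c * Z * (Z⁻¹ * w f) = Real.exp (X f) * w f / Real.exp c := by
            field_simp
        _ ≤ W f := by rw [div_le_iff₀ (Real.exp_pos c)]; linarith
    have h3 := (Real.add_one_le_exp (X f - c + Real.log Z)).trans h2
    rw [le_div_iff₀ hq] at h3
    nlinarith
  have hi := integral_mono_ae (((hw.mul hX).const_mul Z⁻¹).integrable p0)
    ((((hw.mul (BddMeas.const (-Real.log Z + c - 1))).const_mul Z⁻¹).add hW).integrable p0) key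
  rw [integral_add (((hw.mul (BddMeas.const (-Real.log Z + c - 1))).const_mul Z⁻¹).integrable p0)
    (hW.integrable p0), integral_const_mul, integral_const_mul, integral_mul_const, ← hZd,
    ← mul_assoc Z⁻¹ Z, inv_mul_cancel₀ hZ.ne', one_mul] at hi
  linarith

/-- A lower bound for the normalization constant of a Gibbs measure. -/
lemma mul_exp_integral_le {ν : Measure F} [IsProbabilityMeasure ν] {b : ℝ} (hb : 0 < b)
    (hν : ENNReal.ofReal b • ν ≤ p0) {u : F → ℝ} (hu : BddMeas u)
    (h : ∀ᵐ f ∂ν, Real.exp (u f) ≤ w f) : b * Real.exp (∫ f, u f ∂ν) ≤ ∫ f, w f ∂p0 := by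
  have h1 : b * ∫ f, w f ∂ν ≤ ∫ f, w f ∂p0 := by
    have := integral_mono_measure hν (Filter.Eventually.of_forall hw0) (hw.integrable p0)
    rwa [integral_smul_measure, ENNReal.toReal_ofReal hb.le, smul_eq_mul] at this
  refine le_trans (mul_le_mul_of_nonneg_left ?_ hb.le) h1
  have h2 := integral_mono_ae (hu.exp.integrable ν) (hw.integrable ν) h
  refine le_trans ?_ h2
  have h3 : ∀ f, Real.exp (∫ f, u f ∂ν) * (u f - ∫ f, u f ∂ν + 1) ≤ Real.exp (u f) := fun f => by
    have := mul_le_mul_of_nonneg_left (Real.add_one_le_exp (u f - ∫ f, u f ∂ν))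
      (Real.exp_pos (∫ f, u f ∂ν)).le
    rwa [← Real.exp_add, add_sub_cancel] at this
  have h4 := integral_mono (((hu.sub (BddMeas.const (∫ f, u f ∂ν))).add
    (BddMeas.const 1)).const_mul (Real.exp (∫ f, u f ∂ν)) |>.integrable ν) (hu.exp.integrable ν) h3
  rw [integral_const_mul, integral_add ((hu.sub (BddMeas.const _)).integrable ν)
    (integrable_const _), integral_sub (hu.integrable ν) (integrable_const _)] at h4
  simpa using h4

end Gibbs

/-! ### Optimistic posterior sampling -/

section PosteriorSampling

variable {F D : Type*} [MeasurableSpace F] [Fintype D] [MeasurableSpace D]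
  [DiscreteMeasurableSpace D]

/-- The unnormalized density of the optimistic posterior. -/
noncomputable def optWeight (γ : ℝ) (v : F → ℝ) (l : F → D → ℝ) {n : ℕ} (S : Fin n → D) (f : F) :
    ℝ :=
  Real.exp (γ * v f) * ∏ s, l f (S s)

variable {k : F → D → ℝ} (hk : ∀ d, Measurable fun f => k f d) (hk0 : ∀ f d, 0 ≤ k f d)
  (hk1 : ∀ f, ∑ d, k f d = 1)
  (p0 : Measure F) [IsProbabilityMeasure p0] (ν : Measure F) [IsProbabilityMeasure ν]
  {b : ℝ} (hb : 0 < b) (hν : ENNReal.ofReal b • ν ≤ p0)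
  {v : F → ℝ} (hv : BddMeas v) {l : F → D → ℝ} (hl : ∀ d, Measurable fun f => l f d)
  (hl0 : ∀ f d, 0 ≤ l f d) (hl1 : ∀ f d, l f d ≤ 1)
  {ls : D → ℝ} (hls : ∀ d, 0 ≤ ls d) (hkl : ∀ f d, k f d ≠ 0 → 0 < ls d)
  {vs ε γ κ c0 : ℝ} (hγ : 0 ≤ γ) (hc0 : 0 < c0)
  (hε : ∀ᵐ f ∂ν, vs - v f ≤ ε) (hc : ∀ᵐ f ∂ν, ∀ d, 0 < ls d → c0 ≤ l f d)
  (hκ : ∀ f', ∀ᵐ f ∂ν, ∑ d, k f' d * Real.log (ls d / l f d) ≤ κ)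

include hl hl0 hl1 in
lemma bddMeas_lik (d : D) : BddMeas fun f => l f d :=
  BddMeas.mk' (hl d) (C := 1) fun f => by rw [abs_of_nonneg (hl0 f d)]; exact hl1 f d

include hv hl hl0 hl1 in
lemma bddMeas_optWeight {n : ℕ} (S : Fin n → D) : BddMeas (optWeight γ v l S) :=
  (hv.const_mul γ).exp.mul (BddMeas.prod _ fun _ _ => bddMeas_lik hl hl0 hl1 _)

include hl0 in
lemma optWeight_nonneg {n : ℕ} (S : Fin n → D) (f : F) : 0 ≤ optWeight γ v l S f :=
  mul_nonneg (Real.exp_pos _).le (Finset.prod_nonneg fun _ _ => hl0 _ _)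

include hl hl0 hl1 hc0 in
lemma bddMeas_log_max (d : D) : BddMeas fun f => Real.log (max (l f d) c0) := by
  refine BddMeas.mk' (C := max |Real.log c0| |Real.log (max 1 c0)|)
    (((hl d).max measurable_const).log) fun f => ?_
  exact abs_le_max_abs_abs (Real.log_le_log hc0 (le_max_right _ _))
    (Real.log_le_log (hc0.trans_le (le_max_right _ _)) (max_le_max_right _ (hl1 f d)))

include hb hν hv hl hl0 hl1 hc0 hγ hε hc in
/-- The evidence lower bound. -/
lemma mul_exp_le_integral_optWeight {n : ℕ} {S : Fin n → D} (hS : ∀ s, 0 < ls (S s)) :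
    b * Real.exp (γ * (vs - ε) + ∑ s, ∫ f, Real.log (max (l f (S s)) c0) ∂ν) ≤
      ∫ f, optWeight γ v l S f ∂p0 := by
  have hL := fun d => bddMeas_log_max hl hl0 hl1 hc0 d
  have hu : BddMeas fun f => γ * v f + ∑ s, Real.log (max (l f (S s)) c0) :=
    (hv.const_mul γ).add (BddMeas.sum _ fun s _ => hL _)
  refine le_trans (mul_le_mul_of_nonneg_left (Real.exp_le_exp.mpr ?_) hb.le)
    (mul_exp_integral_le p0 (bddMeas_optWeight hv hl hl0 hl1 S) (optWeight_nonneg hl0 S) hb hν hu ?_)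
  · rw [integral_add ((hv.const_mul γ).integrable ν)
      ((BddMeas.sum _ fun s _ => hL _).integrable ν), integral_const_mul,
      integral_finsetSum _ fun s _ => (hL _).integrable ν]
    have : vs - ε ≤ ∫ f, v f ∂ν := by
      have := integral_mono_ae (integrable_const (vs - ε)) (hv.integrable ν)
        (hε.mono fun f hf => by linarith)
      simpa using this
    gcongr
  · filter_upwards [hc] with f hf
    rw [Real.exp_add, Real.exp_sum, optWeight]
    refine mul_le_mul_of_nonneg_left (Finset.prod_le_prod (fun _ _ => (Real.exp_pos _).le)
      fun s _ => ?_) (Real.exp_pos _).le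
    rw [Real.exp_log (hc0.trans_le (le_max_right _ _)), max_eq_left (hf _ (hS s))]

include hk0 hkl hl hl0 hl1 hc0 hc hκ in
lemma sum_mul_log_sub_le (f' : F) :
    ∑ d, k f' d * (Real.log (ls d) - ∫ f, Real.log (max (l f d) c0) ∂ν) ≤ κ := by
  have hL := fun d => bddMeas_log_max hl hl0 hl1 hc0 d
  have hB : ∀ d, BddMeas fun f => k f' d * (Real.log (ls d) - Real.log (max (l f d) c0)) :=
    fun d => ((BddMeas.const _).sub (hL d)).const_mul _
  have e : ∑ d, k f' d * (Real.log (ls d) - ∫ f, Real.log (max (l f d) c0) ∂ν) =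
      ∫ f, ∑ d, k f' d * (Real.log (ls d) - Real.log (max (l f d) c0)) ∂ν := by
    rw [integral_finsetSum _ fun d _ => (hB d).integrable ν]
    refine Finset.sum_congr rfl fun d _ => ?_
    rw [integral_const_mul, integral_sub (integrable_const _) ((hL d).integrable ν)]
    simp
  rw [e]
  have := integral_mono_ae ((BddMeas.sum _ fun d _ => hB d).integrable ν)
    (integrable_const (μ := ν) κ) (by
      filter_upwards [hκ f', hc] with f hf hcf
      refine le_trans (le_of_eq (Finset.sum_congr rfl fun d _ => ?_)) hf
      by_cases hd : k f' d = 0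
      · simp [hd]
      have hd' := hkl f' d hd
      rw [max_eq_left (hcf d hd'), Real.log_div hd'.ne' (hc0.trans_le (hcf d hd')).ne'])
  simpa using this

variable {y : F → F → ℝ} (hy : BddMeas fun p : F × F => y p.1 p.2)
  (hyk : ∀ f f', ∑ d, k f' d * (l f d / ls d * Real.exp (y f f')) ≤ 1)
  {β : ℝ} (hβ : ∀ᵐ f ∂p0, β * (vs - v f) ≤ γ * (vs - v f))

include hk hk0 hk1 hb hν hv hl hl0 hl1 hls hkl hγ hc0 hε hc hκ hy hyk hβ

theorem integral_optimistic_posterior_le (T : ℕ) :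
    IsProbabilityMeasure (pathLaw k (fun _ S => gibbs p0 (optWeight γ v l S)) T) ∧
    ∫ ρ, ∑ t : Fin T, (β * (vs - v (ρ t).1) + ∑ s : Fin t, y (ρ t).1 (ρ (Fin.castLE t.2.le s)).1)
      ∂(pathLaw k (fun _ S => gibbs p0 (optWeight γ v l S)) T) ≤
    ∑ n ∈ Finset.range T, (γ * ε - Real.log b + n * κ) := by
  classical
  let P : ∀ n, (Fin n → D) → Measure F := fun n S =>
    if ∀ s, 0 < ls (S s) then gibbs p0 (optWeight γ v l S) else p0
  have hwB : ∀ {n : ℕ} (S : Fin n → D), BddMeas (optWeight γ v l S) := fun S =>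
    bddMeas_optWeight hv hl hl0 hl1 S
  have hev : ∀ {n : ℕ} {S : Fin n → D}, (∀ s, 0 < ls (S s)) → _ := fun {n} {S} hS =>
    mul_exp_le_integral_optWeight p0 ν hb hν hv hl hl0 hl1 hγ hc0 hε hc (n := n) (S := S) hS
  have hZ : ∀ {n : ℕ} {S : Fin n → D}, (∀ s, 0 < ls (S s)) → 0 < ∫ f, optWeight γ v l S f ∂p0 :=
    fun hS => (mul_pos hb (Real.exp_pos _)).trans_le (hev hS)
  have hP : ∀ n S, IsProbabilityMeasure (P n S) := fun n S => by
    by_cases hS : ∀ s, 0 < ls (S s)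
    · simp only [P, hS, implies_true, if_true]
      exact isProbabilityMeasure_gibbs p0 (hwB S) (optWeight_nonneg hl0 S) (hZ hS)
    · simp only [P, hS, if_false]
      infer_instance
  rw [pathLaw_congr hk hk0 hk1 hP hkl (P' := fun _ S => gibbs p0 (optWeight γ v l S))
    (fun n S hS => by simp [P, hS]) T]
  refine ⟨isProbabilityMeasure_pathLaw hk hk0 hk1 hP T, ?_⟩
  have hysum : ∀ n, BddMeas fun p : (Fin n → F × D) × F => ∑ s, y p.2 (p.1 s).1 := fun n =>
    BddMeas.sum _ fun s _ => hy.comp (φ := fun p : (Fin n → F × D) × F => (p.2, (p.1 s).1))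
      (measurable_snd.prodMk (measurable_fst.comp ((measurable_pi_apply s).comp measurable_fst)))
  have hΦ : ∀ n, BddMeas fun p : (Fin n → F × D) × F =>
      β * (vs - v p.2) + ∑ s, y p.2 (p.1 s).1 := fun n =>
    ((((BddMeas.const vs).sub (hv.comp measurable_snd)).const_mul β)).add (hysum n)
  refine integral_predictable_le hk hk0 hk1 hP
    (Φ := fun n ρ f => β * (vs - v f) + ∑ s, y f (ρ s).1) hΦ (fun n => ?_) T
  have hpr := isProbabilityMeasure_pathLaw hk hk0 hk1 hP n
  let Q : F → F × D → ℝ := fun f r => l f r.2 / ls r.2 * Real.exp (y f r.1)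
  have hQ2 : BddMeas fun p : (F × F) × D => l p.1.1 p.2 / ls p.2 * Real.exp (y p.1.1 p.1.2) :=
    BddMeas.uncurry_discrete (X := F × F) (F := fun p d => l p.1 d / ls d * Real.exp (y p.1 p.2))
      fun d => BddMeas.mul (by
        simp only [div_eq_mul_inv]
        exact ((bddMeas_lik hl hl0 hl1 d).comp measurable_fst).mul (BddMeas.const _)) hy.exp
  have hQ0 : ∀ f r, 0 ≤ Q f r := fun f r =>
    mul_nonneg (div_nonneg (hl0 _ _) (hls _)) (Real.exp_pos _).le
  have hW : BddMeas fun p : (Fin n → F × D) × F => ∏ s, Q p.2 (p.1 s) :=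
    BddMeas.prod _ fun s _ => hQ2.comp
      (φ := fun p : (Fin n → F × D) × F => ((p.2, (p.1 s).1), (p.1 s).2)) (by fun_prop)
  have hWi : ∫ ρ, ∫ f, ∏ s, Q f (ρ s) ∂p0 ∂(pathLaw k P n) ≤ 1 := by
    rw [integral_integral_swap (hW.integrable _)]
    have : ∀ f, ∫ ρ, ∏ s, Q f (ρ s) ∂(pathLaw k P n) ≤ 1 := fun f =>
      integral_prod_pathLaw_le hk hk0 hk1 hP
        (hQ2.comp (φ := fun r : F × D => ((f, r.1), r.2)) (by fun_prop)) (hQ0 f) (hyk f) n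
    refine (integral_mono_of_nonneg (Filter.Eventually.of_forall fun f =>
      integral_nonneg fun ρ => Finset.prod_nonneg fun s _ => hQ0 _ _)
      (integrable_const (1 : ℝ)) (Filter.Eventually.of_forall this)).trans ?_
    simp
  let Λ : D → ℝ := fun d => Real.log (ls d) - ∫ f, Real.log (max (l f d) c0) ∂ν
  have hΛ : ∀ f', ∑ d, k f' d * Λ d ≤ κ :=
    sum_mul_log_sub_le hk0 ν hl hl0 hl1 hkl hc0 hc hκ
  have hΛi := integral_sum_pathLaw_le hk hk0 hk1 hP hΛ n
  have hΛB : BddMeas fun ρ : Fin n → F × D => ∑ s, Λ (ρ s).2 :=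
    BddMeas.sum _ fun s _ => (BddMeas.of_discrete Λ).comp
      (measurable_snd.comp (measurable_pi_apply s))
  have hWB : BddMeas fun ρ : Fin n → F × D => ∫ f, ∏ s, Q f (ρ s) ∂p0 := hW.integral_right p0
  have hpt : ∀ᵐ ρ ∂(pathLaw k P n), ∫ f, (β * (vs - v f) + ∑ s, y f (ρ s).1)
      ∂(P n fun i => (ρ i).2) ≤
      (γ * ε - Real.log b - 1) + ∑ s, Λ (ρ s).2 + ∫ f, ∏ s, Q f (ρ s) ∂p0 := by
    filter_upwards [ae_pathLaw hk hk0 hk1 hP hkl n] with ρ hρ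
    have hPe : P n (fun i => (ρ i).2) = gibbs p0 (optWeight γ v l fun i => (ρ i).2) := by
      simp [P, hρ]
    rw [hPe]
    have h1 := integral_gibbs_le p0 (hwB fun i => (ρ i).2) (optWeight_nonneg hl0 _) (hZ hρ)
      (X := fun f => β * (vs - v f) + ∑ s, y f (ρ s).1) (W := fun f => ∏ s, Q f (ρ s))
      (c := γ * vs + ∑ s, Real.log (ls (ρ s).2))
      ((hΦ n).comp (measurable_prodMk_left (x := ρ))) (hW.comp (measurable_prodMk_left (x := ρ)))
      (fun f => Finset.prod_nonneg fun s _ => hQ0 _ _) (by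
        filter_upwards [hβ] with f hf _
        have e1 : Real.exp (γ * (vs - v f) + ∑ s, y f (ρ s).1) *
            optWeight γ v l (fun i => (ρ i).2) f =
            Real.exp (γ * vs + ∑ s, Real.log (ls (ρ s).2)) * ∏ s, Q f (ρ s) := by
          simp only [optWeight, Q, Real.exp_add, Real.exp_sum, Finset.prod_mul_distrib,
            Real.exp_log (hρ _), Finset.prod_div_distrib, mul_sub, Real.exp_sub]
          have : ∏ s, ls (ρ s).2 ≠ 0 := Finset.prod_ne_zero_iff.mpr fun s _ => (hρ s).ne'
          have h2 := Real.exp_pos (γ * v f)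
          field_simp
        rw [← e1]
        exact mul_le_mul_of_nonneg_right (Real.exp_le_exp.mpr (by linarith))
          (optWeight_nonneg hl0 _ _))
    have h2 := Real.log_le_log (mul_pos hb (Real.exp_pos _)) (hev hρ)
    rw [Real.log_mul hb.ne' (Real.exp_pos _).ne', Real.log_exp] at h2
    simp only [Λ, Finset.sum_sub_distrib]
    linarith
  have hmono : ∫ ρ, ∫ f, (β * (vs - v f) + ∑ s, y f (ρ s).1)
      ∂(P n fun i => (ρ i).2) ∂(pathLaw k P n) ≤
      ∫ ρ, ((γ * ε - Real.log b - 1) + ∑ s, Λ (ρ s).2 + ∫ f, ∏ s, Q f (ρ s) ∂p0)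
        ∂(pathLaw k P n) := by
    refine integral_mono_ae ?_ ((((BddMeas.const _).add hΛB).add hWB).integrable _) hpt
    have := (integral_pathLaw_succ hk hk0 hk1 hP n
      (G := fun ρ => β * (vs - v (ρ (Fin.last n)).1) +
        ∑ s : Fin n, y (ρ (Fin.last n)).1 (ρ s.castSucc).1)
      ((hΦ n).comp (φ := fun ρ : Fin (n + 1) → F × D =>
        ((fun s => ρ s.castSucc), (ρ (Fin.last n)).1)) (by fun_prop))).1
    simpa only [Fin.snoc_last, Fin.snoc_castSucc, ← Finset.sum_mul, hk1, one_mul] using this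
  refine hmono.trans ?_
  rw [integral_add (((BddMeas.const _).add hΛB).integrable _) (hWB.integrable _),
    integral_add (integrable_const _) (hΛB.integrable _)]
  simp only [integral_const, probReal_univ, one_smul]
  linarith

end PosteriorSampling

/-! ### Products of finite distributions -/

section Product

variable {X : Type*} [Fintype X] {H : ℕ}

lemma sum_pi_prod (e : Fin H → X → ℝ) :
    ∑ D : Fin H → X, ∏ h, e h (D h) = ∏ h, ∑ x, e h x := by
  classical
  rw [← Finset.sum_prod_piFinset, Fintype.piFinset_univ]

lemma sum_pi_prod_mul_sum {e : Fin H → X → ℝ} (he : ∀ h, ∑ x, e h x = 1) (g : Fin H → X → ℝ) :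
    ∑ D : Fin H → X, (∏ h, e h (D h)) * ∑ h, g h (D h) = ∑ h, ∑ x, e h x * g h x := by
  classical
  simp only [Finset.mul_sum]
  rw [Finset.sum_comm]
  refine Finset.sum_congr rfl fun j _ => ?_
  have h1 : ∀ D : Fin H → X, (∏ h, e h (D h)) * g j (D j) =
      ∏ h, e h (D h) * (if h = j then g j (D h) else 1) := fun D => by
    rw [Finset.prod_mul_distrib, Finset.prod_ite_eq' Finset.univ j, if_pos (Finset.mem_univ j)]
  simp only [h1]
  rw [sum_pi_prod (fun h x => e h x * (if h = j then g j x else 1))]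
  rw [← Finset.mul_prod_erase _ _ (Finset.mem_univ j), Finset.prod_eq_one, mul_one]
  · simp
  · intro h hh
    simp [Finset.ne_of_mem_erase hh, he]

end Product

/-! ### Measurability in the model -/

section Meas

variable {O A : Type*} [Fintype O] [Fintype A] {H : ℕ} {𝓗 : Set (Model O A)}

lemma measurable_trans (τ : Hist O A) (o : O) : Measurable fun f : 𝓗 => f.1.trans τ o :=
  (measurable_pi_apply o).comp ((measurable_pi_apply τ).comp
    ((comap_measurable (Model.trans (O := O) (A := A))).comp measurable_subtype_coe))

lemma measurable_model_segProb (past σ : Hist O A) : Measurable fun f : 𝓗 => f.1.segProb past σ := by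
  induction σ generalizing past with
  | nil => exact measurable_const
  | cons x σ ih => exact (measurable_trans past x.1).mul (ih _)

lemma measurable_policy_segProb {F : Type*} [MeasurableSpace F] {π : F → Policy O A}
    (hπ : ∀ τ o a, Measurable fun f => (π f).act τ o a) (past σ : Hist O A) :
    Measurable fun f => (π f).segProb past σ := by
  induction σ generalizing past with
  | nil => exact measurable_const
  | cons x σ ih => exact (hπ past x.1 x.2).mul (ih _)

variable {R : Fin H → O → A → ℝ}

lemma measurable_value {F : Type*} [MeasurableSpace F] {m : F → 𝓗} (hm : Measurable m)
    {π : F → Policy O A} (hπ : ∀ τ o a, Measurable fun f => (π f).act τ o a) :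
    Measurable fun f => (m f).1.value R (π f) :=
  Finset.measurable_fun_sum _ fun τ _ =>
    (((measurable_model_segProb [] (List.ofFn τ)).comp hm).mul
      (measurable_policy_segProb hπ [] (List.ofFn τ))).mul measurable_const

variable [Nonempty A] {U : ℕ → Finset (Test O A)}

lemma measurable_explore {F : Type*} [MeasurableSpace F] {π cont : F → Policy O A}
    (hπ : ∀ τ o a, Measurable fun f => (π f).act τ o a)
    (hcont : ∀ τ o a, Measurable fun f => (cont f).act τ o a) (h : ℕ) (acts : List A)
    (τ : Hist O A) (o : O) (a : A) :
    Measurable fun f => ((π f).explore (cont f) h acts).act τ o a := by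
  simp only [Policy.explore]
  split_ifs
  · exact hπ τ o a
  · exact measurable_const
  · exact measurable_const
  · exact measurable_const
  · exact hcont τ o a

lemma measurable_exploreProb {F : Type*} [MeasurableSpace F] {π : F → Policy O A}
    {cont : F → List A → Policy O A} (hπ : ∀ τ o a, Measurable fun f => (π f).act τ o a)
    (hcont : ∀ acts τ o a, Measurable fun f => (cont f acts).act τ o a) (h : ℕ) (τ : Traj O A H) :
    Measurable fun f => exploreProb U (π f) (cont f) h τ :=
  (Finset.measurable_fun_sum _ fun acts _ => measurable_policy_segProb
    (measurable_explore hπ (hcont acts) h acts) [] _).div_const _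

end Meas

/-! ### Exploration distributions -/

section Exploration

variable {O A : Type*} [Fintype O] [Fintype A] [Nonempty A] {H : ℕ} {U : ℕ → Finset (Test O A)}

lemma exploreProb_nonneg (π : Policy O A) (cont : List A → Policy O A) (h : ℕ) (τ : Traj O A H) :
    0 ≤ exploreProb U π cont h τ :=
  div_nonneg (Finset.sum_nonneg fun _ _ => Policy.prob_nonneg _ _) (Nat.cast_nonneg _)

lemma exploreTrajProb_nonneg (f : Model O A) (π : Policy O A) (cont : List A → Policy O A) (h : ℕ)
    (τ : Traj O A H) : 0 ≤ exploreTrajProb f U π cont h τ :=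
  mul_nonneg (f.prob_nonneg _) (exploreProb_nonneg _ _ _ _)

lemma exploreTrajProb_eq (f : Model O A) (π : Policy O A) (cont : List A → Policy O A) (h : ℕ)
    (τ : Traj O A H) : exploreTrajProb f U π cont h τ =
      (∑ acts ∈ coreActions U (h + 1), f.trajProb (π.explore (cont acts) h acts) τ) /
        (coreActions U (h + 1)).card := by
  simp only [exploreTrajProb, exploreProb, Model.trajProb, ← Finset.mul_sum, mul_div_assoc]

lemma sum_exploreTrajProb (f : Model O A) (π : Policy O A) (cont : List A → Policy O A) {h : ℕ}
    (hU : (coreActions U (h + 1)).Nonempty) :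
    ∑ τ : Traj O A H, exploreTrajProb f U π cont h τ = 1 := by
  simp only [exploreTrajProb_eq]
  rw [← Finset.sum_div, Finset.sum_comm]
  simp only [Model.sum_trajProb]
  have : ((coreActions U (h + 1)).card : ℝ) ≠ 0 := by exact_mod_cast hU.card_pos.ne'
  simp [this]

lemma exploreTrajProb_le_one (f : Model O A) (π : Policy O A) (cont : List A → Policy O A) {h : ℕ}
    (hU : (coreActions U (h + 1)).Nonempty) (τ : Traj O A H) :
    exploreTrajProb f U π cont h τ ≤ 1 := by
  rw [← sum_exploreTrajProb (H := H) f π cont hU]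
  exact Finset.single_le_sum (fun τ _ => exploreTrajProb_nonneg f π cont h τ) (Finset.mem_univ τ)

lemma sum_exploreTrajProb_mul_ratio (f g : Model O A) (π : Policy O A)
    (cont : List A → Policy O A) {h : ℕ} (hU : (coreActions U (h + 1)).Nonempty) :
    ∑ τ : Traj O A H, exploreTrajProb g U π cont h τ *
        (f.prob (List.ofFn τ) ^ (1 / 2 : ℝ) / g.prob (List.ofFn τ) ^ (1 / 2 : ℝ)) =
      1 - hellingerSq (fun τ : Traj O A H => exploreTrajProb f U π cont h τ)
        (fun τ => exploreTrajProb g U π cont h τ) := by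
  have hs : ∀ τ : Traj O A H, exploreTrajProb g U π cont h τ *
        (f.prob (List.ofFn τ) ^ (1 / 2 : ℝ) / g.prob (List.ofFn τ) ^ (1 / 2 : ℝ)) =
      1 / 2 * exploreTrajProb f U π cont h τ + 1 / 2 * exploreTrajProb g U π cont h τ -
      1 / 2 * (Real.sqrt (exploreTrajProb f U π cont h τ) -
        Real.sqrt (exploreTrajProb g U π cont h τ)) ^ 2 := fun τ => by
    rw [sub_sq, Real.sq_sqrt (exploreTrajProb_nonneg _ _ _ _ _),
      Real.sq_sqrt (exploreTrajProb_nonneg _ _ _ _ _), ← Real.sqrt_eq_rpow, ← Real.sqrt_eq_rpow]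
    unfold exploreTrajProb
    rw [Real.sqrt_mul (f.prob_nonneg _), Real.sqrt_mul (g.prob_nonneg _)]
    set x := f.prob (List.ofFn τ)
    set z := g.prob (List.ofFn τ) with hz
    have he := Real.mul_self_sqrt (exploreProb_nonneg (U := U) π cont h τ)
    set e := exploreProb U π cont h τ
    have h1 : z * e * (Real.sqrt x / Real.sqrt z) = Real.sqrt z * Real.sqrt x * e := by
      rcases (g.prob_nonneg (List.ofFn τ)).eq_or_lt with h0 | h0
      · rw [← hz] at h0; simp [← h0]
      · have h3 := Real.mul_self_sqrt h0.le
        have h4 := Real.sqrt_pos.mpr h0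
        rw [← hz] at h3 h4
        field_simp
        rw [sq, h3]
        ring
    rw [h1]
    linear_combination (-Real.sqrt z * Real.sqrt x) * he
  simp only [hs, Finset.sum_sub_distrib, Finset.sum_add_distrib, ← Finset.mul_sum,
    sum_exploreTrajProb _ _ _ hU, hellingerSq]
  ring

/-- The log-likelihood ratio of trajectories has mean at most `ε` under every exploration policy. -/
lemma sum_exploreTrajProb_mul_log_le {f g : Model O A} {ε : ℝ}
    (h : ∀ π : Policy O A, klDivergence (fun τ : Traj O A H => g.trajProb π τ)
      (fun τ : Traj O A H => f.trajProb π τ) ≤ (ε : EReal))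
    (π : Policy O A) (cont : List A → Policy O A) {k : ℕ}
    (hU : (coreActions U (k + 1)).Nonempty) :
    ∑ τ : Traj O A H, exploreTrajProb g U π cont k τ *
      Real.log (g.prob (List.ofFn τ) / f.prob (List.ofFn τ)) ≤ ε := by
  have h1 : ∀ π : Policy O A, ∑ τ : Traj O A H, g.trajProb π τ *
      Real.log (g.prob (List.ofFn τ) / f.prob (List.ofFn τ)) ≤ ε := fun π => by
    have h2 := h π
    unfold klDivergence at h2
    split_ifs at h2 with h3
    · have h2' := EReal.coe_le_coe_iff.mp h2
      refine le_trans (le_of_eq (Finset.sum_congr rfl fun τ _ => ?_)) h2'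
      by_cases hp : π.prob (List.ofFn τ) = 0
      · simp [Model.trajProb, hp]
      · simp only [Model.trajProb]
        rw [mul_div_mul_right _ _ hp]
    · exact absurd h2 (by simp)
  simp only [exploreTrajProb_eq, div_mul_eq_mul_div, Finset.sum_mul]
  rw [← Finset.sum_div, Finset.sum_comm,
    div_le_iff₀ (by exact_mod_cast hU.card_pos), mul_comm ε, ← nsmul_eq_mul]
  exact Finset.sum_le_card_nsmul _ _ _ fun acts _ => h1 _

lemma prob_ne_zero_of_klDivergence_le {f g : Model O A} {ε : ℝ}
    (h : ∀ π : Policy O A, klDivergence (fun τ : Traj O A H => g.trajProb π τ)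
      (fun τ : Traj O A H => f.trajProb π τ) ≤ (ε : EReal)) (τ : Traj O A H)
    (hτ : g.prob (List.ofFn τ) ≠ 0) : f.prob (List.ofFn τ) ≠ 0 := by
  intro h0
  let π : Policy O A := ⟨fun _ _ _ => (Fintype.card A : ℝ)⁻¹, fun _ _ _ => by positivity, by simp⟩
  have hπ : ∀ σ past, 0 < π.segProb past σ := by
    intro σ
    induction σ with
    | nil => exact fun _ => one_pos
    | cons x σ ih => exact fun past => mul_pos (by positivity) (ih _)
  have h2 := h π
  unfold klDivergence at h2
  split_ifs at h2 with h3
  · have := h3 τ (by simp [Model.trajProb, h0])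
    exact hτ ((mul_eq_zero.mp this).resolve_right (hπ _ _).ne')
  · exact absurd h2 (by simp)

end Exploration

section Round

variable {O A : Type*} [Fintype O] [Fintype A] {H : ℕ}

noncomputable instance : Fintype (RoundData O A H) := by
  classical exact inferInstanceAs (Fintype (Fin H → Traj O A H))

instance : DiscreteMeasurableSpace (RoundData O A H) := ⟨fun _ => trivial⟩

/-- The likelihood factor `∏_h ℙ_f(τ_h)^{1/2}` of one iteration. -/
noncomputable def roundLik (f : Model O A) (D : RoundData O A H) : ℝ :=
  ∏ h, f.prob (List.ofFn (D h)) ^ (1 / 2 : ℝ)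

lemma roundLik_nonneg (f : Model O A) (D : RoundData O A H) : 0 ≤ roundLik f D :=
  Finset.prod_nonneg fun _ _ => Real.rpow_nonneg (f.prob_nonneg _) _

lemma roundLik_pos_iff (f : Model O A) (D : RoundData O A H) :
    0 < roundLik f D ↔ ∀ h, f.prob (List.ofFn (D h)) ≠ 0 := by
  rw [(roundLik_nonneg f D).lt_iff_ne', roundLik, Finset.prod_ne_zero_iff]
  simp only [Finset.mem_univ, true_implies]
  refine forall_congr' fun h => not_congr ?_
  rw [Real.rpow_eq_zero (f.prob_nonneg _) (by norm_num)]

lemma roundLik_le_one (f : Model O A) (D : RoundData O A H) : roundLik f D ≤ 1 :=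
  Finset.prod_le_one (fun _ _ => Real.rpow_nonneg (f.prob_nonneg _) _) fun _ _ =>
    Real.rpow_le_one (f.prob_nonneg _) (f.segProb_le_one _ _) (by norm_num)

lemma measurable_roundLik {𝓗 : Set (Model O A)} (D : RoundData O A H) :
    Measurable fun f : 𝓗 => roundLik f.1 D :=
  Finset.measurable_fun_prod _ fun _ _ => (measurable_model_segProb [] _).pow_const _

lemma log_roundLik_div {f g : Model O A} {D : RoundData O A H} (hg : 0 < roundLik g D)
    (hf : 0 < roundLik f D) : Real.log (roundLik g D / roundLik f D) =
      ∑ h, 1 / 2 * Real.log (g.prob (List.ofFn (D h)) / f.prob (List.ofFn (D h))) := by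
  have hg' := (roundLik_pos_iff g D).mp hg
  have hf' := (roundLik_pos_iff f D).mp hf
  rw [roundLik, roundLik, ← Finset.prod_div_distrib, Real.log_prod fun h _ => div_ne_zero
    (Real.rpow_pos_of_pos ((g.prob_nonneg _).lt_of_ne' (hg' h)) _).ne'
    (Real.rpow_pos_of_pos ((f.prob_nonneg _).lt_of_ne' (hf' h)) _).ne']
  refine Finset.sum_congr rfl fun h _ => ?_
  rw [← Real.div_rpow (g.prob_nonneg _) (f.prob_nonneg _), Real.log_rpow
    (div_pos ((g.prob_nonneg _).lt_of_ne' (hg' h)) ((f.prob_nonneg _).lt_of_ne' (hf' h)))]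

variable [Nonempty A] {U : ℕ → Finset (Test O A)}

/-- The probability of the data of one iteration in the model `g`. -/
noncomputable def roundProb (g : Model O A) (U : ℕ → Finset (Test O A)) (π : Policy O A)
    (cont : ℕ → List A → Policy O A) (D : RoundData O A H) : ℝ :=
  ∏ h : Fin H, exploreTrajProb g U π (cont h) h (D h)

/-- The sum of the squared Hellinger distances of the trajectories of one iteration. -/
noncomputable def roundHel (f g : Model O A) (U : ℕ → Finset (Test O A)) (H : ℕ) (π : Policy O A)
    (cont : ℕ → List A → Policy O A) : ℝ :=
  ∑ h : Fin H, hellingerSq (fun τ : Traj O A H => exploreTrajProb f U π (cont h) h τ)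
    (fun τ : Traj O A H => exploreTrajProb g U π (cont h) h τ)

lemma roundProb_nonneg (g : Model O A) (π : Policy O A) (cont : ℕ → List A → Policy O A)
    (D : RoundData O A H) : 0 ≤ roundProb g U π cont D :=
  Finset.prod_nonneg fun _ _ => exploreTrajProb_nonneg _ _ _ _ _

lemma roundLik_pos_of_roundProb_ne_zero {g : Model O A} {π : Policy O A}
    {cont : ℕ → List A → Policy O A} {D : RoundData O A H} (h : roundProb g U π cont D ≠ 0) :
    0 < roundLik g D := by
  rw [roundLik_pos_iff]
  intro i hi
  exact Finset.prod_ne_zero_iff.mp h i (Finset.mem_univ i) (by simp [exploreTrajProb, hi])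

variable (hU : ∀ h : Fin H, (coreActions U (h + 1)).Nonempty)

include hU

lemma sum_roundProb (g : Model O A) (π : Policy O A) (cont : ℕ → List A → Policy O A) :
    ∑ D : RoundData O A H, roundProb g U π cont D = 1 := by
  refine (sum_pi_prod (H := H) (X := Traj O A H)
    (fun h τ => exploreTrajProb g U π (cont h) h τ)).trans ?_
  exact Finset.prod_eq_one fun h _ => sum_exploreTrajProb g π (cont h) (hU h)

lemma sum_roundProb_mul_ratio_le (f g : Model O A) (π : Policy O A)
    (cont : ℕ → List A → Policy O A) :
    ∑ D : RoundData O A H, roundProb g U π cont D *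
      (roundLik f D / roundLik g D * Real.exp (roundHel f g U H π cont)) ≤ 1 := by
  have h1 : ∀ D : RoundData O A H, roundProb g U π cont D *
      (roundLik f D / roundLik g D * Real.exp (roundHel f g U H π cont)) =
      (∏ h : Fin H, exploreTrajProb g U π (cont h) h (D h) *
        (f.prob (List.ofFn (D h)) ^ (1 / 2 : ℝ) / g.prob (List.ofFn (D h)) ^ (1 / 2 : ℝ))) *
      Real.exp (roundHel f g U H π cont) := fun D => by
    rw [roundProb, roundLik, roundLik, ← Finset.prod_div_distrib, Finset.prod_mul_distrib,
      mul_assoc]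
  simp only [h1]
  rw [← Finset.sum_mul]
  have h2 := sum_pi_prod (H := H) (X := Traj O A H) (fun h τ => exploreTrajProb g U π (cont h) h τ *
        (f.prob (List.ofFn τ) ^ (1 / 2 : ℝ) / g.prob (List.ofFn τ) ^ (1 / 2 : ℝ)))
  refine (congrArg (· * Real.exp (roundHel f g U H π cont)) h2).le.trans ?_
  simp only [sum_exploreTrajProb_mul_ratio f g π _ (hU _)]
  rw [roundHel, Real.exp_sum, ← Finset.prod_mul_distrib]
  refine Finset.prod_le_one (fun h _ => mul_nonneg ?_ (Real.exp_pos _).le) fun h _ => ?_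
  · rw [← sum_exploreTrajProb_mul_ratio f g π _ (hU _)]
    exact Finset.sum_nonneg fun τ _ => mul_nonneg (exploreTrajProb_nonneg _ _ _ _ _)
      (div_nonneg (Real.rpow_nonneg (f.prob_nonneg _) _) (Real.rpow_nonneg (g.prob_nonneg _) _))
  · set x := hellingerSq (fun τ : Traj O A H => exploreTrajProb f U π (cont h) h τ)
      (fun τ : Traj O A H => exploreTrajProb g U π (cont h) h τ)
    have := mul_le_mul_of_nonneg_right (Real.add_one_le_exp (-x)) (Real.exp_pos x).le
    rw [← Real.exp_add, neg_add_cancel, Real.exp_zero] at this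
    linarith

lemma sum_roundProb_mul_log_le {f g : Model O A} {ε : ℝ}
    (h : ∀ π : Policy O A, klDivergence (fun τ : Traj O A H => g.trajProb π τ)
      (fun τ : Traj O A H => f.trajProb π τ) ≤ (ε : EReal))
    (π : Policy O A) (cont : ℕ → List A → Policy O A) :
    ∑ D : RoundData O A H, roundProb g U π cont D * Real.log (roundLik g D / roundLik f D) ≤
      H * (ε / 2) := by
  have h1 : ∀ D : RoundData O A H, roundProb g U π cont D *
      Real.log (roundLik g D / roundLik f D) =
      (∏ h : Fin H, exploreTrajProb g U π (cont h) h (D h)) *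
        ∑ h, 1 / 2 * Real.log (g.prob (List.ofFn (D h)) / f.prob (List.ofFn (D h))) := fun D => by
    by_cases hD : roundProb g U π cont D = 0
    · rw [hD, zero_mul]
      rw [roundProb] at hD
      rw [hD, zero_mul]
    · have hg := roundLik_pos_of_roundProb_ne_zero hD
      have hf : 0 < roundLik f D := (roundLik_pos_iff f D).mpr fun i =>
        prob_ne_zero_of_klDivergence_le h _ ((roundLik_pos_iff g D).mp hg i)
      rw [log_roundLik_div hg hf, roundProb]
  simp only [h1]
  refine (sum_pi_prod_mul_sum (H := H) (X := Traj O A H)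
    (e := fun h τ => exploreTrajProb g U π (cont h) h τ)
    (fun h => sum_exploreTrajProb g π (cont h) (hU h))
    (fun _ τ => 1 / 2 * Real.log (g.prob (List.ofFn τ) / f.prob (List.ofFn τ)))).le.trans ?_
  have h2 : ∀ i ∈ (Finset.univ : Finset (Fin H)), ∑ τ : Traj O A H,
      exploreTrajProb g U π (cont i) i τ *
        (1 / 2 * Real.log (g.prob (List.ofFn τ) / f.prob (List.ofFn τ))) ≤ ε / 2 := fun i _ => by
    have h3 := sum_exploreTrajProb_mul_log_le h π (cont i) (hU i)
    have e : ∀ τ : Traj O A H, exploreTrajProb g U π (cont i) i τ *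
        (1 / 2 * Real.log (g.prob (List.ofFn τ) / f.prob (List.ofFn τ))) =
        1 / 2 * (exploreTrajProb g U π (cont i) i τ *
          Real.log (g.prob (List.ofFn τ) / f.prob (List.ofFn τ))) := fun τ => by ring
    simp only [e]
    rw [← Finset.mul_sum]
    linarith
  have := Finset.sum_le_card_nsmul _ _ _ h2
  simpa using this

end Round

section Run

variable {O A : Type*} [Fintype O] [Fintype A] [Nonempty A] {H : ℕ} {R : Fin H → O → A → ℝ}
  {U : ℕ → Finset (Test O A)} {𝓗 : Set (Model O A)} (fstar : 𝓗) {optPol : 𝓗 → Policy O A}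
  {cont : 𝓗 → ℕ → List A → Policy O A} (p0 : Measure 𝓗)

lemma runLaw_eq_pathLaw (γ : ℝ) (n : ℕ) : runLaw R U 𝓗 fstar optPol cont p0 (1 / 2) γ n =
    pathLaw (fun f D => roundProb fstar.1 U (optPol f) (cont f) D)
      (fun _ S => gibbs p0 (optWeight γ (fun f : 𝓗 => f.1.optValue R)
        (fun f D => roundLik f.1 D) S)) n := by
  induction n with
  | zero => rfl
  | succ n ih => rw [runLaw, pathLaw, ih]; rfl

variable [IsProbabilityMeasure p0]

lemma exists_subset_modelBall {ε : ℝ} (hp : p0 (modelBall R 𝓗 fstar ε) ≠ 0) {ζ : ℝ} (hζ : 0 < ζ) :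
    ∃ c0 : ℝ, 0 < c0 ∧ ∃ B ⊆ modelBall R 𝓗 fstar ε,
      (∀ f ∈ B, ∀ D : RoundData O A H, 0 < roundLik fstar.1 D → c0 ≤ roundLik f.1 D) ∧
      0 < p0.real B ∧ -Real.log (p0.real B) ≤ -Real.log (p0.real (modelBall R 𝓗 fstar ε)) + ζ := by
  set B : ℕ → Set 𝓗 := fun m => {f | f ∈ modelBall R 𝓗 fstar ε ∧
    ∀ D : RoundData O A H, 0 < roundLik fstar.1 D → 1 / ((m : ℝ) + 1) ≤ roundLik f.1 D} with hB
  have hmono : Monotone B := fun m n hmn f hf => ⟨hf.1, fun D hD =>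
    (one_div_le_one_div_of_le (by positivity) (by simpa using hmn)).trans (hf.2 D hD)⟩
  have hU : ⋃ m, B m = modelBall R 𝓗 fstar ε := by
    refine Set.Subset.antisymm (Set.iUnion_subset fun m f hf => hf.1) fun f hf => ?_
    have hkl : ∀ π : Policy O A, klDivergence (fun τ : Traj O A H => fstar.1.trajProb π τ)
      (fun τ : Traj O A H => f.1.trajProb π τ) ≤ (ε : EReal) := fun π =>
        (le_iSup (fun π : Policy O A => klDivergence (fun τ : Traj O A H => fstar.1.trajProb π τ)
      (fun τ : Traj O A H => f.1.trajProb π τ)) π).trans hf.2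
    have hev : ∀ᶠ m : ℕ in Filter.atTop, ∀ D : RoundData O A H, 0 < roundLik fstar.1 D →
        1 / ((m : ℝ) + 1) ≤ roundLik f.1 D := by
      refine Filter.eventually_all.mpr fun D => ?_
      by_cases hD : 0 < roundLik fstar.1 D
      · have hf0 : 0 < roundLik f.1 D := (roundLik_pos_iff _ D).mpr fun i =>
          prob_ne_zero_of_klDivergence_le hkl _ ((roundLik_pos_iff _ D).mp hD i)
        filter_upwards [tendsto_one_div_add_atTop_nhds_zero_nat.eventually_lt_const hf0] with m hm _
        exact hm.le
      · exact Filter.Eventually.of_forall fun _ h => absurd h hD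
    obtain ⟨m, hm⟩ := hev.exists
    exact Set.mem_iUnion.mpr ⟨m, hf, hm⟩
  have ht := tendsto_measure_iUnion_atTop (μ := p0) hmono
  rw [hU] at ht
  have ht' : Filter.Tendsto (fun m => p0.real (B m)) Filter.atTop
      (nhds (p0.real (modelBall R 𝓗 fstar ε))) :=
    (ENNReal.tendsto_toReal (measure_ne_top _ _)).comp ht
  have hpos : 0 < p0.real (modelBall R 𝓗 fstar ε) :=
    ENNReal.toReal_pos hp (measure_ne_top _ _)
  have hlog := (ht'.log hpos.ne').eventually_const_lt
    (show Real.log (p0.real (modelBall R 𝓗 fstar ε)) - ζ < _ by linarith)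
  obtain ⟨m, hm1, hm2⟩ := (hlog.and (ht'.eventually_const_lt hpos)).exists
  exact ⟨1 / ((m : ℝ) + 1), by positivity, B m, fun f hf => hf.1, fun f hf => hf.2, hm2,
    by linarith⟩

lemma sum_castLE_eq_sum_Iio {T : ℕ} (t : Fin T) (G : Fin T → ℝ) :
    ∑ s : Fin t, G (Fin.castLE t.2.le s) = ∑ s ∈ Finset.Iio t, G s :=
  Finset.sum_bij' (fun s _ => Fin.castLE t.2.le s)
    (fun s hs => ⟨s.1, Fin.lt_def.mp (Finset.mem_Iio.mp hs)⟩)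
    (fun s _ => Finset.mem_Iio.mpr (Fin.lt_def.mpr s.2)) (fun _ _ => Finset.mem_univ _)
    (fun _ _ => rfl) (fun _ _ => rfl) (fun _ _ => rfl)

variable (hR : ∀ i o a, 0 ≤ R i o a) (hR1 : ∀ τ : Traj O A H, ∑ i, R i (τ i).1 (τ i).2 ≤ 1)
  (hopt : ∀ (f : 𝓗) (π : Policy O A), f.1.value R π ≤ f.1.value R (optPol f))
  (hoptm : ∀ τ o a, Measurable fun f => (optPol f).act τ o a)
  (hcontm : ∀ h acts τ o a, Measurable fun f => (cont f h acts).act τ o a)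
  (hU : ∀ h : Fin H, (coreActions U (h + 1)).Nonempty)

include hR hR1 hopt hoptm in
lemma bddMeas_optValue : BddMeas fun f : 𝓗 => f.1.optValue R := by
  have e : (fun f : 𝓗 => f.1.optValue R) = fun f => f.1.value R (optPol f) :=
    funext fun f => Model.optValue_eq (hopt f)
  rw [e]
  refine BddMeas.mk' (C := 1) (measurable_value measurable_id hoptm) fun f => ?_
  rw [abs_of_nonneg (f.1.value_nonneg hR _)]
  exact f.1.value_le_one hR1 _

include hoptm hcontm in
lemma measurable_roundProb (D : RoundData O A H) :
    Measurable fun f => roundProb fstar.1 U (optPol f) (cont f) D :=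
  Finset.measurable_fun_prod _ fun h _ =>
    (measurable_exploreProb hoptm (hcontm h) h (D h)).const_mul _

include hoptm hcontm hU in
lemma bddMeas_roundHel :
    BddMeas fun p : 𝓗 × 𝓗 => roundHel p.1.1 fstar.1 U H (optPol p.2) (cont p.2) := by
  refine BddMeas.sum _ fun h _ => BddMeas.const_mul _ (BddMeas.sum _ fun τ _ => ?_)
  have hb : ∀ f : 𝓗 × 𝓗 → 𝓗, Measurable f → BddMeas fun p : 𝓗 × 𝓗 =>
      Real.sqrt (exploreTrajProb (f p).1 U (optPol p.2) (cont p.2 h) h τ) := fun f hf => by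
    refine BddMeas.mk' (C := 1) (Measurable.sqrt ?_) fun p => ?_
    · exact ((measurable_model_segProb [] (List.ofFn τ)).comp hf).mul
        ((measurable_exploreProb hoptm (hcontm h) h τ).comp measurable_snd)
    · rw [abs_of_nonneg (Real.sqrt_nonneg _), Real.sqrt_le_one]
      exact exploreTrajProb_le_one _ _ _ (hU h) τ
  have := (hb Prod.fst measurable_fst).sub (hb (fun _ => fstar) measurable_const)
  simpa only [sq] using this.mul this

include hR hR1 hopt hoptm hcontm hU

theorem integral_regret_terms_le {γ : ℝ} (hγ : 0 ≤ γ) {β : ℝ}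
    (hβ : ∀ᵐ f ∂p0, β * (fstar.1.optValue R - f.1.optValue R) ≤
      γ * (fstar.1.optValue R - f.1.optValue R))
    {ε : ℝ} (hε : 0 < ε) (hp : p0 (modelBall R 𝓗 fstar ε) ≠ 0) (T : ℕ) :
    IsProbabilityMeasure (runLaw R U 𝓗 fstar optPol cont p0 (1 / 2) γ T) ∧
    ∫ ρ, ∑ t : Fin T, (β * (fstar.1.optValue R - (ρ t).1.1.optValue R) +
        ∑ s ∈ Finset.Iio t, roundHel (ρ t).1.1 fstar.1 U H (optPol (ρ s).1) (cont (ρ s).1))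
      ∂(runLaw R U 𝓗 fstar optPol cont p0 (1 / 2) γ T) ≤
    T * (γ * ε + (H * T * ε - Real.log (p0.real (modelBall R 𝓗 fstar ε)))) := by
  have hv := bddMeas_optValue hR hR1 hopt hoptm
  have key : ∀ ζ : ℝ, 0 < ζ →
      IsProbabilityMeasure (runLaw R U 𝓗 fstar optPol cont p0 (1 / 2) γ T) ∧
      ∫ ρ, ∑ t : Fin T, (β * (fstar.1.optValue R - (ρ t).1.1.optValue R) +
        ∑ s ∈ Finset.Iio t, roundHel (ρ t).1.1 fstar.1 U H (optPol (ρ s).1) (cont (ρ s).1))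
      ∂(runLaw R U 𝓗 fstar optPol cont p0 (1 / 2) γ T) ≤
      T * (γ * ε + (H * T * ε - Real.log (p0.real (modelBall R 𝓗 fstar ε)))) + T * ζ := by
    intro ζ hζ
    obtain ⟨c0, hc0, B, hBs, hBc, hBp, hBl⟩ := exists_subset_modelBall fstar p0 hp hζ
    have hB0 : p0 B ≠ 0 := fun h => by simp [Measure.real, h] at hBp
    set ν : Measure 𝓗 := (p0 B)⁻¹ • p0.restrict B with hνd
    have hνp : IsProbabilityMeasure ν := ⟨by
      rw [hνd, Measure.smul_apply, Measure.restrict_apply_univ, smul_eq_mul,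
        ENNReal.inv_mul_cancel hB0 (measure_ne_top _ _)]⟩
    have hν : ENNReal.ofReal (p0.real B) • ν ≤ p0 := by
      rw [hνd, Measure.real, ENNReal.ofReal_toReal (measure_ne_top _ _), smul_smul,
        ENNReal.mul_inv_cancel hB0 (measure_ne_top _ _), one_smul]
      exact Measure.restrict_le_self
    have hae : ∀ q : 𝓗 → Prop, MeasurableSet {f | q f} → (∀ f ∈ B, q f) → ∀ᵐ f ∂ν, q f :=
      fun q hq h => Measure.ae_smul_measure
        ((ae_restrict_iff hq).mpr (Filter.Eventually.of_forall h)) _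
    have hkl : ∀ f ∈ B, ∀ π : Policy O A, klDivergence
        (fun τ : Traj O A H => fstar.1.trajProb π τ)
        (fun τ : Traj O A H => f.1.trajProb π τ) ≤ (ε : EReal) := fun f hf π =>
      (le_iSup (fun π : Policy O A => klDivergence (fun τ : Traj O A H => fstar.1.trajProb π τ)
        (fun τ : Traj O A H => f.1.trajProb π τ)) π).trans (hBs hf).2
    have hmain := integral_optimistic_posterior_le
      (k := fun f D => roundProb fstar.1 U (optPol f) (cont f) D)
      (l := fun (f : 𝓗) (D : RoundData O A H) => roundLik f.1 D)
      (ls := fun D => roundLik fstar.1 D) (v := fun f : 𝓗 => f.1.optValue R)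
      (y := fun f f' => roundHel f.1 fstar.1 U H (optPol f') (cont f'))
      (vs := fstar.1.optValue R) (ε := ε) (γ := γ) (κ := H * (ε / 2)) (c0 := c0) (β := β)
      (fun D => measurable_roundProb fstar hoptm hcontm D) (fun f D => roundProb_nonneg _ _ _ D)
      (fun f => sum_roundProb hU _ _ _) p0 ν hBp hν hv measurable_roundLik
      (fun f D => roundLik_nonneg _ D) (fun f D => roundLik_le_one _ D)
      (fun D => roundLik_nonneg _ D) (fun f D h => roundLik_pos_of_roundProb_ne_zero h) hγ hc0
      (hae _ (measurableSet_le (measurable_const.sub hv.meas) measurable_const)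
        fun f hf => (hBs hf).1)
      (hae _ (by
        simp only [Set.ofPred_forall]
        exact MeasurableSet.iInter fun D => MeasurableSet.iInter fun _ =>
          measurableSet_le measurable_const (measurable_roundLik D)) hBc)
      (fun f' => hae _ (measurableSet_le (Finset.measurable_fun_sum _ fun D _ =>
          ((measurable_const.div (measurable_roundLik D)).log).const_mul _) measurable_const)
        fun f hf => sum_roundProb_mul_log_le hU (hkl f hf) _ _)
      (bddMeas_roundHel fstar hoptm hcontm hU)
      (fun f f' => sum_roundProb_mul_ratio_le hU f.1 fstar.1 (optPol f') (cont f')) hβ T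
    rw [← runLaw_eq_pathLaw] at hmain
    refine ⟨hmain.1, ?_⟩
    have h1 := hmain.2
    have e : ∀ (ρ : Fin T → 𝓗 × RoundData O A H) (t : Fin T),
        ∑ s : Fin t, roundHel (ρ t).1.1 fstar.1 U H (optPol (ρ (Fin.castLE t.2.le s)).1)
          (cont (ρ (Fin.castLE t.2.le s)).1) = ∑ s ∈ Finset.Iio t,
          roundHel (ρ t).1.1 fstar.1 U H (optPol (ρ s).1) (cont (ρ s).1) := fun ρ t =>
      sum_castLE_eq_sum_Iio t fun s =>
        roundHel (ρ t).1.1 fstar.1 U H (optPol (ρ s).1) (cont (ρ s).1)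
    simp only [e] at h1
    refine h1.trans ?_
    have h2 : ∀ n ∈ Finset.range T, γ * ε - Real.log (p0.real B) + n * (H * (ε / 2)) ≤
        γ * ε + (H * T * ε - Real.log (p0.real (modelBall R 𝓗 fstar ε))) + ζ := fun n hn => by
      have hn' : (n : ℝ) ≤ T := by exact_mod_cast (Finset.mem_range.mp hn).le
      have h3 : (n : ℝ) * (H * (ε / 2)) ≤ T * (H * (ε / 2)) :=
        mul_le_mul_of_nonneg_right hn' (by positivity)
      have h4 : 0 ≤ (T : ℝ) * (H * (ε / 2)) := by positivity
      linarith
    have h3 := Finset.sum_le_card_nsmul _ _ _ h2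
    rw [Finset.card_range, nsmul_eq_mul] at h3
    linarith
  refine ⟨(key 1 one_pos).1, le_of_forall_pos_le_add fun δ hδ => ?_⟩
  refine ((key (δ / (T + 1)) (by positivity)).2).trans (add_le_add_right ?_ _)
  rw [mul_div_assoc', div_le_iff₀ (by positivity)]
  nlinarith

end Run

section Rates

variable {O A : Type*} [Fintype O] [Fintype A] {H : ℕ} {U : ℕ → Finset (Test O A)}
  {α : ℝ} {g : Model O A}

lemma regretRate_eq_sqrt (T : ℕ) (N w : ℝ) :
    regretRate g H U α T N w = Real.sqrt (gecRate g H U α T * H * N * (H + w)) := by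
  have e : gecRate g H U α T * H * N * (H + w) =
      ((Fintype.card A : ℝ) * (maxCoreActions H U : ℝ) ^ 2 * (H : ℝ) / α ^ 2) ^ 2 *
      ((psrRank g H : ℝ) * (Fintype.card A : ℝ) * N * ((H : ℝ) + w) * iota g H U α T) := by
    rw [gecRate, div_pow, ← pow_mul]
    ring
  rw [e, Real.sqrt_mul (sq_nonneg _), Real.sqrt_sq (by positivity), regretRate]
  ring

lemma gecRate_nonneg [Nonempty A] (T : ℕ) : 0 ≤ gecRate g H U α T := by
  have := iota_nonneg (g := g) (H := H) (U := U) (α := α) T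
  unfold gecRate
  positivity

lemma gecRate_zero : gecRate g H U α 0 = 0 := by simp [gecRate, iota]

lemma one_le_gecRate [Nonempty A] (hg : IsGeneralizedRegular g H U α) (hα : 0 < α) (hH : 1 ≤ H)
    {T : ℕ} (hT : 1 ≤ T) : 1 ≤ gecRate g H U α T := by
  obtain ⟨M, hM⟩ := hg.exists_regularOps
  have h1 : (1 : ℝ) ≤ psrRank g H := by exact_mod_cast one_le_psrRank hg.1 hH
  have hA : (1 : ℝ) ≤ Fintype.card A := by exact_mod_cast Fintype.card_pos
  have h2 : (1 : ℝ) ≤ ((maxCoreActions H U : ℝ) / α) ^ 4 :=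
    one_le_pow₀ ((one_le_div hα).mpr (hM.alpha_le_maxCoreActions hg.1 hα hH))
  have h3 : (1 : ℝ) ≤ H := by exact_mod_cast hH
  have h4 : (1 : ℝ) ≤ iota g H U α T := by
    refine le_trans ?_ (hM.two_mul_log_le_iota hg.1 hα hH T)
    have hT' : (1 : ℝ) ≤ T := by exact_mod_cast hT
    have h5 : Real.log 2 ≤ Real.log (1 + T) := Real.log_le_log two_pos (by linarith)
    linarith [Real.log_two_gt_d9]
  have e : gecRate g H U α T = (psrRank g H : ℝ) * (Fintype.card A : ℝ) ^ 3 *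
      ((maxCoreActions H U : ℝ) / α) ^ 4 * H * iota g H U α T := by
    rw [gecRate, div_pow]
    ring
  rw [e]
  exact one_le_mul_of_one_le_of_one_le (one_le_mul_of_one_le_of_one_le
    (one_le_mul_of_one_le_of_one_le (one_le_mul_of_one_le_of_one_le h1 (one_le_pow₀ hA)) h2) h3) h4

lemma regret_bound_of_le {r ω d G H T : ℝ} (hω : 0 ≤ ω) (hT : 0 ≤ T) (hH : 0 ≤ H)
    (hd : d ≤ 17280 * G) (hG : 1 ≤ G) (hrT : r ≤ T)
    (hr : r ≤ ω + Real.sqrt (ω * T * d) + Real.sqrt (d * H * T)) :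
    r ≤ 265 * Real.sqrt (G * T * (H + ω)) := by
  set Q := Real.sqrt (G * T * (H + ω)) with hQ
  have hQ0 : 0 ≤ Q := Real.sqrt_nonneg _
  have hbase : ω * T ≤ G * T * (H + ω) := by
    have h1 : ω * T ≤ T * (H + ω) := by nlinarith [mul_nonneg hT hH]
    have h2 : 0 ≤ T * (H + ω) := mul_nonneg hT (add_nonneg hH hω)
    nlinarith
  rcases le_total ω T with h | h
  · have h1 : ω ≤ Q := Real.le_sqrt_of_sq_le (le_trans (by nlinarith) hbase)
    have hs : ∀ x, x ≤ 17280 * (G * T * (H + ω)) → Real.sqrt x ≤ 132 * Q := fun x hx => by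
      refine Real.sqrt_le_iff.mpr ⟨by positivity, ?_⟩
      have h0 : 0 ≤ G * T * (H + ω) := le_trans (mul_nonneg hω hT) hbase
      rw [mul_pow, hQ, Real.sq_sqrt h0]
      nlinarith
    have h2 := hs (ω * T * d) (by
      have := mul_le_mul_of_nonneg_left hd (mul_nonneg hω hT)
      have h0 : 0 ≤ G * T * H := by positivity
      nlinarith)
    have h3 := hs (d * H * T) (by
      have := mul_le_mul_of_nonneg_right hd (mul_nonneg hH hT)
      have h0 : 0 ≤ G * T * ω := by positivity
      nlinarith)
    linarith
  · have h1 : T ≤ Q := Real.le_sqrt_of_sq_le (le_trans (by nlinarith) hbase)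
    linarith

end Rates

section Coefficient

variable {O A : Type*} [Fintype O] [Fintype A] [Nonempty A] {H : ℕ} {R : Fin H → O → A → ℝ}
  {U : ℕ → Finset (Test O A)} {𝓗 : Set (Model O A)} {fstar : 𝓗} {optPol : 𝓗 → Policy O A}
  {cont : 𝓗 → ℕ → List A → Policy O A}

/-- The infimum in the definition of the generalized eluder coefficient is attained. -/
lemma sum_le_of_gec_le {T : ℕ} {d₀ : ℝ} (hd₀ : 0 ≤ d₀) (h₀ : ∀ f : Fin T → 𝓗,
      ∑ t, ((f t).1.optValue R - fstar.1.value R (optPol (f t))) ≤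
      Real.sqrt (d₀ * ∑ h : Fin H, ∑ t, ∑ s ∈ Finset.Iio t,
        hellingerSq
          (fun τ : Traj O A H => exploreTrajProb (f t).1 U (optPol (f s)) (cont (f s) h) h τ)
          (fun τ : Traj O A H => exploreTrajProb fstar.1 U (optPol (f s)) (cont (f s) h) h τ))
      + Real.sqrt (d₀ * H * T)) {d : ℝ} (hd : gec R U 𝓗 fstar optPol cont T ≤ d)
    (f : Fin T → 𝓗) :
    ∑ t, ((f t).1.optValue R - fstar.1.value R (optPol (f t))) ≤
      Real.sqrt (d * ∑ t, ∑ s ∈ Finset.Iio t,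
        roundHel (f t).1 fstar.1 U H (optPol (f s)) (cont (f s))) + Real.sqrt (d * H * T) := by
  have hX : ∑ t, ∑ s ∈ Finset.Iio t, roundHel (f t).1 fstar.1 U H (optPol (f s)) (cont (f s)) =
      ∑ h : Fin H, ∑ t, ∑ s ∈ Finset.Iio t, hellingerSq
          (fun τ : Traj O A H => exploreTrajProb (f t).1 U (optPol (f s)) (cont (f s) h) h τ)
          (fun τ : Traj O A H => exploreTrajProb fstar.1 U (optPol (f s)) (cont (f s) h) h τ) := by
    rw [Finset.sum_comm]
    refine Finset.sum_congr rfl fun t _ => ?_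
    rw [Finset.sum_comm]
    rfl
  have hX0 : 0 ≤ ∑ t, ∑ s ∈ Finset.Iio t,
      roundHel (f t).1 fstar.1 U H (optPol (f s)) (cont (f s)) :=
    Finset.sum_nonneg fun _ _ => Finset.sum_nonneg fun _ _ => Finset.sum_nonneg fun _ _ =>
      hellingerSq_nonneg _ _
  set X := ∑ t, ∑ s ∈ Finset.Iio t, roundHel (f t).1 fstar.1 U H (optPol (f s)) (cont (f s))
  have hcont : Continuous fun e : ℝ =>
      Real.sqrt ((d + e) * X) + Real.sqrt ((d + e) * H * T) := by fun_prop
  have ht := (hcont.tendsto 0).mono_left (nhdsWithin_le_nhds (s := Set.Ioi 0))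
  rw [add_zero] at ht
  refine ge_of_tendsto ht ?_
  filter_upwards [self_mem_nhdsWithin] with e he
  have he' : (0 : ℝ) < e := he
  have hde : gec R U 𝓗 fstar optPol cont T < d + e := by linarith
  unfold gec at hde
  obtain ⟨d', ⟨-, hd'⟩, hlt⟩ := exists_lt_of_csInf_lt (by exact ⟨d₀, hd₀, h₀⟩) hde
  refine (hd' f).trans ?_
  rw [← hX]
  gcongr

end Coefficient

section Regret

variable {O A : Type*} [Fintype O] [Fintype A] [Nonempty A] {H : ℕ} {R : Fin H → O → A → ℝ}
  {U : ℕ → Finset (Test O A)} {𝓗 : Set (Model O A)} (fstar : 𝓗) {optPol : 𝓗 → Policy O A}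
  {cont : 𝓗 → ℕ → List A → Policy O A} (p0 : Measure 𝓗) [IsProbabilityMeasure p0]

lemma neg_log_measureReal_nonneg (s : Set 𝓗) : 0 ≤ -Real.log (p0.real s) :=
  neg_nonneg.mpr (Real.log_nonpos measureReal_nonneg measureReal_le_one)

lemma omega_nonneg {c : ℝ} (hc : 0 ≤ c) : 0 ≤ omega R 𝓗 fstar p0 c := by
  refine Real.sInf_nonneg ?_
  rintro r ⟨ε, hε, -, rfl⟩
  have := neg_log_measureReal_nonneg p0 (modelBall R 𝓗 fstar ε)
  nlinarith [mul_nonneg hc hε.le]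

lemma omega_le {c : ℝ} (hc : 0 ≤ c) {ε : ℝ} (hε : 0 < ε) (hp : p0 (modelBall R 𝓗 fstar ε) ≠ 0) :
    omega R 𝓗 fstar p0 c ≤ c * ε - Real.log (p0.real (modelBall R 𝓗 fstar ε)) := by
  refine csInf_le ⟨0, ?_⟩ ⟨ε, hε, hp, rfl⟩
  rintro r ⟨ε, hε, -, rfl⟩
  have := neg_log_measureReal_nonneg p0 (modelBall R 𝓗 fstar ε)
  nlinarith [mul_nonneg hc hε.le]

lemma exists_lt_omega_add (hω : ∃ ε : ℝ, 0 < ε ∧ p0 (modelBall R 𝓗 fstar ε) ≠ 0) (c : ℝ) {ζ : ℝ}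
    (hζ : 0 < ζ) : ∃ ε : ℝ, 0 < ε ∧ p0 (modelBall R 𝓗 fstar ε) ≠ 0 ∧
      c * ε - Real.log (p0.real (modelBall R 𝓗 fstar ε)) < omega R 𝓗 fstar p0 c + ζ := by
  obtain ⟨ε, hε, hp⟩ := hω
  obtain ⟨r, ⟨ε', hε', hp', rfl⟩, hlt⟩ := exists_lt_of_csInf_lt
    (⟨_, ε, hε, hp, rfl⟩ : {r : ℝ | ∃ ε : ℝ, 0 < ε ∧ p0 (modelBall R 𝓗 fstar ε) ≠ 0 ∧
      r = c * ε - Real.log (p0.real (modelBall R 𝓗 fstar ε))}.Nonempty)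
    (show omega R 𝓗 fstar p0 c < omega R 𝓗 fstar p0 c + ζ by linarith)
  exact ⟨ε', hε', hp', hlt⟩

lemma mem_modelBall_self {ε : ℝ} (hε : 0 < ε) : fstar ∈ modelBall R 𝓗 fstar ε := by
  refine ⟨by linarith, iSup_le fun π => ?_⟩
  unfold klDivergence
  rw [if_pos fun _ h => h]
  refine EReal.coe_le_coe_iff.mpr (le_trans (le_of_eq (Finset.sum_eq_zero fun τ _ => ?_)) hε.le)
  change fstar.1.trajProb π τ * Real.log (fstar.1.trajProb π τ / fstar.1.trajProb π τ) = 0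
  by_cases h : fstar.1.trajProb π τ = 0
  · rw [h, zero_mul]
  · rw [div_self h, Real.log_one, mul_zero]

lemma omega_le_log_card (hfin : 𝓗.Finite) (hp : ∀ f : 𝓗, p0 {f} = (Nat.card 𝓗 : ENNReal)⁻¹)
    {c : ℝ} (hc : 0 ≤ c) :
    (∃ ε : ℝ, 0 < ε ∧ p0 (modelBall R 𝓗 fstar ε) ≠ 0) ∧
      omega R 𝓗 fstar p0 c ≤ Real.log (Nat.card 𝓗) := by
  have hle : ∀ ε : ℝ, 0 < ε → (Nat.card 𝓗 : ENNReal)⁻¹ ≤ p0 (modelBall R 𝓗 fstar ε) :=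
    fun ε hε => (hp fstar) ▸ measure_mono (Set.singleton_subset_iff.mpr (mem_modelBall_self fstar hε))
  have hne : ∀ ε : ℝ, 0 < ε → p0 (modelBall R 𝓗 fstar ε) ≠ 0 := fun ε hε h0 => by
    have := hle ε hε
    rw [h0] at this
    simp at this
  have hfi : Finite 𝓗 := hfin
  have hcard : (0 : ℝ) < Nat.card 𝓗 := by
    have : Nonempty 𝓗 := ⟨fstar⟩
    exact_mod_cast Nat.card_pos
  refine ⟨⟨1, one_pos, hne 1 one_pos⟩, le_of_forall_pos_le_add fun δ hδ => ?_⟩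
  have hε : 0 < δ / (c + 1) := by positivity
  refine (omega_le fstar p0 hc hε (hne _ hε)).trans ?_
  have h1 : (Nat.card 𝓗 : ℝ)⁻¹ ≤ p0.real (modelBall R 𝓗 fstar (δ / (c + 1))) := by
    have := ENNReal.toReal_mono (measure_ne_top _ _) (hle _ hε)
    simpa [Measure.real] using this
  have h2 := Real.log_le_log (inv_pos.mpr hcard) h1
  rw [Real.log_inv] at h2
  have h3 : c * (δ / (c + 1)) ≤ δ := by
    rw [mul_div_assoc', div_le_iff₀ (by positivity)]
    nlinarith
  linarith

variable (hR : ∀ i o a, 0 ≤ R i o a) (hR1 : ∀ τ : Traj O A H, ∑ i, R i (τ i).1 (τ i).2 ≤ 1)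
  (hopt : ∀ (f : 𝓗) (π : Policy O A), f.1.value R π ≤ f.1.value R (optPol f))
  (hoptm : ∀ τ o a, Measurable fun f => (optPol f).act τ o a)
  (hcontm : ∀ h acts τ o a, Measurable fun f => (cont f h acts).act τ o a)
  (hU : ∀ h : Fin H, (coreActions U (h + 1)).Nonempty)

include hR hR1 hopt hoptm in
lemma ae_optValue_le_of_omega_eq_zero (hω : ∃ ε : ℝ, 0 < ε ∧ p0 (modelBall R 𝓗 fstar ε) ≠ 0)
    {c : ℝ} (hc : 0 < c) (h0 : omega R 𝓗 fstar p0 c = 0) :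
    ∀ᵐ f ∂p0, fstar.1.optValue R ≤ f.1.optValue R := by
  have hv := (bddMeas_optValue hR hR1 hopt hoptm).meas
  have hη : ∀ n : ℕ, ∀ᵐ f ∂p0, fstar.1.optValue R - f.1.optValue R ≤ 1 / ((n : ℝ) + 1) := by
    intro n
    have hn : (0 : ℝ) < 1 / ((n : ℝ) + 1) := by positivity
    have hms : MeasurableSet {f : 𝓗 | fstar.1.optValue R - f.1.optValue R ≤ 1 / ((n : ℝ) + 1)} :=
      measurableSet_le (measurable_const.sub hv) measurable_const
    have h1 : (1 : ℝ) ≤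
        p0.real {f : 𝓗 | fstar.1.optValue R - f.1.optValue R ≤ 1 / ((n : ℝ) + 1)} := by
      refine le_of_forall_pos_le_add fun δ hδ => ?_
      obtain ⟨ε, hε, hp, hlt⟩ := exists_lt_omega_add fstar p0 hω c
        (lt_min hδ (mul_pos hc hn))
      rw [h0, zero_add] at hlt
      have hlog := neg_log_measureReal_nonneg p0 (modelBall R 𝓗 fstar ε)
      have hcε := mul_pos hc hε
      have h2 : ε ≤ 1 / ((n : ℝ) + 1) := by
        have := hlt.trans_le (min_le_right _ _)
        exact le_of_mul_le_mul_left (by linarith) hc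
      have h3 := hlt.trans_le (min_le_left _ _)
      have h4 : 1 - δ ≤ p0.real (modelBall R 𝓗 fstar ε) := by
        have hpos : 0 < p0.real (modelBall R 𝓗 fstar ε) :=
          ENNReal.toReal_pos hp (measure_ne_top _ _)
        have := Real.log_le_sub_one_of_pos hpos
        linarith
      have h5 : p0.real (modelBall R 𝓗 fstar ε) ≤
          p0.real {f : 𝓗 | fstar.1.optValue R - f.1.optValue R ≤ 1 / ((n : ℝ) + 1)} :=
        measureReal_mono fun f hf => hf.1.trans h2
      linarith
    have h2 : p0 {f : 𝓗 | fstar.1.optValue R - f.1.optValue R ≤ 1 / ((n : ℝ) + 1)} = 1 := by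
      have h3 : p0.real {f : 𝓗 | fstar.1.optValue R - f.1.optValue R ≤ 1 / ((n : ℝ) + 1)} = 1 :=
        le_antisymm measureReal_le_one h1
      rwa [Measure.real, ENNReal.toReal_eq_one_iff] at h3
    exact (mem_ae_iff_prob_eq_one hms).mpr h2
  filter_upwards [ae_all_iff.mpr hη] with f hf
  have := ge_of_tendsto' tendsto_one_div_add_atTop_nhds_zero_nat hf
  linarith

include hR hR1 hoptm in
lemma bddMeas_regret (T : ℕ) : BddMeas fun ρ : Fin T → 𝓗 × RoundData O A H =>
    ∑ t, (fstar.1.optValue R - fstar.1.value R (optPol (ρ t).1)) := by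
  refine BddMeas.sum _ fun t _ => (BddMeas.const _).sub
    (BddMeas.comp (f := fun f => fstar.1.value R (optPol f)) ?_
      (measurable_fst.comp (measurable_pi_apply t)))
  refine BddMeas.mk' (C := 1) (measurable_value measurable_const hoptm) fun f => ?_
  rw [abs_of_nonneg (fstar.1.value_nonneg hR _)]
  exact fstar.1.value_le_one hR1 _

include hR hR1 hopt hoptm hcontm hU

/-- The expected regret of optimistic posterior sampling, with a free trade-off parameter `β`. -/
lemma expectedRegret_le_of_pos {T : ℕ} {d : ℝ}
    (hd : ∀ f : Fin T → 𝓗, ∑ t, ((f t).1.optValue R - fstar.1.value R (optPol (f t))) ≤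
      Real.sqrt (d * ∑ t, ∑ s ∈ Finset.Iio t,
        roundHel (f t).1 fstar.1 U H (optPol (f s)) (cont (f s))) + Real.sqrt (d * H * T))
    {γ : ℝ} (hγ : 0 ≤ γ) (hd0 : 0 ≤ d) {β : ℝ} (hβ0 : 0 < β)
    (hβ : ∀ᵐ f ∂p0, β * (fstar.1.optValue R - f.1.optValue R) ≤
      γ * (fstar.1.optValue R - f.1.optValue R))
    {ε : ℝ} (hε : 0 < ε) (hp : p0 (modelBall R 𝓗 fstar ε) ≠ 0) :
    expectedRegret R U 𝓗 fstar optPol cont p0 (1 / 2) γ T ≤ T ∧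
    expectedRegret R U 𝓗 fstar optPol cont p0 (1 / 2) γ T ≤
      β⁻¹ * (T * (γ * ε + (H * T * ε - Real.log (p0.real (modelBall R 𝓗 fstar ε))))) +
        (β * d / 4 + Real.sqrt (d * H * T)) := by
  obtain ⟨hprob, hint⟩ := integral_regret_terms_le fstar p0 hR hR1 hopt hoptm hcontm hU hγ hβ hε hp T
  have hreg := bddMeas_regret fstar hR hR1 hoptm T
  set μ := runLaw R U 𝓗 fstar optPol cont p0 (1 / 2) γ T
  constructor
  · have h1 := integral_mono (hreg.integrable μ) (integrable_const (T : ℝ)) fun ρ => by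
      have h2 : ∀ t ∈ Finset.univ, fstar.1.optValue R - fstar.1.value R (optPol (ρ t).1) ≤ 1 :=
        fun t _ => by
          rw [Model.optValue_eq (hopt fstar)]
          linarith [fstar.1.value_le_one hR1 (optPol fstar),
            fstar.1.value_nonneg hR (optPol (ρ t).1)]
      simpa using Finset.sum_le_card_nsmul _ _ _ h2
    exact h1.trans_eq (by simp)
  have hv := bddMeas_optValue hR hR1 hopt hoptm
  have hterms : BddMeas fun ρ : Fin T → 𝓗 × RoundData O A H =>
      ∑ t : Fin T, (β * (fstar.1.optValue R - (ρ t).1.1.optValue R) +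
        ∑ s ∈ Finset.Iio t, roundHel (ρ t).1.1 fstar.1 U H (optPol (ρ s).1) (cont (ρ s).1)) := by
    refine BddMeas.sum _ fun t _ => BddMeas.add (BddMeas.const_mul _ ((BddMeas.const _).sub
      (hv.comp (measurable_fst.comp (measurable_pi_apply t))))) (BddMeas.sum _ fun s _ => ?_)
    exact (bddMeas_roundHel fstar hoptm hcontm hU).comp
      (φ := fun ρ : Fin T → 𝓗 × RoundData O A H => ((ρ t).1, (ρ s).1)) (by fun_prop)
  have hpt : ∀ ρ : Fin T → 𝓗 × RoundData O A H,
      ∑ t, (fstar.1.optValue R - fstar.1.value R (optPol (ρ t).1)) ≤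
      β⁻¹ * (∑ t : Fin T, (β * (fstar.1.optValue R - (ρ t).1.1.optValue R) +
        ∑ s ∈ Finset.Iio t, roundHel (ρ t).1.1 fstar.1 U H (optPol (ρ s).1) (cont (ρ s).1))) +
        (β * d / 4 + Real.sqrt (d * H * T)) := by
    intro ρ
    have h1 := hd fun t => (ρ t).1
    rw [Finset.sum_add_distrib, ← Finset.mul_sum, mul_add, inv_mul_cancel_left₀ hβ0.ne']
    have hX0 : 0 ≤ ∑ t, ∑ s ∈ Finset.Iio t,
        roundHel (ρ t).1.1 fstar.1 U H (optPol (ρ s).1) (cont (ρ s).1) :=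
      Finset.sum_nonneg fun _ _ => Finset.sum_nonneg fun _ _ => Finset.sum_nonneg fun _ _ =>
        hellingerSq_nonneg _ _
    set X := ∑ t, ∑ s ∈ Finset.Iio t,
      roundHel (ρ t).1.1 fstar.1 U H (optPol (ρ s).1) (cont (ρ s).1)
    have h2 : Real.sqrt (d * X) ≤ β⁻¹ * X + β * d / 4 := by
      refine Real.sqrt_le_iff.mpr ⟨by positivity, ?_⟩
      have h3 : β⁻¹ * X * (β * d / 4) = d * X / 4 := by field_simp
      nlinarith [sq_nonneg (β⁻¹ * X - β * d / 4)]
    simp only [Finset.sum_sub_distrib] at h1 ⊢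
    linarith
  have h1 := integral_mono (hreg.integrable μ) (((hterms.const_mul β⁻¹).add
    (BddMeas.const (β * d / 4 + Real.sqrt (d * H * T)))).integrable μ) hpt
  rw [integral_add ((hterms.const_mul β⁻¹).integrable μ) (integrable_const _),
    integral_const_mul] at h1
  simp only [integral_const, probReal_univ, one_smul] at h1
  exact h1.trans (add_le_add_left (mul_le_mul_of_nonneg_left hint (inv_pos.mpr hβ0).le) _)

theorem expectedRegret_le {T : ℕ} (hH : 1 ≤ H) (hT : 1 ≤ T) {d : ℝ} (hd0 : 0 < d)
    (hd : ∀ f : Fin T → 𝓗, ∑ t, ((f t).1.optValue R - fstar.1.value R (optPol (f t))) ≤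
      Real.sqrt (d * ∑ t, ∑ s ∈ Finset.Iio t,
        roundHel (f t).1 fstar.1 U H (optPol (f s)) (cont (f s))) + Real.sqrt (d * H * T))
    (hω : ∃ ε : ℝ, 0 < ε ∧ p0 (modelBall R 𝓗 fstar ε) ≠ 0) {γ : ℝ}
    (hγ : γ = 2 * Real.sqrt (omega R 𝓗 fstar p0 (H * T) * T / d)) :
    expectedRegret R U 𝓗 fstar optPol cont p0 (1 / 2) γ T ≤ T ∧
    expectedRegret R U 𝓗 fstar optPol cont p0 (1 / 2) γ T ≤
      omega R 𝓗 fstar p0 (H * T) + Real.sqrt (omega R 𝓗 fstar p0 (H * T) * T * d) +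
        Real.sqrt (d * H * T) := by
  have hH1 : (1 : ℝ) ≤ H := by exact_mod_cast hH
  have hT1 : (1 : ℝ) ≤ T := by exact_mod_cast hT
  have hω0 : 0 ≤ omega R 𝓗 fstar p0 (H * T) := omega_nonneg fstar p0 (by positivity)
  have hγ0 : 0 ≤ γ := by rw [hγ]; positivity
  have key := fun (β : ℝ) (hβ0 : 0 < β) hβ (ε : ℝ) (hε : 0 < ε) hp =>
    expectedRegret_le_of_pos fstar p0 hR hR1 hopt hoptm hcontm hU hd hγ0 hd0.le (β := β) hβ0 hβ
      (ε := ε) hε hp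
  set ω := omega R 𝓗 fstar p0 (H * T) with hωd
  rcases hγ0.eq_or_lt with h0 | hpos
  · have hz : ω = 0 := by
      have h1 : Real.sqrt (ω * T / d) = 0 := by linarith
      rw [Real.sqrt_eq_zero (by positivity), div_eq_zero_iff, or_iff_left hd0.ne',
        mul_eq_zero, or_iff_left (by positivity)] at h1
      exact h1
    have hae := ae_optValue_le_of_omega_eq_zero fstar p0 hR hR1 hopt hoptm hω
      (show (0 : ℝ) < H * T by positivity) hz
    have hβ : ∀ β : ℝ, 0 < β → ∀ᵐ f ∂p0, β * (fstar.1.optValue R - f.1.optValue R) ≤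
        γ * (fstar.1.optValue R - f.1.optValue R) := fun β hβ => by
      filter_upwards [hae] with f hf
      rw [← h0, zero_mul]
      exact mul_nonpos_of_nonneg_of_nonpos hβ.le (by linarith)
    constructor
    · obtain ⟨ε, hε, hp⟩ := hω
      exact (key 1 one_pos (hβ 1 one_pos) ε hε hp).1
    refine le_of_forall_pos_le_add fun δ hδ => ?_
    have hb : 0 < 2 * δ / d := by positivity
    obtain ⟨ε, hε, hp, hlt⟩ := exists_lt_omega_add fstar p0 hω (H * T)
      (show 0 < 2 * δ / d * δ / (2 * T) by positivity)
    rw [← hωd, hz, zero_add] at hlt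
    refine ((key _ hb (hβ _ hb) ε hε hp).2).trans ?_
    rw [← h0, hz, zero_mul, zero_mul, zero_mul, Real.sqrt_zero]
    have h2 : (2 * δ / d)⁻¹ * (T * (0 + (H * T * ε -
        Real.log (p0.real (modelBall R 𝓗 fstar ε))))) ≤
        (2 * δ / d)⁻¹ * (T * (2 * δ / d * δ / (2 * T))) := by
      rw [zero_add]
      gcongr
    have h3 : (2 * δ / d)⁻¹ * (T * (2 * δ / d * δ / (2 * T))) = δ / 2 := by field_simp
    have h4 : 2 * δ / d * d / 4 = δ / 2 := by field_simp; norm_num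
    linarith
  · have hβ : ∀ᵐ f ∂p0, γ * (fstar.1.optValue R - f.1.optValue R) ≤
        γ * (fstar.1.optValue R - f.1.optValue R) := Filter.Eventually.of_forall fun _ => le_rfl
    constructor
    · obtain ⟨ε, hε, hp⟩ := hω
      exact (key γ hpos hβ ε hε hp).1
    refine le_of_forall_pos_le_add fun δ hδ => ?_
    obtain ⟨ε, hε, hp, hlt⟩ := exists_lt_omega_add fstar p0 hω (H * T)
      (show 0 < δ / (1 + γ⁻¹ * T) by positivity)
    refine ((key γ hpos hβ ε hε hp).2).trans ?_
    rw [← hωd] at hlt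
    set L := H * T * ε - Real.log (p0.real (modelBall R 𝓗 fstar ε)) with hL
    have h1 : T * ε ≤ L := by
      have := neg_log_measureReal_nonneg p0 (modelBall R 𝓗 fstar ε)
      have h2 : 1 * (T * ε) ≤ H * (T * ε) := mul_le_mul_of_nonneg_right hH1 (by positivity)
      rw [hL]
      linarith
    have h2 : γ⁻¹ * (T * (γ * ε + L)) = T * ε + γ⁻¹ * T * L := by field_simp
    have h3 : L * (1 + γ⁻¹ * T) ≤ ω * (1 + γ⁻¹ * T) + δ := by
      have := mul_le_mul_of_nonneg_right hlt.le (show 0 ≤ 1 + γ⁻¹ * (T : ℝ) by positivity)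
      rwa [add_mul, div_mul_cancel₀ _ (show 1 + γ⁻¹ * (T : ℝ) ≠ 0 by positivity)] at this
    have h4 : γ⁻¹ * T * ω + γ * d / 4 = Real.sqrt (ω * T * d) := by
      set s := Real.sqrt (ω * T / d) with hs
      have hs0 : 0 < s := by linarith
      have hsq : s ^ 2 = ω * T / d := Real.sq_sqrt (by positivity)
      have hωT : ω * T = d * s ^ 2 := by rw [hsq]; field_simp
      have h5 : ω * T * d = (d * s) ^ 2 := by rw [hωT]; ring
      rw [h5, Real.sqrt_sq (by positivity), hγ]
      have h6 : (2 * s)⁻¹ * T * ω = (2 * s)⁻¹ * (d * s ^ 2) := by rw [← hωT]; ring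
      rw [h6]
      field_simp
      ring
    rw [h2]
    linarith

end Regret

end PSR

open PSR MeasureTheory

theorem mainTheorem5 :
    ∃ C₁ C₂ : ℝ, 0 < C₁ ∧ 0 < C₂ ∧
    ∀ {O A : Type*} [Fintype O] [Fintype A] [Nonempty A] (H T : ℕ), 1 ≤ H →
    ∀ (R : Fin H → O → A → ℝ), (∀ i o a, 0 ≤ R i o a) →
      (∀ τ : Traj O A H, ∑ i, R i (τ i).1 (τ i).2 ≤ 1) →
    ∀ (U : ℕ → Finset (Test O A)) (α : ℝ), 0 < α →
    ∀ (𝓗 : Set (Model O A)), (∀ f ∈ 𝓗, IsGeneralizedRegular f H U α) →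
    ∀ (fstar : 𝓗) (optPol : 𝓗 → Policy O A),
      (∀ (f : 𝓗) (π : Policy O A), f.1.value R π ≤ f.1.value R (optPol f)) →
      (∀ τ o a, Measurable fun f => (optPol f).act τ o a) →
    ∀ (cont : 𝓗 → ℕ → List A → Policy O A),
      (∀ h acts τ o a, Measurable fun f => (cont f h acts).act τ o a) →
    ∀ (p0 : Measure 𝓗) [IsProbabilityMeasure p0],
      gec R U 𝓗 fstar optPol cont T ≤ C₁ * gecRate fstar.1 H U α T ∧
      ∀ d : ℝ, 0 < d → gec R U 𝓗 fstar optPol cont T ≤ d → d ≤ C₁ * gecRate fstar.1 H U α T →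
      ∀ γ : ℝ, γ = 2 * Real.sqrt (omega R 𝓗 fstar p0 (H * T) * T / d) →
        ((∃ ε : ℝ, 0 < ε ∧ p0 (modelBall R 𝓗 fstar ε) ≠ 0) →
          expectedRegret R U 𝓗 fstar optPol cont p0 (1 / 2) γ T
            ≤ C₂ * regretRate fstar.1 H U α T T (omega R 𝓗 fstar p0 (H * T)) ∧
          H * expectedRegret R U 𝓗 fstar optPol cont p0 (1 / 2) γ T
            ≤ C₂ * regretRate fstar.1 H U α T (H * T) (omega R 𝓗 fstar p0 (H * T))) ∧
        (𝓗.Finite → (∀ f : 𝓗, p0 {f} = (Nat.card 𝓗 : ENNReal)⁻¹) →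
          expectedRegret R U 𝓗 fstar optPol cont p0 (1 / 2) γ T
            ≤ C₂ * regretRate fstar.1 H U α T T (Real.log (Nat.card 𝓗)) ∧
          H * expectedRegret R U 𝓗 fstar optPol cont p0 (1 / 2) γ T
            ≤ C₂ * regretRate fstar.1 H U α T (H * T) (Real.log (Nat.card 𝓗))) := by
  refine ⟨17280, 265, by norm_num, by norm_num, ?_⟩
  intro O A _ _ _ H T hH R hR hR1 U α hα 𝓗 h𝓗 fstar optPol hopt hoptm cont hcontm p0 _
  have hmem := gecRate_mem hH hR hR1 hα h𝓗 fstar optPol hopt cont T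
  have hrate : 0 ≤ 17280 * gecRate fstar.1 H U α T := mul_nonneg (by norm_num) (gecRate_nonneg T)
  refine ⟨csInf_le ⟨0, fun d hd => hd.1⟩ ⟨hrate, hmem⟩, ?_⟩
  intro d hd0 hgd hd γ hγ
  have hT : 1 ≤ T := by
    by_contra h
    obtain rfl : T = 0 := by omega
    rw [gecRate_zero] at hd
    linarith
  have hU : ∀ h : Fin H, (coreActions U (h + 1)).Nonempty := fun h => coreActions_nonempty
    (exists_coreTest (h𝓗 _ fstar.2).1 (Finset.mem_Icc.mpr ⟨by omega, by omega⟩))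
  have hH1 : (1 : ℝ) ≤ H := by exact_mod_cast hH
  have hG := one_le_gecRate (h𝓗 _ fstar.2) hα hH hT
  have hω0 : 0 ≤ omega R 𝓗 fstar p0 (H * T) := omega_nonneg fstar p0 (by positivity)
  have hbound : (∃ ε : ℝ, 0 < ε ∧ p0 (modelBall R 𝓗 fstar ε) ≠ 0) → ∀ w : ℝ,
      omega R 𝓗 fstar p0 (H * T) ≤ w →
      expectedRegret R U 𝓗 fstar optPol cont p0 (1 / 2) γ T ≤ 265 * regretRate fstar.1 H U α T T w ∧
      H * expectedRegret R U 𝓗 fstar optPol cont p0 (1 / 2) γ T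
        ≤ 265 * regretRate fstar.1 H U α T (H * T) w := by
    intro hω w hw
    obtain ⟨hr1, hr2⟩ := expectedRegret_le fstar p0 hR hR1 hopt hoptm hcontm hU hH hT hd0
      (sum_le_of_gec_le hrate hmem hgd) hω hγ
    have hr := regret_bound_of_le hω0 (Nat.cast_nonneg T) (Nat.cast_nonneg H) hd hG hr1 hr2
    have hw0 : 0 ≤ w := hω0.trans hw
    have hr' : expectedRegret R U 𝓗 fstar optPol cont p0 (1 / 2) γ T ≤
        265 * Real.sqrt (gecRate fstar.1 H U α T * T * (H + w)) := hr.trans (by gcongr)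
    have h0 : 0 ≤ gecRate fstar.1 H U α T * T * (H + w) := by positivity
    rw [regretRate_eq_sqrt, regretRate_eq_sqrt]
    constructor
    · refine hr'.trans (mul_le_mul_of_nonneg_left (Real.sqrt_le_sqrt ?_) (by norm_num))
      nlinarith
    · have e : gecRate fstar.1 H U α T * H * (H * T) * (H + w) =
          (H : ℝ) ^ 2 * (gecRate fstar.1 H U α T * T * (H + w)) := by ring
      rw [e, Real.sqrt_mul (sq_nonneg _), Real.sqrt_sq (Nat.cast_nonneg H)]
      have := mul_le_mul_of_nonneg_left hr' (Nat.cast_nonneg (α := ℝ) H)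
      linarith
  refine ⟨fun hω => hbound hω _ le_rfl, fun hfin hp => ?_⟩
  obtain ⟨hω, hle⟩ := omega_le_log_card (R := R) fstar p0 hfin hp
    (c := H * T) (by positivity)
  exact hbound hω _ hle
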